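/- \textbf{Setting.} Let $A$ be a binomial domain (an integral domain of characteristic $0$ closed under binomial coefficients $\binom{\alpha}{n}$) and let $G$ be an $A$-exponential nilpotent group in the sense of P. Hall that is finitely generated as an $A$-group. Let $$G=R_1\ge R_2\ge\dots\ge R_c\ge R_{c+1}=1\qquad (R)$$ be a central series ($[R_i,G]\le R_{i+1}$) whose terms are definable in $G$ uniformly with respect to $Th(G)$: $R_i$ is defined in $G$ by a parameter-free formula $\rho_i(x)$ of the language of groups. In every group $H\equiv G$ the same formulas define a central series, again denoted $(R)$. Assume that $A$ is Noetherian (for instance a PID) or that all $R_i$ are $A$-subgroups of $G$. \textbf{Constructions}, for any group $G$ with a central series $(R)$. Put $R^u_i=\{x:[x,G]\subseteq[R_i,G]\}$, $R^l_1=G$ and $R^l_i=[R_{i-1},G]$ for $2\le i\le c+1$; then $R^u_c=Z(G)$, $R^l_2=G'$ and $R^l_{c+1}=1$ (for $c\ge 1$). Let $V_R=\bigcap_{i=1}^{c-1}\{x:[x,R^u_i]\subseteq R^l_{i+2}\}\ge G'Z(G)$. Commutation induces the full non-degenerate bilinear map $$F_R:\ G/V_R\times\bigoplus_{i=1}^{c-1}R^u_i/R^u_{i+1}\to\bigoplus_{i=1}^{c-1}R^l_{i+1}/R^l_{i+2},$$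 and $P_R$ is the ring of all triples $(\varphi_1,\varphi_2,\varphi_0)$ of endomorphisms of the three abelian groups with $F_R(\varphi_1x,y)=F_R(x,\varphi_2y)=\varphi_0F_R(x,y)$. It acts on $G/V_R$ and on each summand. $PL_R\le P_R$ is the largest subring over which the canonical maps $R^l_i/R^l_{i+1}\to R^u_i/R^u_{i+1}$, $2\le i\le c-1$, are linear. The refined upper and lower series are $$G=R^u_1\ge\dots\ge R^u_c=Z(G)\ge R^l_2\cap Z(G)\ge\dots\ge R^l_{c+1}\cap Z(G)=1\qquad (U(R)),$$ $$G\ge V_R=(V_R\cap R^u_1)G'\ge\dots\ge(V_R\cap R^u_c)G'=Z(G)G'\ge G'=R^l_2\ge\dots\ge R^l_{c+1}=1\qquad (L(R)).$$ Put $T_i=(R^l_i\cap Z(G))/(R^l_{i+1}\cap Z(G))$ for $2\le i\le c$, and, for $1\le i\le c-1$, $D_i=(V_R\cap R^u_i)/(V_R\cap R^u_{i+1})$ and $X_i=(V_R\cap R^u_i)G'/(V_R\cap R^u_{i+1})G'$, with the canonical maps $\varepsilon_i:T_i\hookrightarrow R^l_i/R^l_{i+1}$, $\delta_i:D_i\hookrightarrow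 R^u_i/R^u_{i+1}$ and $q_i:D_i\twoheadrightarrow X_i$. Let $AE_R$ be the largest subring of $PL_R$ leaving all $\varepsilon_i(T_i)$ invariant, $\widehat{AD}_R$ the largest one leaving all $\delta_i(D_i)$ invariant, and $AD_R$ the largest one leaving all $\delta_i(D_i)$ and all $\delta_i(\ker q_i)$ invariant. Put $A_R(G)=AE_R\cap AD_R\ \le\ \widehat A_R(G)=AE_R\cap\widehat{AD}_R$ (these agree if all $q_i$ are isomorphisms). Then $A_R(G)$ acts on all quotients of $U(R)$ and $L(R)$ except the special gap $Z(G)/(Z(G)\cap G')\cong Z(G)G'/G'$: via $\varepsilon_i$ on $T_i$, and via $\delta_i$ and $q_i$ on $X_i$. Likewise $\widehat A_R(G)$ acts on these quotients, with $D_i$ in place of $X_i$. \textbf{Proposition.} There are parameter-free formulas of the language of groups which, simultaneously in all groups $H\equiv G$ with the series given by the $\rho_i$, do the following: \begin{enumerate} \item they define all terms of $U(R)$; \item they define all terms of $L(R)$; \item they interpret the ring $A_R(H)$ (in tuples of some fixed length $n$) and, using this interpretation of the ring and representatives for elements of the quotients, they define the action of $A_R(H)$ on \begin{itemize} \item[(a)]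 all quotients of $U(R)$ except the special gap $Z(H)/(Z(H)\cap H')$, namely $R^u_i/R^u_{i+1}$ for $1\le i\le c-1$ and $T_i$ for $2\le i\le c$; \item[(b)] all quotients of $L(R)$ except the special gap $Z(H)H'/H'$, namely $G/V_R$ (formed in $H$), $X_i$ for $1\le i\le c-1$ and $R^l_i/R^l_{i+1}$ for $2\le i\le c$. \end{itemize} The same holds for the ring $\widehat A_R(H)$, with $D_i$ in place of $X_i$ in (b). \end{enumerate} -/

import Mathlib

open FirstOrder
open scoped commutatorElement

namespace NilScalars

/-! ### Groups with exponents in a binomial ring (P. Hall) -/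

section Exponents

/-- The Petresco words `τ_k(x₁, …, xₙ)`, evaluated in a group. They are determined by
`x₁ᵏ ⋯ xₙᵏ = τ₁^(k choose 1) τ₂^(k choose 2) ⋯ τ_k^(k choose k)` for all `k ≥ 1`; here `τ₀ = 1`. -/
def petresco {G : Type*} [Group G] (xs : List G) (k : ℕ) : G :=
  ((List.ofFn fun j : Fin k => petresco xs j ^ k.choose j).prod)⁻¹ * (xs.map (· ^ k)).prod
termination_by k
decreasing_by exact j.2

/-- `A`-exponential nilpotent groups in the sense of P. Hall. -/
class ExpGroup (A : Type*) [CommRing A] [BinomialRing A]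
    (G : Type*) [Group G] [Group.IsNilpotent G] where
  /-- `expo g α` is the power `g ^ α`. -/
  expo : G → A → G
  expo_one : ∀ g, expo g 1 = g
  expo_add : ∀ g α β, expo g (α + β) = expo g α * expo g β
  expo_mul : ∀ g α β, expo g (α * β) = expo (expo g α) β
  expo_conj : ∀ g h α, expo (h⁻¹ * g * h) α = h⁻¹ * expo g α * h
  hall_petresco : ∀ (xs : List G) (α : A),
    (xs.map fun g => expo g α).prod =
      (List.ofFn fun j : Fin (Group.nilpotencyClass G + 1) =>
        expo (petresco xs j) (Ring.choose α (j : ℕ))).prod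

variable (A : Type*) [CommRing A] [BinomialRing A]
  {G : Type*} [Group G] [Group.IsNilpotent G] [ExpGroup A G]

/-- A subgroup is an `A`-subgroup if it is closed under all powers with exponents in `A`. -/
def IsExpSubgroup (K : Subgroup G) : Prop :=
  ∀ g ∈ K, ∀ α : A, ExpGroup.expo g α ∈ K

variable (G) in
/-- `G` is finitely generated as an `A`-group. -/
def ExpFG : Prop :=
  ∃ X : Finset G, ∀ K : Subgroup G, (X : Set G) ⊆ K → IsExpSubgroup A K → K = ⊤

end Exponents

/-! ### Rings of operators on abelian groups -/

section Rings

variable {M₁ M₂ N : Type*} [AddCommGroup M₁] [AddCommGroup M₂] [AddCommGroup N]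

/-- The largest ring of scalars `P(f)` of a bilinear map `f`: all triples `(φ₁, φ₂, φ₀)` of
endomorphisms such that `f (φ₁ x) y = f x (φ₂ y) = φ₀ (f x y)`. -/
def largestRing (f : M₁ →+ M₂ →+ N) :
    Subring (AddMonoid.End M₁ × AddMonoid.End M₂ × AddMonoid.End N) where
  carrier := {φ | ∀ x y, f (φ.1 x) y = f x (φ.2.1 y) ∧ f x (φ.2.1 y) = φ.2.2 (f x y)}
  one_mem' := fun x y => ⟨rfl, rfl⟩
  zero_mem' := fun x y => by simp
  add_mem' := by
    intro φ ψ hφ hψ x y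
    have h1 := hφ x y
    have h2 := hψ x y
    change f (φ.1 x + ψ.1 x) y = f x (φ.2.1 y + ψ.2.1 y) ∧
      f x (φ.2.1 y + ψ.2.1 y) = φ.2.2 (f x y) + ψ.2.2 (f x y)
    rw [map_add, map_add, AddMonoidHom.add_apply, h1.1, h2.1, h1.2, h2.2]
    exact ⟨rfl, rfl⟩
  neg_mem' := by
    intro φ hφ x y
    have h1 := hφ x y
    change f (-φ.1 x) y = f x (-φ.2.1 y) ∧ f x (-φ.2.1 y) = -φ.2.2 (f x y)
    rw [map_neg, map_neg, AddMonoidHom.neg_apply, h1.1, h1.2]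
    exact ⟨rfl, rfl⟩
  mul_mem' := by
    intro φ ψ hφ hψ x y
    have a1 := hφ (ψ.1 x) y
    have a2 := hψ x y
    have a3 := hφ x (ψ.2.1 y)
    have a4 := congrArg φ.2.2 a2.1
    have a5 := congrArg φ.2.2 a2.2
    change f (φ.1 (ψ.1 x)) y = f x (φ.2.1 (ψ.2.1 y)) ∧
      f x (φ.2.1 (ψ.2.1 y)) = φ.2.2 (ψ.2.2 (f x y))
    constructor
    · rw [a1.1, a1.2, a3.2, a4]
    · rw [a3.2, a5]

variable {B : Type*} [Ring B] {M D X : Type*} [AddCommGroup M] [AddCommGroup D] [AddCommGroup X]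

/-- The largest subring of `B` that leaves the subgroup `W` of the `B`-module `M` invariant. -/
def stabilizer (θ : B →+* AddMonoid.End M) (W : AddSubgroup M) : Subring B where
  carrier := {b | ∀ w ∈ W, θ b w ∈ W}
  one_mem' := fun w hw => by simpa using hw
  zero_mem' := fun w _ => by simp
  add_mem' := fun {a b} ha hb w hw => by
    rw [map_add]; exact W.add_mem (ha w hw) (hb w hw)
  neg_mem' := fun {a} ha w hw => by
    rw [map_neg]; exact W.neg_mem (ha w hw)
  mul_mem' := fun {a b} ha hb w hw => by
    rw [map_mul]; exact ha _ (hb w hw)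

/-- The largest subring of `B` over which the homomorphism `e` is linear. -/
def linearizer (θ : B →+* AddMonoid.End M) (η : B →+* AddMonoid.End N) (e : M →+ N) :
    Subring B where
  carrier := {b | ∀ x, e (θ b x) = η b (e x)}
  one_mem' := fun w => by simp
  zero_mem' := fun w => by simp
  add_mem' := fun {a b} ha hb w => by
    rw [map_add, map_add]
    exact (map_add e _ _).trans (congrArg₂ (· + ·) (ha w) (hb w))
  neg_mem' := fun {a} ha w => by
    rw [map_neg, map_neg]
    exact (map_neg e _).trans (congrArg (- ·) (ha w))
  mul_mem' := fun {a b} ha hb w => by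
    rw [map_mul, map_mul]
    exact (ha (θ b w)).trans (congrArg (η a) (hb w))

/-- The action on `D` for which an embedding `m : D → M` with invariant image is linear:
`b • d = m⁻¹ (b • m d)`. -/
noncomputable def restrictAct (θ : B →+* AddMonoid.End M) (m : D →+ M)
    (hm : Function.Injective m) (h : ∀ b, ∀ w ∈ m.range, θ b w ∈ m.range) :
    B →+* AddMonoid.End D :=
  have key : ∀ b d, ∃ d', m d' = θ b (m d) := fun b d => h b _ ⟨d, rfl⟩
  { toFun := fun b => AddMonoidHom.mk' (fun d => (key b d).choose) fun d d' => hm (by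
      refine (key b (d + d')).choose_spec.trans ?_
      rw [map_add m (key b d).choose, (key b d).choose_spec, (key b d').choose_spec, map_add,
        map_add])
    map_one' := by
      ext d
      apply hm
      exact (key 1 d).choose_spec.trans (by simp)
    map_zero' := by
      ext d
      apply hm
      exact (key 0 d).choose_spec.trans (by simp)
    map_add' := by
      intro a b
      ext d
      apply hm
      refine (key (a + b) d).choose_spec.trans ?_
      change _ = m ((key a d).choose + (key b d).choose)
      rw [map_add m, (key a d).choose_spec, (key b d).choose_spec, map_add]
      rfl
    map_mul' := by
      intro a b
      ext d
      apply hm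
      refine (key (a * b) d).choose_spec.trans ?_
      change _ = m (key a (key b d).choose).choose
      rw [(key a _).choose_spec, (key b d).choose_spec, map_mul]
      rfl }

theorem restrictAct_spec (θ : B →+* AddMonoid.End M) (m : D →+ M)
    (hm : Function.Injective m) (h : ∀ b, ∀ w ∈ m.range, θ b w ∈ m.range) (b : B) (d : D) :
    m (restrictAct θ m hm h b d) = θ b (m d) :=
  (h b _ ⟨d, rfl⟩).choose_spec

/-- The action on `X` for which a surjection `q : D → X` with invariant kernel is linear:
`b • q d = q (b • d)`. -/
noncomputable def descendAct (θ : B →+* AddMonoid.End D) (q : D →+ X)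
    (hq : Function.Surjective q) (h : ∀ b, ∀ d ∈ q.ker, θ b d ∈ q.ker) :
    B →+* AddMonoid.End X :=
  have key : ∀ b d d', q d = q d' → q (θ b d) = q (θ b d') := fun b d d' e => by
    have h1 := h b (d - d') (by rw [AddMonoidHom.mem_ker, map_sub, e, sub_self])
    rw [AddMonoidHom.mem_ker, map_sub, map_sub, sub_eq_zero] at h1
    exact h1
  have sp : ∀ x, q (Function.surjInv hq x) = x := Function.surjInv_eq hq
  { toFun := fun b => AddMonoidHom.mk' (fun x => q (θ b (Function.surjInv hq x))) fun x x' => by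
      rw [← map_add, ← map_add]
      exact key b _ _ (by rw [map_add, sp, sp, sp])
    map_one' := by
      ext x
      change q (θ 1 _) = x
      rw [map_one]
      exact sp x
    map_zero' := by
      ext x
      change q (θ 0 _) = 0
      simp
    map_add' := by
      intro a b
      ext x
      change q (θ (a + b) _) = q (θ a _) + q (θ b _)
      rw [map_add θ, ← map_add q]
      rfl
    map_mul' := by
      intro a b
      ext x
      change q (θ (a * b) _) = q (θ a (Function.surjInv hq (q (θ b _))))
      rw [map_mul]
      exact key a _ _ (sp _).symm }

theorem descendAct_spec (θ : B →+* AddMonoid.End D) (q : D →+ X)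
    (hq : Function.Surjective q) (h : ∀ b, ∀ d ∈ q.ker, θ b d ∈ q.ker) (b : B) (d : D) :
    descendAct θ q hq h b (q d) = q (θ b d) := by
  change q (θ b (Function.surjInv hq (q d))) = q (θ b d)
  have h1 := h b (Function.surjInv hq (q d) - d)
    (by rw [AddMonoidHom.mem_ker, map_sub, Function.surjInv_eq hq, sub_self])
  rw [AddMonoidHom.mem_ker, map_sub, map_sub, sub_eq_zero] at h1
  exact h1

/-- The action on the `i`-th summand of a finite direct sum all of whose summands are
invariant. -/
def compAct {ι : Type*} [DecidableEq ι] {E : ι → Type*} [∀ i, AddCommGroup (E i)]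
    (θ : B →+* AddMonoid.End (∀ i, E i))
    (h : ∀ b i x j, j ≠ i → θ b (Pi.single i x) j = 0) (i : ι) : B →+* AddMonoid.End (E i) :=
  have key : ∀ b x, θ b (Pi.single i x) = Pi.single i (θ b (Pi.single i x) i) := fun b x => by
    funext j
    by_cases hj : j = i
    · subst hj; simp
    · rw [h b i x j hj, Pi.single_eq_of_ne hj]
  { toFun := fun b => AddMonoidHom.mk' (fun x => θ b (Pi.single i x) i) fun x y => by
      rw [Pi.single_add, map_add, Pi.add_apply]
    map_one' := by
      ext x
      change θ 1 (Pi.single i x) i = x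
      simp
    map_zero' := by
      ext x
      change θ 0 (Pi.single i x) i = 0
      simp
    map_add' := by
      intro a b
      ext x
      change θ (a + b) (Pi.single i x) i = θ a (Pi.single i x) i + θ b (Pi.single i x) i
      rw [map_add]
      rfl
    map_mul' := by
      intro a b
      ext x
      change θ (a * b) (Pi.single i x) i = θ a (Pi.single i (θ b (Pi.single i x) i)) i
      rw [← key, map_mul]
      rfl }

end Rings

/-! ### Central sections of a group -/

/-- A central section `top / bot` of a group: `bot ≤ top` and `[top, G] ≤ bot`. -/
structure CSec (G : Type*) [Group G] where
  /-- the numerator -/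
  top : Subgroup G
  /-- the denominator -/
  bot : Subgroup G
  le : bot ≤ top
  central : ∀ x ∈ top, ∀ g : G, ⁅x, g⁆ ∈ bot

namespace CSec

variable {G : Type*} [Group G] (s t : CSec G)

instance normal : (s.bot.subgroupOf s.top).Normal where
  conj_mem := by
    intro n hn g
    rw [Subgroup.mem_subgroupOf] at hn ⊢
    have h1 := s.central n (s.le hn) g
    have h2 : ((g * n * g⁻¹ : s.top) : G) = (⁅(n : G), (g : G)⁆)⁻¹ * n := by
      simp [commutatorElement_def, mul_assoc]
    rw [h2]
    exact s.bot.mul_mem (s.bot.inv_mem h1) hn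

/-- The abelian quotient group `top / bot`, written additively. -/
abbrev Q : Type _ := Additive (s.top ⧸ s.bot.subgroupOf s.top)

instance addCommGroup : AddCommGroup s.Q :=
  { (inferInstance : AddGroup s.Q) with
    add_comm := by
      intro a b
      obtain ⟨x, rfl⟩ := QuotientGroup.mk_surjective a.toMul
      obtain ⟨y, rfl⟩ := QuotientGroup.mk_surjective b.toMul
      change ((x * y : s.top) : s.top ⧸ s.bot.subgroupOf s.top) = ((y * x : s.top) : _)
      rw [QuotientGroup.eq, Subgroup.mem_subgroupOf]
      have h1 := s.central _ (s.top.inv_mem y.2) (x⁻¹ : G)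
      simpa [commutatorElement_def, mul_assoc] using h1 }

/-- The canonical projection of `top` onto `top / bot`. -/
def cls (x : s.top) : s.Q := Additive.ofMul (QuotientGroup.mk x)

variable {s} in
theorem cls_surjective : Function.Surjective s.cls := fun a => by
  obtain ⟨x, hx⟩ := QuotientGroup.mk_surjective a.toMul
  exact ⟨x, hx⟩

theorem cls_mul (x y : s.top) : s.cls (x * y) = s.cls x + s.cls y := rfl

theorem cls_eq_zero {x : s.top} : s.cls x = 0 ↔ (x : G) ∈ s.bot :=
  (QuotientGroup.eq_one_iff x).trans Subgroup.mem_subgroupOf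

theorem cls_eq_of {x y : s.top} (h : (x : G) * (y : G)⁻¹ ∈ s.bot) : s.cls x = s.cls y := by
  have h1 : s.cls (x * y⁻¹) = 0 := s.cls_eq_zero.2 h
  exact add_neg_eq_zero.1 h1

/-- An additive map out of `top / bot` given on representatives. -/
def lift {N : Type*} [AddCommGroup N] (φ : s.top → N) (hmul : ∀ x y, φ (x * y) = φ x + φ y)
    (hbot : ∀ x : s.top, (x : G) ∈ s.bot → φ x = 0) : s.Q →+ N :=
  MonoidHom.toAdditiveLeft (QuotientGroup.lift (s.bot.subgroupOf s.top)
    (MonoidHom.mk' (fun x => Multiplicative.ofAdd (φ x)) fun x y => by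
      rw [hmul]; rfl)
    (fun x hx => by
      change Multiplicative.ofAdd (φ x) = 1
      rw [hbot x (Subgroup.mem_subgroupOf.1 hx)]; rfl))

@[simp]
theorem lift_cls {N : Type*} [AddCommGroup N] (φ : s.top → N) (hmul hbot) (x : s.top) :
    s.lift φ hmul hbot (s.cls x) = φ x := rfl

variable {s t} in
/-- The homomorphism `s.top / s.bot → t.top / t.bot` induced by the inclusion
`s.top → t.top`. -/
def incl (htop : s.top ≤ t.top) (hbot : s.bot ≤ t.bot) : s.Q →+ t.Q :=
  s.lift (fun x => t.cls ⟨x, htop x.2⟩) (fun _ _ => rfl) fun _ hx => t.cls_eq_zero.2 (hbot hx)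

variable {s t} in
@[simp]
theorem incl_cls (htop : s.top ≤ t.top) (hbot : s.bot ≤ t.bot) (x : s.top) :
    incl htop hbot (s.cls x) = t.cls ⟨x, htop x.2⟩ := rfl

end CSec

/-! ### Central series and the associated constructions -/

/-- A central series `G = R₁ ≥ R₂ ≥ ⋯ ≥ R_c ≥ R_{c+1} = 1`; only the terms with indices
`1, …, c + 1` carry information (`R₀ = G` and `R_i = 1` for `i > c` are forced). -/
structure CentralSeries (G : Type*) [Group G] (c : ℕ) where
  /-- the terms `R_i` -/
  term : ℕ → Subgroup G
  anti : Antitone term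
  first : term 1 = ⊤
  last : term (c + 1) = ⊥
  central : ∀ i, ⁅term i, (⊤ : Subgroup G)⁆ ≤ term (i + 1)

namespace CentralSeries

variable {G : Type*} [Group G] {c : ℕ} (R : CentralSeries G c)

instance term_normal (i : ℕ) : (R.term i).Normal :=
  Subgroup.commutator_top_right_le_iff.1 ((R.central i).trans (R.anti i.le_succ))

/-- The lower series associated with `R`: `R^l₁ = G` and `R^l_i = [R_{i-1}, G]` for `i ≥ 2`. -/
def Rl : ℕ → Subgroup G
  | 0 => ⊤
  | 1 => ⊤
  | i + 2 => ⁅R.term (i + 1), (⊤ : Subgroup G)⁆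

/-- The upper series associated with `R`: `R^u_i = {x | [x, G] ⊆ [R_i, G]}`. -/
def Ru (i : ℕ) : Subgroup G where
  carrier := {x | ∀ g : G, ⁅x, g⁆ ∈ ⁅R.term i, (⊤ : Subgroup G)⁆}
  one_mem' := fun g => by simp
  mul_mem' := fun {a b} ha hb g => by
    rw [commutatorElement_mul_left_eq_conj_mul]
    exact mul_mem (Subgroup.Normal.conj_mem inferInstance _ (hb g) a) (ha g)
  inv_mem' := fun {a} ha g => by
    rw [commutatorElement_inv_left, ← commutatorElement_inv]
    simpa using Subgroup.Normal.conj_mem inferInstance _ (inv_mem (ha g)) a⁻¹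

instance Rl_normal (i : ℕ) : (R.Rl i).Normal := by
  match i with
  | 0 => exact Subgroup.normal_of_characteristic (⊤ : Subgroup G)
  | 1 => exact Subgroup.normal_of_characteristic (⊤ : Subgroup G)
  | i + 2 => exact Subgroup.commutator_normal _ _

theorem Rl_le_term (i : ℕ) : R.Rl i ≤ R.term i := by
  match i with
  | 0 => exact (R.first ▸ R.anti zero_le_one : (⊤ : Subgroup G) ≤ R.term 0)
  | 1 => exact R.first.ge
  | i + 2 => exact R.central (i + 1)

theorem term_le_Ru (i : ℕ) : R.term i ≤ R.Ru i :=
  fun _ hx _ => Subgroup.commutator_mem_commutator hx (Subgroup.mem_top _)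

theorem Rl_le_Ru (i : ℕ) : R.Rl i ≤ R.Ru i := (R.Rl_le_term i).trans (R.term_le_Ru i)

theorem comm_term_le_Rl (i : ℕ) : ⁅R.term i, (⊤ : Subgroup G)⁆ ≤ R.Rl (i + 1) := by
  match i with
  | 0 => exact le_top
  | i + 1 => exact le_rfl

theorem Rl_succ_le (i : ℕ) : R.Rl (i + 1) ≤ R.Rl i := by
  match i with
  | 0 => exact le_top
  | 1 => exact le_top
  | i + 2 => exact Subgroup.commutator_mono (R.anti (i + 1).le_succ) le_rfl

theorem Ru_succ_le (i : ℕ) : R.Ru (i + 1) ≤ R.Ru i :=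
  fun _ hx g => Subgroup.commutator_mono (R.anti i.le_succ) le_rfl (hx g)

theorem Rl_central (i : ℕ) : ∀ x ∈ R.Rl i, ∀ g : G, ⁅x, g⁆ ∈ R.Rl (i + 1) := fun _ hx _ =>
  R.comm_term_le_Rl i
    (Subgroup.commutator_mem_commutator (R.Rl_le_term i hx) (Subgroup.mem_top _))

theorem Ru_comm (i : ℕ) : ∀ x ∈ R.Ru i, ∀ g : G, ⁅x, g⁆ ∈ R.Rl (i + 1) := fun _ hx g =>
  R.comm_term_le_Rl i (hx g)

theorem Ru_comm' (i : ℕ) (x : G) (hx : x ∈ R.Ru i) (g : G) : ⁅g, x⁆ ∈ R.Rl (i + 1) := by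
  rw [← commutatorElement_inv]
  exact inv_mem (R.Ru_comm i x hx g)

theorem Ru_central (i : ℕ) : ∀ x ∈ R.Ru i, ∀ g : G, ⁅x, g⁆ ∈ R.Ru (i + 1) := fun x hx g =>
  R.Rl_le_Ru (i + 1) (R.Ru_comm i x hx g)

/-- The quotient `R^u_i / R^u_{i+1}`. -/
def U (i : ℕ) : CSec G := ⟨R.Ru i, R.Ru (i + 1), R.Ru_succ_le i, R.Ru_central i⟩

/-- The quotient `R^l_i / R^l_{i+1}`. -/
def L (i : ℕ) : CSec G := ⟨R.Rl i, R.Rl (i + 1), R.Rl_succ_le i, R.Rl_central i⟩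

/-- The index set `1, …, c - 1` of the bundle of bilinear maps. -/
abbrev Idx (c : ℕ) : Type := {i : ℕ // 1 ≤ i ∧ i < c}

/-- `V_i = {x | [x, R^u_i] ⊆ R^l_{i+2}}`. -/
def Vi (i : ℕ) : Subgroup G where
  carrier := {x | ∀ y ∈ R.Ru i, ⁅x, y⁆ ∈ R.Rl (i + 2)}
  one_mem' := fun g _ => by simp
  mul_mem' := fun {a b} ha hb g hg => by
    rw [commutatorElement_mul_left_eq_conj_mul]
    exact mul_mem (Subgroup.Normal.conj_mem inferInstance _ (hb g hg) a) (ha g hg)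
  inv_mem' := fun {a} ha g hg => by
    rw [commutatorElement_inv_left, ← commutatorElement_inv]
    simpa using Subgroup.Normal.conj_mem inferInstance _ (inv_mem (ha g hg)) a⁻¹

/-- `V_R`, the intersection of `V_1, …, V_{c-1}`. -/
def V : Subgroup G := ⨅ i : Idx c, R.Vi i

theorem pair_mul_left (i : ℕ) (a b y : G) (hy : y ∈ R.Ru i) :
    (R.L (i + 1)).cls ⟨⁅a * b, y⁆, R.Ru_comm' i y hy _⟩ =
      (R.L (i + 1)).cls ⟨⁅a, y⁆, R.Ru_comm' i y hy _⟩ +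
      (R.L (i + 1)).cls ⟨⁅b, y⁆, R.Ru_comm' i y hy _⟩ := by
  have hb := R.Ru_comm' i y hy b
  have hc := R.Rl_central (i + 1) _ hb a
  refine Eq.trans (b := (R.L (i + 1)).cls (⟨⁅b, y⁆, R.Ru_comm' i y hy _⟩ *
    ⟨⁅a, y⁆, R.Ru_comm' i y hy _⟩)) (CSec.cls_eq_of _ ?_)
    ((CSec.cls_mul _ _ _).trans (add_comm _ _))
  change ⁅a * b, y⁆ * (⁅b, y⁆ * ⁅a, y⁆)⁻¹ ∈ R.Rl (i + 2)
  have : ⁅a * b, y⁆ * (⁅b, y⁆ * ⁅a, y⁆)⁻¹ = (⁅⁅b, y⁆, a⁆)⁻¹ := by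
    rw [commutatorElement_mul_left_eq_conj_mul, commutatorElement_inv,
      commutatorElement_def a ⁅b, y⁆, mul_inv_rev]
    group
  rw [this]
  exact inv_mem hc

theorem pair_mul_right (i : ℕ) (a y z : G) (hy : y ∈ R.Ru i) (hz : z ∈ R.Ru i) :
    (R.L (i + 1)).cls ⟨⁅a, y * z⁆, R.Ru_comm' i _ (mul_mem hy hz) _⟩ =
      (R.L (i + 1)).cls ⟨⁅a, y⁆, R.Ru_comm' i y hy _⟩ +
      (R.L (i + 1)).cls ⟨⁅a, z⁆, R.Ru_comm' i z hz _⟩ := by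
  have hb := R.Ru_comm' i z hz a
  have hc := R.Rl_central (i + 1) _ hb y
  have hc' := (R.Rl_normal (i + 2)).conj_mem _ (inv_mem hc) ⁅a, y⁆
  refine CSec.cls_eq_of (R.L (i + 1)) (y := ⟨⁅a, y⁆, R.Ru_comm' i y hy _⟩ *
    ⟨⁅a, z⁆, R.Ru_comm' i z hz _⟩) ?_
  change ⁅a, y * z⁆ * (⁅a, y⁆ * ⁅a, z⁆)⁻¹ ∈ R.Rl (i + 2)
  have : ⁅a, y * z⁆ * (⁅a, y⁆ * ⁅a, z⁆)⁻¹ = ⁅a, y⁆ * (⁅⁅a, z⁆, y⁆)⁻¹ * ⁅a, y⁆⁻¹ := by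
    rw [commutatorElement_inv ⁅a, z⁆ y, commutatorElement_def y ⁅a, z⁆]
    simp only [commutatorElement_def]
    group
  rw [this]
  exact hc'

/-- Commutation with a fixed `a` as a map `R^u_i / R^u_{i+1} → R^l_{i+1} / R^l_{i+2}`.
Since the map is bilinear, `⁅a, y⁆ = a y a⁻¹ y⁻¹` and `a⁻¹ y⁻¹ a y` give the same class. -/
def pairRight (i : ℕ) (a : G) : (R.U i).Q →+ (R.L (i + 1)).Q :=
  (R.U i).lift (fun y => (R.L (i + 1)).cls ⟨⁅a, y⁆, R.Ru_comm' i y y.2 _⟩)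
    (fun y z => R.pair_mul_right i a y z y.2 z.2)
    (fun y hy => (R.L (i + 1)).cls_eq_zero.2 (R.Ru_comm' (i + 1) y hy a))

theorem pairRight_mul (i : ℕ) (a b : G) :
    R.pairRight i (a * b) = R.pairRight i a + R.pairRight i b := by
  refine AddMonoidHom.ext fun q => ?_
  obtain ⟨y, rfl⟩ := CSec.cls_surjective q
  exact R.pair_mul_left i a b y y.2

theorem commutator_le_V : commutator G ≤ R.V := by
  refine le_iInf fun i => ?_
  rw [commutator_def, Subgroup.commutator_le]
  intro a _ b _ y hy
  let φ : G →* Multiplicative ((R.U i).Q →+ (R.L (i + 1)).Q) :=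
    MonoidHom.mk' (fun g => Multiplicative.ofAdd (R.pairRight i g)) fun g h => by
      rw [pairRight_mul]; rfl
  have h1 : φ ⁅a, b⁆ = 1 := by rw [map_commutatorElement, commutatorElement_eq_one_iff_commute]
                               exact Commute.all _ _
  have h2 : R.pairRight i ⁅a, b⁆ ((R.U i).cls ⟨y, hy⟩) = 0 :=
    DFunLike.congr_fun (Multiplicative.ofAdd.injective h1) _
  exact (R.L (i + 1)).cls_eq_zero.1 h2

theorem comm_mem (x g : G) : ⁅x, g⁆ ∈ commutator G :=
  Subgroup.commutator_mem_commutator (Subgroup.mem_top _) (Subgroup.mem_top _)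

/-- The quotient `G / V_R`. -/
def topV : CSec G := ⟨⊤, R.V, le_top, fun x _ g => R.commutator_le_V (comm_mem x g)⟩

/-- The `i`-th bilinear map of the bundle, `(x, y) ↦ [x, y]`, with the first variable
in `G / V_R`. -/
def f (i : Idx c) : R.topV.Q →+ (R.U i).Q →+ (R.L (i + 1)).Q :=
  R.topV.lift (fun x => R.pairRight i x) (fun x y => R.pairRight_mul i x y) fun x hx => by
    refine AddMonoidHom.ext fun q => ?_
    obtain ⟨y, rfl⟩ := CSec.cls_surjective q
    have hx' : (x : G) ∈ R.Vi i := Subgroup.mem_iInf.1 hx i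
    exact (R.L (i + 1)).cls_eq_zero.2 (hx' y y.2)

/-- The bilinear map `F_R : G / V_R × R^u → R^l` associated with the series `R`, where
`R^u = ⨁ R^u_i / R^u_{i+1}` and `R^l = ⨁ R^l_{i+1} / R^l_{i+2}`, `1 ≤ i ≤ c - 1`. -/
def F : R.topV.Q →+ (∀ i : Idx c, (R.U i).Q) →+ (∀ i : Idx c, (R.L (i + 1)).Q) :=
  AddMonoidHom.mk' (fun x => AddMonoidHom.mk' (fun y i => R.f i x (y i)) fun y z => by
    funext i; simp) fun x y => by
      ext z i; simp

theorem F_apply (x : R.topV.Q) (y : ∀ i : Idx c, (R.U i).Q) (i : Idx c) :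
    R.F x y i = R.f i x (y i) := rfl

/-- The ring `P_R = P(F_R)`. -/
def P : Type _ := ↥(largestRing R.F)

instance : Ring R.P := inferInstanceAs (Ring ↥(largestRing R.F))

theorem f_nondeg (i : Idx c) (y : (R.U i).Q) (h : ∀ x, R.f i x y = 0) : y = 0 := by
  obtain ⟨y, rfl⟩ := CSec.cls_surjective y
  refine (R.U i).cls_eq_zero.2 fun g => ?_
  have h1 : ⁅g, (y : G)⁆ ∈ R.Rl (i + 2) :=
    (R.L (i + 1)).cls_eq_zero.1 (h (R.topV.cls ⟨g, Subgroup.mem_top g⟩))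
  rw [← commutatorElement_inv]
  exact inv_mem h1

theorem f_full (i : Idx c) (z : (R.L (i + 1)).Q) :
    z ∈ AddSubgroup.closure {w | ∃ x y, R.f i x y = w} := by
  obtain ⟨⟨z, hz⟩, rfl⟩ := CSec.cls_surjective z
  obtain ⟨k, hk⟩ : ∃ k, (i : ℕ) = k + 1 := ⟨i - 1, by have := i.2.1; omega⟩
  have hz' : z ∈ ⁅R.term i, (⊤ : Subgroup G)⁆ := by
    have : z ∈ R.Rl (i + 1) := hz
    rw [hk] at this ⊢
    exact this
  suffices H : ∃ h : z ∈ R.Rl (i + 1), (R.L (i + 1)).cls ⟨z, h⟩ ∈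
      AddSubgroup.closure {w | ∃ x y, R.f i x y = w} from H.2
  clear hz
  rw [Subgroup.commutator_def] at hz'
  induction hz' using Subgroup.closure_induction with
  | mem z h =>
    obtain ⟨r, hr, g, -, rfl⟩ := h
    have hr' := R.term_le_Ru i hr
    refine ⟨R.Ru_comm i r hr' g, ?_⟩
    have e : (R.L (i + 1)).cls ⟨⁅r, g⁆, R.Ru_comm i r hr' g⟩ =
        - R.f i (R.topV.cls ⟨g, Subgroup.mem_top g⟩) ((R.U i).cls ⟨r, hr'⟩) := by
      change (R.L (i + 1)).cls _ = (R.L (i + 1)).cls (⟨⁅g, r⁆, R.Ru_comm' i r hr' g⟩⁻¹)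
      congr 1
      ext
      exact (commutatorElement_inv g r).symm
    rw [e]
    exact neg_mem (AddSubgroup.subset_closure ⟨_, _, rfl⟩)
  | one => exact ⟨one_mem _, zero_mem _⟩
  | mul x y _ _ hx hy =>
    exact ⟨mul_mem hx.1 hy.1, add_mem hx.2 hy.2⟩
  | inv x _ hx => exact ⟨inv_mem hx.1, neg_mem hx.2⟩

/-! #### The action of `P_R` on the quotients -/

/-- The action of `P_R` on `G / V_R`. -/
def actV : R.P →+* AddMonoid.End R.topV.Q := (RingHom.fst _ _).comp (largestRing R.F).subtype

/-- The action of `P_R` on `R^u`. -/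
def actUsum : R.P →+* AddMonoid.End (∀ i : Idx c, (R.U i).Q) :=
  ((RingHom.fst _ _).comp (RingHom.snd _ _)).comp (largestRing R.F).subtype

/-- The action of `P_R` on `R^l`. -/
def actLsum : R.P →+* AddMonoid.End (∀ i : Idx c, (R.L (i + 1)).Q) :=
  ((RingHom.snd _ _).comp (RingHom.snd _ _)).comp (largestRing R.F).subtype

theorem F_actV (a : R.P) (x : R.topV.Q) (y : ∀ i : Idx c, (R.U i).Q) :
    R.F (R.actV a x) y = R.F x (R.actUsum a y) := (a.2 x y).1

theorem F_actLsum (a : R.P) (x : R.topV.Q) (y : ∀ i : Idx c, (R.U i).Q) :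
    R.actLsum a (R.F x y) = R.F (R.actV a x) y := ((a.2 x y).1.trans (a.2 x y).2).symm

theorem F_single (x : R.topV.Q) (i : Idx c) (y : (R.U i).Q) :
    R.F x (Pi.single i y) = Pi.single i (R.f i x y) := by
  funext j
  rw [F_apply]
  by_cases h : j = i
  · subst h; simp
  · rw [Pi.single_eq_of_ne h, Pi.single_eq_of_ne h, map_zero]

theorem actUsum_single (a : R.P) (i : Idx c) (x : (R.U i).Q) (j : Idx c) (h : j ≠ i) :
    R.actUsum a (Pi.single i x) j = 0 := by
  apply R.f_nondeg
  intro g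
  rw [← F_apply, ← F_actV, F_single, Pi.single_eq_of_ne h]

theorem actLsum_single (a : R.P) (i : Idx c) (x : (R.L (i + 1)).Q) (j : Idx c) (h : j ≠ i) :
    R.actLsum a (Pi.single i x) j = 0 := by
  induction R.f_full i x using AddSubgroup.closure_induction with
  | mem w hw =>
    obtain ⟨g, y, rfl⟩ := hw
    rw [← F_single, F_actLsum, F_single, Pi.single_eq_of_ne h]
  | zero => rw [Pi.single_zero, map_zero]; rfl
  | add w z _ _ hw hz => rw [Pi.single_add, map_add, Pi.add_apply, hw, hz, add_zero]
  | neg w _ hw => rw [Pi.single_neg, map_neg, Pi.neg_apply, hw, neg_zero]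

/-- The action of `P_R` on `R^u_i / R^u_{i+1}`, `1 ≤ i ≤ c - 1`. -/
def actU (i : Idx c) : R.P →+* AddMonoid.End (R.U i).Q := compAct R.actUsum R.actUsum_single i

/-- The action of `P_R` on `R^l_{i+1} / R^l_{i+2}`, `1 ≤ i ≤ c - 1`. -/
def actL (i : Idx c) : R.P →+* AddMonoid.End (R.L (i + 1)).Q :=
  compAct (E := fun i : Idx c => (R.L (i + 1)).Q) R.actLsum R.actLsum_single i

/-! #### The ring `A_R` -/

/-- The canonical map `e_i : R^l_i / R^l_{i+1} → R^u_i / R^u_{i+1}`. -/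
def e (i : ℕ) : (R.L i).Q →+ (R.U i).Q := CSec.incl (R.Rl_le_Ru i) (R.Rl_le_Ru (i + 1))

/-- The ring `PL_R`: the largest subring of `P_R` over which all the maps `e_i` between quotients
on which `P_R` acts (`2 ≤ i ≤ c - 1`) are linear. -/
def PL : Subring R.P :=
  ⨅ (i : ℕ) (h : 1 ≤ i ∧ i + 1 < c),
    linearizer (R.actL ⟨i, h.1, (Nat.lt_succ_self i).trans h.2⟩)
      (R.actU ⟨i + 1, Nat.succ_le_succ (Nat.zero_le i), h.2⟩) (R.e (i + 1))

/-- The quotient `T_i = (R^l_i ∩ Z(G)) / (R^l_{i+1} ∩ Z(G))` of the refined upper series. -/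
def T (i : ℕ) : CSec G where
  top := R.Rl i ⊓ Subgroup.center G
  bot := R.Rl (i + 1) ⊓ Subgroup.center G
  le := inf_le_inf_right _ (R.Rl_succ_le i)
  central := fun x hx g => by
    rw [commutatorElement_eq_one_iff_mul_comm.2 (Subgroup.mem_center_iff.1 hx.2 g).symm]
    exact one_mem _

/-- The quotient `D_i = (V_R ∩ R^u_i) / (V_R ∩ R^u_{i+1})`. -/
def D (i : ℕ) : CSec G where
  top := R.V ⊓ R.Ru i
  bot := R.V ⊓ R.Ru (i + 1)
  le := inf_le_inf_left _ (R.Ru_succ_le i)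
  central := fun x hx g => ⟨R.commutator_le_V (comm_mem x g), R.Ru_central i x hx.2 g⟩

/-- The quotient `X_i = (V_R ∩ R^u_i) G' / (V_R ∩ R^u_{i+1}) G'` of the refined lower series. -/
def X (i : ℕ) : CSec G where
  top := (R.V ⊓ R.Ru i) ⊔ commutator G
  bot := (R.V ⊓ R.Ru (i + 1)) ⊔ commutator G
  le := sup_le_sup_right (inf_le_inf_left _ (R.Ru_succ_le i)) _
  central := fun x _ g => Subgroup.mem_sup_right (comm_mem x g)

/-- The canonical monomorphism `ε_i : T_i → R^l_i / R^l_{i+1}`. -/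
def eps (i : ℕ) : (R.T i).Q →+ (R.L i).Q :=
  CSec.incl (s := R.T i) (t := R.L i) inf_le_left inf_le_left

/-- The canonical monomorphism `δ_i : D_i → R^u_i / R^u_{i+1}`. -/
def delta (i : ℕ) : (R.D i).Q →+ (R.U i).Q :=
  CSec.incl (s := R.D i) (t := R.U i) inf_le_right inf_le_right

/-- The canonical epimorphism `D_i → X_i`. -/
def proj (i : ℕ) : (R.D i).Q →+ (R.X i).Q :=
  CSec.incl (s := R.D i) (t := R.X i) le_sup_left le_sup_left

theorem eps_injective (i : ℕ) : Function.Injective (R.eps i) := by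
  rw [injective_iff_map_eq_zero]
  intro a ha
  obtain ⟨x, rfl⟩ := CSec.cls_surjective a
  exact (R.T i).cls_eq_zero.2 ⟨(R.L i).cls_eq_zero.1 ha, x.2.2⟩

theorem delta_injective (i : ℕ) : Function.Injective (R.delta i) := by
  rw [injective_iff_map_eq_zero]
  intro a ha
  obtain ⟨x, rfl⟩ := CSec.cls_surjective a
  exact (R.D i).cls_eq_zero.2 ⟨x.2.1, (R.U i).cls_eq_zero.1 ha⟩

theorem proj_surjective (i : ℕ) : Function.Surjective (R.proj i) := by
  intro a
  obtain ⟨⟨x, hx⟩, rfl⟩ := CSec.cls_surjective a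
  obtain ⟨d, hd, g, hg, rfl⟩ := Subgroup.mem_sup_of_normal_right.1 hx
  refine ⟨(R.D i).cls ⟨d, hd⟩, CSec.cls_eq_of (R.X i) ?_⟩
  have h1 : d * (d * g)⁻¹ ∈ commutator G := by
    have := (inferInstance : (commutator G).Normal).conj_mem _ (inv_mem hg) d
    simpa [mul_assoc] using this
  exact Subgroup.mem_sup_right h1

/-- The ring `AE_R`: the largest subring of `PL_R` leaving all the images `ε_i(T_i)`,
`2 ≤ i ≤ c`, invariant. -/
def AE : Subring R.P := R.PL ⊓ ⨅ i : Idx c, stabilizer (R.actL i) (R.eps (i + 1)).range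

/-- The largest subring of `PL_R` leaving all the images `δ_i(D_i)`, `1 ≤ i ≤ c - 1`,
invariant; it acts on the quotients `D_i`. -/
def ADwide : Subring R.P := R.PL ⊓ ⨅ i : Idx c, stabilizer (R.actU i) (R.delta i).range

/-- The ring `AD_R`: the largest subring of `PL_R` leaving all the images `δ_i(D_i)` and
`δ_i(ker (D_i → X_i))`, `1 ≤ i ≤ c - 1`, invariant; it acts on the quotients `X_i`. The second
condition is void whenever the canonical map `D_i → X_i` is an isomorphism. -/
def AD : Subring R.P :=
  R.ADwide ⊓ ⨅ i : Idx c, stabilizer (R.actU i) ((R.proj i).ker.map (R.delta i))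

/-- The ring `A_R = AE_R ∩ AD_R`. -/
def scalars : Subring R.P := R.AE ⊓ R.AD

/-- The ring `Â_R ⊇ A_R` obtained when `AD_R` is replaced by the larger ring `ADwide`. -/
def scalarsWide : Subring R.P := R.AE ⊓ R.ADwide

theorem scalars_le : R.scalars ≤ R.scalarsWide := inf_le_inf_left _ inf_le_left

/-- The inclusion of `A_R` into `Â_R`. -/
def toWide : R.scalars →+* R.scalarsWide := Subring.inclusion R.scalars_le

/-- The action of `Â_R` on `G / V_R`. -/
def wideV : R.scalarsWide →+* AddMonoid.End R.topV.Q := R.actV.comp R.scalarsWide.subtype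

/-- The action of `Â_R` on `R^u_i / R^u_{i+1}`, `1 ≤ i ≤ c - 1`. -/
def wideU (i : Idx c) : R.scalarsWide →+* AddMonoid.End (R.U i).Q :=
  (R.actU i).comp R.scalarsWide.subtype

/-- The action of `Â_R` on `R^l_{i+1} / R^l_{i+2}`, `1 ≤ i ≤ c - 1`. -/
def wideL (i : Idx c) : R.scalarsWide →+* AddMonoid.End (R.L (i + 1)).Q :=
  (R.actL i).comp R.scalarsWide.subtype

/-- The action of `Â_R` on `T_{i+1}`, `1 ≤ i ≤ c - 1`, given by `a • x = ε⁻¹(a • ε x)`. -/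
noncomputable def wideT (i : Idx c) : R.scalarsWide →+* AddMonoid.End (R.T (i + 1)).Q :=
  restrictAct (R.wideL i) (R.eps (i + 1)) (R.eps_injective _) fun b =>
    Subring.mem_iInf.1 b.2.1.2 i

/-- The action of `Â_R` on `D_i`, `1 ≤ i ≤ c - 1`, given by `a • x = δ⁻¹(a • δ x)`. -/
noncomputable def wideD (i : Idx c) : R.scalarsWide →+* AddMonoid.End (R.D i).Q :=
  restrictAct (R.wideU i) (R.delta i) (R.delta_injective _) fun b =>
    Subring.mem_iInf.1 b.2.2.2 i

theorem delta_wideD (i : Idx c) (b : R.scalarsWide) (d : (R.D i).Q) :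
    R.delta i (R.wideD i b d) = R.wideU i b (R.delta i d) :=
  restrictAct_spec _ _ _ _ b d

theorem coe_toWide (b : R.scalars) : (R.toWide b : R.P) = b :=
  Subring.coe_inclusion R.scalars_le b

theorem wideU_apply (i : Idx c) (b : R.scalarsWide) : R.wideU i b = R.actU i b :=
  RingHom.comp_apply _ _ _

theorem wideL_apply (i : Idx c) (b : R.scalarsWide) : R.wideL i b = R.actL i b :=
  RingHom.comp_apply _ _ _

theorem proj_wideD (i : Idx c) (b : R.scalars) (d : (R.D i).Q) (hd : d ∈ (R.proj i).ker) :
    R.wideD i (R.toWide b) d ∈ (R.proj i).ker := by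
  have h1 : (b : R.P) ∈ R.AD := (Subring.mem_inf.1 b.2).2
  have h2 := Subring.mem_iInf.1 (Subring.mem_inf.1 h1).2 i
  have h3 : R.actU i b (R.delta i d) ∈ (R.proj i).ker.map (R.delta i) :=
    h2 _ (AddSubgroup.mem_map_of_mem _ hd)
  obtain ⟨d', hd', e⟩ := AddSubgroup.mem_map.1 h3
  have h5 := R.delta_wideD i (R.toWide b) d
  rw [wideU_apply, coe_toWide, ← e] at h5
  rw [R.delta_injective i h5]
  exact hd'

/-- The action of `A_R` on `X_i`, `1 ≤ i ≤ c - 1`, induced by the action on `D_i`. -/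
noncomputable def actX (i : Idx c) : R.scalars →+* AddMonoid.End (R.X i).Q :=
  descendAct ((R.wideD i).comp R.toWide) (R.proj i) (R.proj_surjective _)
    fun b d hd => R.proj_wideD i b d hd

end CentralSeries

/-! ### First-order definability and interpretability -/

section Logic

open Language

/-- Function symbols of the language of groups. -/
inductive GroupFunc : ℕ → Type
  | mul : GroupFunc 2
  | inv : GroupFunc 1
  | one : GroupFunc 0

/-- The first-order language of groups. -/
def groupLang : Language := ⟨GroupFunc, fun _ => Empty⟩

/-- Every group as a structure for the language of groups. -/
instance groupStructure (H : Type*) [Group H] : groupLang.Structure H where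
  funMap := fun {_} F => match F with
    | GroupFunc.mul => fun v => v 0 * v 1
    | GroupFunc.inv => fun v => (v 0)⁻¹
    | GroupFunc.one => fun _ => 1
  RelMap := fun {_} r => r.elim

/-- `θ` defines the subgroup `K` of `H` (without parameters). -/
def Defines (θ : groupLang.Formula (Fin 1)) {H : Type*} [Group H] (K : Subgroup H) : Prop :=
  ∀ x : H, θ.Realize (fun _ => x) ↔ x ∈ K

/-- A subgroup `K H` of every model `H` of `T` is definable uniformly with respect to `T`:
one formula defines it in all models. -/
def UnifDefinable.{v} (T : groupLang.Theory)
    (K : ∀ (H : Type v) [Group H], H ⊨ T → Subgroup H) : Prop :=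
  ∃ θ : groupLang.Formula (Fin 1), ∀ (H : Type v) [Group H] (h : H ⊨ T), Defines θ (K H h)

/-- A code of a (parameter-free, `n`-dimensional) interpretation of a ring in a group. -/
structure RingCode (n : ℕ) where
  /-- the domain -/
  dom : groupLang.Formula (Fin n)
  /-- equality -/
  eq : groupLang.Formula (Fin n ⊕ Fin n)
  /-- the constant `0` -/
  zero : groupLang.Formula (Fin n)
  /-- the constant `1` -/
  one : groupLang.Formula (Fin n)
  /-- the graph of addition -/
  add : groupLang.Formula (Fin n ⊕ Fin n ⊕ Fin n)
  /-- the graph of multiplication -/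
  mul : groupLang.Formula (Fin n ⊕ Fin n ⊕ Fin n)

/-- The set of tuples in `H` that code elements of the ring. -/
def RingCode.Dom {n : ℕ} (C : RingCode n) (H : Type*) [Group H] : Type _ :=
  {t : Fin n → H // C.dom.Realize t}

/-- `C` interprets the ring `B` in the group `H`, the element of `B` with code `t` being `π t`. -/
structure RingCode.Interprets {n : ℕ} (C : RingCode n) {H : Type*} [Group H]
    {B : Type*} [Ring B] (π : C.Dom H → B) : Prop where
  surj : Function.Surjective π
  eq_iff : ∀ s t : C.Dom H, C.eq.Realize (Sum.elim s.1 t.1) ↔ π s = π t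
  zero_iff : ∀ s : C.Dom H, C.zero.Realize s.1 ↔ π s = 0
  one_iff : ∀ s : C.Dom H, C.one.Realize s.1 ↔ π s = 1
  add_iff : ∀ s t r : C.Dom H,
    C.add.Realize (Sum.elim s.1 (Sum.elim t.1 r.1)) ↔ π s + π t = π r
  mul_iff : ∀ s t r : C.Dom H,
    C.mul.Realize (Sum.elim s.1 (Sum.elim t.1 r.1)) ↔ π s * π t = π r

/-- `θ` defines in `H` the graph of the action `act` of the ring `B`, whose elements are coded
by `π`, on the quotient `s`, whose elements are coded by their representatives. -/
def DefinesAction {n : ℕ} (C : RingCode n) (θ : groupLang.Formula (Fin n ⊕ Fin 2))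
    {H : Type*} [Group H] {B : Type*} [Ring B] (π : C.Dom H → B) (s : CSec H)
    (act : B →+* AddMonoid.End s.Q) : Prop :=
  ∀ (t : C.Dom H) (y z : s.top),
    θ.Realize (Sum.elim t.1 ![(y : H), (z : H)]) ↔ act (π t) (s.cls y) = s.cls z

end Logic

end NilScalars

universe u v w

/-!
The statement asks for formulas that describe the associated series of `R`, the rings of scalars
and their actions in *all* groups `H ≡ G` at once, although `H` itself carries no exponents. The
exponential structure of `G` is used only to prove two finiteness properties of `G` that a
first-order theory can express; everything else takes place in a group with these properties.

*Finite width.* For a normal subgroup `K` of `G` the commutator subgroup `[K, G]` is always an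
`A`-subgroup (`isExpSubgroup_commutator_top`): modulo `[K, G, G]` its generators are central and
`[k, g]^α = [k, g^α]` by the Hall–Petresco formula. Hence `[K, G] / [K, G, G]` is an `A`-module
generated by the commutators `[k, g]`. If `K` is an `A`-subgroup, each element of this module is
already a sum `∑ [k_x, x]` with `k_x ∈ K` over the finitely many generators `x` of `G`; if `A` is
Noetherian, all sections of `G` by `A`-subgroups are Noetherian modules
(`ExpSec.isNoetherian_of_expFG`), so finitely many of the commutators `[k, g]` generate. By
descent through `[K, G]`, `[K, G, G]`, and so on, every element of `[R_i, G]` is a product of a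
bounded number of commutators `[r, g]` with `r ∈ R_i` (`CentralSeries.exists_hasWidth`).

*Finite complete systems.* The generators `e_1, …, e_m` of `G` satisfy: an element of `R^u_i` with
`[e_j, y] ∈ R^l_{i+2}` for all `j` lies in `R^u_{i+1}` (`CentralSeries.exists_isComplete`).

Both properties, and the property that the given formulas define a central series, pass to `H`.
Bounded width makes the subgroups `[R_i, H]`, and so all terms of the refined series, definable.
An operator `φ ∈ P_R` is coded by a complete system `e` together with representatives `a_j` of
`φ e_j`. Its action can be recovered by formulas: on `R^u_i / R^u_{i+1}` by `[a_j, y] = [e_j, φ y]`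
for all `j`, on `G / V_R` by `[φ x, y] = [x, φ y]`, and on the quotients of the lower series by
`φ ∏ [x_k, y_k] = ∏ [x_k, φ y_k]`, a product of bounded length. A pair `(e, a)` codes an
operator if and only if `e` is complete and the relations so defined are endomorphisms compatible
with commutation and with the values `a` (`CentralSeries.Codes.isCode`,
`CentralSeries.IsCode.exists_codes`), which is again a first-order condition. The subrings
`A_R` and `Â_R` of `P_R` are cut out by further conditions on these relations, and an operator is
determined by its action on `G / V_R`, so equality, sum and product of operators are definable
from their codes (`UnifSubring.exists_ringCode`).
-/

namespace NilScalars

/-! ### Powers modulo a normal subgroup closed under powers -/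

section Powers

theorem petresco_zero {G : Type*} [Group G] (xs : List G) : petresco xs 0 = 1 := by
  rw [petresco]
  simp

theorem petresco_one {G : Type*} [Group G] (xs : List G) : petresco xs 1 = xs.prod := by
  rw [petresco]
  simp [petresco_zero]

theorem map_petresco {G H : Type*} [Group G] [Group H] (φ : G →* H) (xs : List G) (k : ℕ) :
    φ (petresco xs k) = petresco (xs.map φ) k := by
  induction k using Nat.strong_induction_on with
  | _ k ih =>
    rw [petresco, petresco.eq_1 (xs.map φ), map_mul, map_inv, map_list_prod, map_list_prod,
      List.map_ofFn, List.map_map, List.map_map]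
    congr 3
    · congr 1
      funext j
      simp [ih j j.2]
    · funext x
      simp

/-- The Petresco words of two commuting elements are trivial from the second one on. -/
theorem petresco_of_commute {G : Type*} [Group G] {x y : G} (h : Commute x y) (k : ℕ) :
    petresco [x, y] (k + 2) = 1 := by
  induction k using Nat.strong_induction_on with
  | _ k ih =>
    have h1 : ∀ j : Fin k, petresco [x, y] ((j : ℕ) + 1 + 1) = 1 := fun j => ih j j.2
    rw [petresco, List.ofFn_succ, List.ofFn_succ]
    simp [petresco_zero, petresco_one, h1, h.mul_pow, List.ofFn_const]

variable {A : Type*} [CommRing A] [BinomialRing A]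
  {G : Type*} [Group G] [Group.IsNilpotent G] [ExpGroup A G]

open ExpGroup

theorem expo_zero (g : G) : expo g (0 : A) = 1 := by
  have h := expo_add g (0 : A) 0
  rw [add_zero] at h
  exact left_eq_mul.1 h

theorem one_expo (α : A) : expo (1 : G) α = 1 := by
  have h := expo_mul (1 : G) (0 : A) α
  rwa [zero_mul, expo_zero, eq_comm] at h

theorem expo_neg (g : G) (α : A) : expo g (-α) = (expo g α)⁻¹ := by
  rw [eq_inv_iff_mul_eq_one, ← expo_add, neg_add_cancel, expo_zero]

theorem inv_expo (g : G) (α : A) : expo g⁻¹ α = (expo g α)⁻¹ := by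
  have h : g⁻¹ = expo g (-1 : A) := by rw [expo_neg, expo_one]
  rw [h, ← expo_mul, neg_one_mul, expo_neg]

theorem conj_expo (g h : G) (α : A) : expo (h * g * h⁻¹) α = h * expo g α * h⁻¹ := by
  have := expo_conj g h⁻¹ α
  rwa [inv_inv] at this

variable (A) in
theorem IsExpSubgroup.top : IsExpSubgroup A (⊤ : Subgroup G) := fun _ _ _ => Subgroup.mem_top _

variable (A) in
theorem IsExpSubgroup.bot : IsExpSubgroup A (⊥ : Subgroup G) := fun g hg α => by
  rw [Subgroup.mem_bot.1 hg, one_expo]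
  exact one_mem _

theorem IsExpSubgroup.inf {K L : Subgroup G} (hK : IsExpSubgroup A K) (hL : IsExpSubgroup A L) :
    IsExpSubgroup A (K ⊓ L) := fun g hg α => ⟨hK g hg.1 α, hL g hg.2 α⟩

variable {N : Subgroup G} [N.Normal]

/-- Modulo a normal `A`-subgroup, powers are multiplicative on commuting elements: in the
Hall–Petresco formula only the word `τ₁ = x y` survives. -/
theorem mk_mul_expo (hN : IsExpSubgroup A N) {x y : G}
    (h : Commute (x : G ⧸ N) (y : G ⧸ N)) (α : A) :
    ((expo (x * y) α : G) : G ⧸ N) = (expo x α : G) * (expo y α : G) := by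
  have hp := congrArg (QuotientGroup.mk' N) (hall_petresco [x, y] α)
  rcases hn : Group.nilpotencyClass G with _ | n
  · have := Group.nilpotencyClass_zero_iff_subsingleton.1 hn
    rw [← QuotientGroup.mk_mul]
    exact congrArg _ (Subsingleton.elim _ _)
  rw [hn, List.ofFn_succ, List.ofFn_succ] at hp
  have h1 : ∀ j : Fin n, QuotientGroup.mk' N
      (expo (petresco [x, y] ((j.succ.succ : Fin (n + 2)) : ℕ))
        (Ring.choose α ((j.succ.succ : Fin (n + 2)) : ℕ))) = 1 := fun j => by
    refine (QuotientGroup.eq_one_iff _).2 (hN _ ((QuotientGroup.eq_one_iff _).1 ?_) _)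
    change QuotientGroup.mk' N _ = 1
    rw [map_petresco]
    simpa using petresco_of_commute h j
  simp only [List.prod_cons, map_mul, map_list_prod, List.map_ofFn, Function.comp_def, h1] at hp
  simpa [petresco_zero, petresco_one, one_expo, List.ofFn_const] using hp.symm

theorem mk_expo_congr (hN : IsExpSubgroup A N) {x y : G} (h : (x : G ⧸ N) = y) (α : A) :
    ((expo x α : G) : G ⧸ N) = (expo y α : G) := by
  have h1 : x⁻¹ * y ∈ N := QuotientGroup.eq.1 h
  have h2 : ((x⁻¹ * y : G) : G ⧸ N) = 1 := (QuotientGroup.eq_one_iff _).2 h1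
  have h3 := mk_mul_expo hN (x := x) (y := x⁻¹ * y) (by rw [h2]; exact Commute.one_right _) α
  rw [mul_inv_cancel_left, (QuotientGroup.eq_one_iff (expo (x⁻¹ * y) α)).2 (hN _ h1 α),
    mul_one] at h3
  exact h3.symm

theorem mk_commutator_expo_right (hN : IsExpSubgroup A N) {k g : G}
    (h : Commute ((⁅k, g⁆ : G) : G ⧸ N) (g : G ⧸ N)) (α : A) :
    ((⁅k, expo g α⁆ : G) : G ⧸ N) = (expo ⁅k, g⁆ α : G) := by
  have h1 : k * g * k⁻¹ = ⁅k, g⁆ * g := by simp [commutatorElement_def]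
  have h2 : ⁅k, expo g α⁆ = expo (⁅k, g⁆ * g) α * (expo g α)⁻¹ := by
    rw [← h1, conj_expo, commutatorElement_def]
  rw [h2, QuotientGroup.mk_mul, mk_mul_expo hN h, QuotientGroup.mk_inv, mul_inv_cancel_right]

theorem mk_commutator_expo_left (hN : IsExpSubgroup A N) {k g : G}
    (h : Commute ((⁅k, g⁆ : G) : G ⧸ N) (k : G ⧸ N)) (α : A) :
    ((⁅expo k α, g⁆ : G) : G ⧸ N) = (expo ⁅k, g⁆ α : G) := by
  have h' : Commute ((⁅g, k⁆ : G) : G ⧸ N) (k : G ⧸ N) := by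
    rw [← commutatorElement_inv, QuotientGroup.mk_inv]
    exact h.inv_left
  rw [← commutatorElement_inv g, QuotientGroup.mk_inv, mk_commutator_expo_right hN h',
    ← QuotientGroup.mk_inv, ← inv_expo, commutatorElement_inv]

theorem mk_commute_of_mem {G : Type*} [Group G] {N : Subgroup G} [N.Normal] {z g : G}
    (h : ⁅z, g⁆ ∈ N) :
    Commute (z : G ⧸ N) (g : G ⧸ N) := by
  rw [← commutatorElement_eq_one_iff_commute]
  exact (QuotientGroup.eq_one_iff _).2 h

/-- The commutator subgroup `[K, G]` is an `A`-subgroup for every normal subgroup `K`, whether or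
not `K` is one: modulo `[K, G, G]` its generators are central and `[k, g]^α = [k, g^α]`. -/
theorem isExpSubgroup_commutator_top (K : Subgroup G) [K.Normal] :
    IsExpSubgroup A ⁅K, (⊤ : Subgroup G)⁆ := by
  suffices H : ∀ n, ∀ K : Subgroup G, K.Normal → K ≤ Subgroup.upperCentralSeries G n →
      IsExpSubgroup A ⁅K, (⊤ : Subgroup G)⁆ by
    obtain ⟨n, hn⟩ := Group.IsNilpotent.nilpotent G
    exact H n K inferInstance (hn ▸ le_top)
  intro n
  induction n with
  | zero =>
    intro K _ h
    rw [Subgroup.upperCentralSeries_zero, le_bot_iff] at h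
    rw [h, Subgroup.commutator_bot_left]
    exact IsExpSubgroup.bot A
  | succ n ih =>
    intro K _ h
    have hL : ⁅K, (⊤ : Subgroup G)⁆ ≤ Subgroup.upperCentralSeries G n :=
      Subgroup.commutator_le.2 fun k hk g _ =>
        (Subgroup.mem_upperCentralSeries_succ_iff).1 (h hk) g
    set L := ⁅K, (⊤ : Subgroup G)⁆ with hLdef
    have hN : IsExpSubgroup A ⁅L, (⊤ : Subgroup G)⁆ := ih L inferInstance hL
    have hNL : ⁅L, (⊤ : Subgroup G)⁆ ≤ L := Subgroup.commutator_le_left _ _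
    have hc : ∀ z ∈ L, ∀ g : G, Commute (z : G ⧸ ⁅L, (⊤ : Subgroup G)⁆) g := fun z hz g =>
      mk_commute_of_mem (Subgroup.commutator_mem_commutator hz (Subgroup.mem_top _))
    have key : ∀ {z w : G}, (z : G ⧸ ⁅L, (⊤ : Subgroup G)⁆) = w → w ∈ L → z ∈ L := by
      intro z w e hw
      have := hNL (QuotientGroup.eq.1 e)
      have h2 := mul_mem hw (inv_mem this)
      simpa using h2
    intro z hz α
    suffices z ∈ L ∧ expo z α ∈ L from this.2
    rw [hLdef, Subgroup.commutator_def] at hz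
    induction hz using Subgroup.closure_induction with
    | mem z h =>
      obtain ⟨k, hk, g, -, rfl⟩ := h
      have hkg : ⁅k, g⁆ ∈ L := Subgroup.commutator_mem_commutator hk (Subgroup.mem_top g)
      exact ⟨hkg, key (mk_commutator_expo_right hN (hc _ hkg _) α).symm
        (Subgroup.commutator_mem_commutator hk (Subgroup.mem_top _))⟩
    | one => exact ⟨one_mem _, by rw [one_expo]; exact one_mem _⟩
    | mul x y _ _ hx hy =>
      refine ⟨mul_mem hx.1 hy.1, key (w := expo x α * expo y α) ?_ (mul_mem hx.2 hy.2)⟩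
      exact mk_mul_expo hN (hc x hx.1 y) α
    | inv x _ hx => exact ⟨inv_mem hx.1, by rw [inv_expo]; exact inv_mem hx.2⟩

end Powers

/-! ### Central sections as modules -/

section Sections

variable (A : Type*) [CommRing A] [BinomialRing A]
  (G : Type*) [Group G] [Group.IsNilpotent G] [ExpGroup A G]

open ExpGroup

/-- A central section of an `A`-exponential group both terms of which are `A`-subgroups. -/
structure ExpSec extends CSec G where
  exp_top : IsExpSubgroup A top
  exp_bot : IsExpSubgroup A bot

variable {A G}

theorem CSec.bot_normal {G : Type*} [Group G] (s : CSec G) : s.bot.Normal :=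
  Subgroup.commutator_top_right_le_iff.1
    (Subgroup.commutator_le.2 fun x hx g _ => s.central x (s.le hx) g)

theorem CSec.cls_eq_iff {G : Type*} [Group G] (s : CSec G) {x y : s.top} :
    s.cls x = s.cls y ↔ (x : G) * (y : G)⁻¹ ∈ s.bot := by
  refine ⟨fun h => ?_, s.cls_eq_of⟩
  have h1 : s.cls (x * y⁻¹) = 0 := by
    rw [CSec.cls_mul, h, ← CSec.cls_mul, mul_inv_cancel]
    rfl
  exact s.cls_eq_zero.1 h1

theorem CSec.cls_eq_iff_mk {G : Type*} [Group G] (s : CSec G) [s.bot.Normal] {x y : s.top} :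
    s.cls x = s.cls y ↔ ((x : G) : G ⧸ s.bot) = (y : G) := by
  rw [CSec.cls_eq_iff, QuotientGroup.eq_iff_div_mem, div_eq_mul_inv]

namespace ExpSec

variable (s t : ExpSec A G)

/-- The abelian group `top / bot`, carrying the `A`-module structure `α • [x] = [x ^ α]`. -/
def M : Type _ := s.toCSec.Q

instance : AddCommGroup s.M := inferInstanceAs (AddCommGroup s.toCSec.Q)

/-- The canonical projection of `top` onto the module `top / bot`. -/
def cl (x : s.top) : s.M := s.toCSec.cls x

variable {s} in
theorem cl_surjective : Function.Surjective s.cl := CSec.cls_surjective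

theorem cl_mul (x y : s.top) : s.cl (x * y) = s.cl x + s.cl y := rfl

theorem cl_eq_zero {x : s.top} : s.cl x = 0 ↔ (x : G) ∈ s.bot := s.toCSec.cls_eq_zero

theorem cl_eq_iff {x y : s.top} : s.cl x = s.cl y ↔ (x : G) * (y : G)⁻¹ ∈ s.bot :=
  s.toCSec.cls_eq_iff

instance bot_normal : s.bot.Normal := s.toCSec.bot_normal

theorem cl_eq_iff_mk {x y : s.top} : s.cl x = s.cl y ↔ ((x : G) : G ⧸ s.bot) = (y : G) :=
  s.toCSec.cls_eq_iff_mk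

theorem mk_commute {x : G} (hx : x ∈ s.top) (g : G) : Commute (x : G ⧸ s.bot) (g : G ⧸ s.bot) :=
  mk_commute_of_mem (s.central x hx g)

instance : SMul A s.M where
  smul α := s.toCSec.lift (N := s.M) (fun x => s.cl ⟨expo (x : G) α, s.exp_top x x.2 α⟩)
    (fun x y => s.cl_eq_iff_mk.2 (mk_mul_expo s.exp_bot (s.mk_commute x.2 y) α))
    (fun x hx => s.cl_eq_zero.2 (s.exp_bot x hx α))

theorem smul_cl (α : A) (x : s.top) : α • s.cl x = s.cl ⟨expo (x : G) α, s.exp_top x x.2 α⟩ := rfl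

instance : Module A s.M where
  one_smul m := by
    obtain ⟨x, rfl⟩ := cl_surjective m
    rw [smul_cl]
    congr 1
    ext
    exact expo_one _
  mul_smul α β m := by
    obtain ⟨x, rfl⟩ := cl_surjective m
    rw [smul_cl, smul_cl, smul_cl]
    congr 1
    ext
    change expo (x : G) (α * β) = expo (expo (x : G) β) α
    rw [mul_comm, expo_mul]
  smul_zero α := map_zero (s.toCSec.lift (N := s.M) _ _ _)
  smul_add α m n := map_add (s.toCSec.lift (N := s.M) _ _ _) m n
  add_smul α β m := by
    obtain ⟨x, rfl⟩ := cl_surjective m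
    rw [smul_cl, smul_cl, smul_cl, ← cl_mul]
    congr 1
    ext
    exact expo_add _ _ _
  zero_smul m := by
    obtain ⟨x, rfl⟩ := cl_surjective m
    rw [smul_cl, cl_eq_zero]
    change expo (x : G) (0 : A) ∈ s.bot
    rw [expo_zero]
    exact one_mem _

/-- A linear map out of the module `top / bot` given on representatives. -/
def lift {N : Type*} [AddCommGroup N] [Module A N] (φ : s.top → N)
    (hmul : ∀ x y, φ (x * y) = φ x + φ y) (hbot : ∀ x : s.top, (x : G) ∈ s.bot → φ x = 0)
    (hexp : ∀ (α : A) (x : s.top), φ ⟨expo (x : G) α, s.exp_top x x.2 α⟩ = α • φ x) :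
    s.M →ₗ[A] N :=
  { s.toCSec.lift φ hmul hbot with
    map_smul' := fun α m => by
      obtain ⟨x, rfl⟩ := cl_surjective m
      exact hexp α x }

variable {s t} in
/-- The linear map of sections induced by an inclusion of the numerators. -/
def incl (htop : s.top ≤ t.top) (hbot : s.bot ≤ t.bot) : s.M →ₗ[A] t.M :=
  s.lift (fun x => t.cl ⟨x, htop x.2⟩) (fun _ _ => rfl) (fun _ hx => t.cl_eq_zero.2 (hbot hx))
    fun _ _ => rfl

variable {s t} in
/-- The linear map of sections `x ↦ [x, g]`. -/
def commMap (g : G) (htop : ∀ x ∈ s.top, ⁅x, g⁆ ∈ t.top) (hbot : ∀ x ∈ s.bot, ⁅x, g⁆ ∈ t.bot) :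
    s.M →ₗ[A] t.M :=
  s.lift (fun x => t.cl ⟨⁅(x : G), g⁆, htop x x.2⟩)
    (fun x y => by
      rw [add_comm, ← cl_mul, cl_eq_iff_mk]
      change ((⁅(x : G) * y, g⁆ : G) : G ⧸ t.bot) = (⁅(y : G), g⁆ * ⁅(x : G), g⁆ : G)
      rw [commutatorElement_mul_left_eq_conj_mul, QuotientGroup.mk_mul, QuotientGroup.mk_mul,
        QuotientGroup.mk_mul, QuotientGroup.mk_mul, ← (t.mk_commute (htop _ y.2) x).eq,
        QuotientGroup.mk_inv, mul_inv_cancel_right])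
    (fun x hx => t.cl_eq_zero.2 (hbot x hx))
    (fun α x => t.cl_eq_iff_mk.2
      (mk_commutator_expo_left t.exp_bot (t.mk_commute (htop x x.2) x) α))

variable {s} in
/-- For fixed `k`, the class of `[k, g]` depends linearly on `g`, so it lies in a given submodule
for all `g` as soon as it does for a set of generators of the exponential group. -/
theorem cl_commutator_mem_of_generators {X : Set G}
    (hX : ∀ K : Subgroup G, X ⊆ K → IsExpSubgroup A K → K = ⊤)
    (k : G) (hk : ∀ g, ⁅k, g⁆ ∈ s.top) (W : Submodule A s.M)
    (h : ∀ x ∈ X, s.cl ⟨⁅k, x⁆, hk x⟩ ∈ W) (g : G) : s.cl ⟨⁅k, g⁆, hk g⟩ ∈ W := by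
  have hmul : ∀ a b, s.cl ⟨⁅k, a * b⁆, hk _⟩ = s.cl ⟨⁅k, a⁆, hk a⟩ + s.cl ⟨⁅k, b⁆, hk b⟩ := by
    intro a b
    rw [← cl_mul, cl_eq_iff_mk]
    change ((⁅k, a * b⁆ : G) : G ⧸ s.bot) = (⁅k, a⁆ * ⁅k, b⁆ : G)
    have : ⁅k, a * b⁆ = ⁅k, a⁆ * (a * ⁅k, b⁆ * a⁻¹) := by
      simp only [commutatorElement_def]
      group
    rw [this, QuotientGroup.mk_mul, QuotientGroup.mk_mul, QuotientGroup.mk_mul,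
      QuotientGroup.mk_mul, ← (s.mk_commute (hk b) a).eq, QuotientGroup.mk_inv,
      mul_inv_cancel_right]
  have hone : s.cl ⟨⁅k, 1⁆, hk _⟩ = 0 := by
    rw [cl_eq_zero]
    simp
  let S : Subgroup G :=
    { carrier := {g | s.cl ⟨⁅k, g⁆, hk g⟩ ∈ W}
      mul_mem' := fun {a b} ha hb => by
        change s.cl _ ∈ W
        rw [hmul]
        exact W.add_mem ha hb
      one_mem' := by
        change s.cl _ ∈ W
        rw [hone]
        exact W.zero_mem
      inv_mem' := fun {a} ha => by
        have h1 := hmul a⁻¹ a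
        simp only [inv_mul_cancel, hone] at h1
        change s.cl _ ∈ W
        rw [eq_neg_of_add_eq_zero_left h1.symm]
        exact W.neg_mem ha }
  have hS : IsExpSubgroup A S := fun g hg α => by
    change s.cl _ ∈ W
    have e : s.cl ⟨⁅k, expo g α⁆, hk _⟩ = α • s.cl ⟨⁅k, g⁆, hk g⟩ :=
      s.cl_eq_iff_mk.2 (mk_commutator_expo_right s.exp_bot (s.mk_commute (hk g) g) α)
    rw [e]
    exact W.smul_mem α hg
  have hT : g ∈ S := by
    rw [hX S (fun x hx => h x hx) hS]
    exact Subgroup.mem_top g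
  exact hT

/-- The section `K / [K, G]` of a normal `A`-subgroup `K`. -/
def ofNormal (K : Subgroup G) [K.Normal] (hK : IsExpSubgroup A K) : ExpSec A G where
  top := K
  bot := ⁅K, (⊤ : Subgroup G)⁆
  le := Subgroup.commutator_le_left _ _
  central := fun _ hx _ => Subgroup.commutator_mem_commutator hx (Subgroup.mem_top _)
  exp_top := hK
  exp_bot := isExpSubgroup_commutator_top K

/-- The section `[K, G] / [K, G, G]` of a normal subgroup `K`. -/
abbrev ofCommutator (K : Subgroup G) [K.Normal] : ExpSec A G :=
  ofNormal ⁅K, (⊤ : Subgroup G)⁆ (isExpSubgroup_commutator_top K)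

theorem commutator_mem_ofCommutator (K : Subgroup G) [K.Normal] {k : G} (hk : k ∈ K) (g : G) :
    ⁅k, g⁆ ∈ (ofCommutator (A := A) K).top :=
  Subgroup.commutator_mem_commutator hk (Subgroup.mem_top g)

/-- The module `[K, G] / [K, G, G]` is additively generated by the commutators `[k, g]`. -/
theorem eq_top_of_commutator_mem (K : Subgroup G) [K.Normal]
    (W : Submodule A (ofCommutator (A := A) K).M)
    (h : ∀ k (hk : k ∈ K) (g : G),
      (ofCommutator K).cl ⟨⁅k, g⁆, commutator_mem_ofCommutator K hk g⟩ ∈ W) : W = ⊤ := by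
  rw [eq_top_iff]
  rintro m -
  obtain ⟨⟨z, hz⟩, rfl⟩ := cl_surjective m
  suffices H : ∃ h : z ∈ (ofCommutator (A := A) K).top, (ofCommutator K).cl ⟨z, h⟩ ∈ W from H.2
  have hz' : z ∈ ⁅K, (⊤ : Subgroup G)⁆ := hz
  clear hz
  rw [Subgroup.commutator_def] at hz'
  induction hz' using Subgroup.closure_induction with
  | mem z hz =>
    obtain ⟨k, hk, g, -, rfl⟩ := hz
    exact ⟨_, h k hk g⟩
  | one => exact ⟨one_mem _, W.zero_mem⟩
  | mul x y _ _ hx hy => exact ⟨mul_mem hx.1 hy.1, W.add_mem hx.2 hy.2⟩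
  | inv x _ hx => exact ⟨inv_mem hx.1, W.neg_mem hx.2⟩

/-- The linear map `(k_x)_x ↦ ∑ [k_x, x]` from powers of `K / [K, G]` to `[K, G] / [K, G, G]`. -/
def sumComm (X : Finset G) (K : Subgroup G) [K.Normal] (hK : IsExpSubgroup A K) :
    (X → (ofNormal K hK).M) →ₗ[A] (ofCommutator (A := A) K).M :=
  ∑ x : X, (commMap (s := ofNormal K hK) (t := ofCommutator K) (x : G)
    (fun _ hk => Subgroup.commutator_mem_commutator hk (Subgroup.mem_top _))
    (fun _ hk => Subgroup.commutator_mem_commutator hk (Subgroup.mem_top _))).comp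
      (LinearMap.proj x)

theorem sumComm_surjective {X : Finset G}
    (hX : ∀ K : Subgroup G, (X : Set G) ⊆ K → IsExpSubgroup A K → K = ⊤)
    (K : Subgroup G) [K.Normal] (hK : IsExpSubgroup A K) :
    Function.Surjective (sumComm X K hK) := by
  classical
  rw [← LinearMap.range_eq_top]
  refine eq_top_of_commutator_mem K _ fun k hk g => ?_
  refine cl_commutator_mem_of_generators hX k (fun g => commutator_mem_ofCommutator K hk g) _
    (fun x hx => ?_) g
  refine ⟨Pi.single ⟨x, hx⟩ ((ofNormal K hK).cl ⟨k, hk⟩), ?_⟩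
  rw [sumComm, LinearMap.sum_apply, Finset.sum_eq_single ⟨x, hx⟩]
  · rw [LinearMap.comp_apply, LinearMap.proj_apply, Pi.single_eq_same]
    rfl
  · intro y _ hy
    simp [Pi.single_eq_of_ne hy]
  · simp

end ExpSec

end Sections

/-! ### Noetherian rings of exponents -/

section Noetherian

variable {A : Type*} [CommRing A] [BinomialRing A]
  {G : Type*} [Group G] [Group.IsNilpotent G] [ExpGroup A G]

namespace ExpSec

open ExpGroup

theorem subsingleton_of_top_eq_bot (s : ExpSec A G) (h : s.top ≤ s.bot) : Subsingleton s.M := by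
  refine subsingleton_of_forall_eq 0 fun m => ?_
  obtain ⟨x, rfl⟩ := cl_surjective m
  exact s.cl_eq_zero.2 (h x.2)

theorem finite_ofNormal_top {X : Finset G}
    (hX : ∀ K : Subgroup G, (X : Set G) ⊆ K → IsExpSubgroup A K → K = ⊤) :
    Module.Finite A (ofNormal (A := A) (⊤ : Subgroup G) (IsExpSubgroup.top A)).M := by
  classical
  set s := ofNormal (A := A) (⊤ : Subgroup G) (IsExpSubgroup.top A) with hs
  let q : G → s.M := fun g => s.cl ⟨g, Subgroup.mem_top g⟩
  refine ⟨⟨X.image q, ?_⟩⟩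
  set W := Submodule.span A ((X.image q : Finset s.M) : Set s.M) with hW
  let S : Subgroup G :=
    { carrier := {g | q g ∈ W}
      mul_mem' := fun {a b} ha hb => W.add_mem ha hb
      one_mem' := W.zero_mem
      inv_mem' := fun {a} ha => W.neg_mem ha }
  have h : S = ⊤ := hX S
    (fun x hx => Submodule.subset_span (Finset.mem_coe.2 (Finset.mem_image_of_mem q hx)))
    (fun g hg α => W.smul_mem α hg)
  rw [eq_top_iff]
  rintro m -
  obtain ⟨⟨x, hx⟩, rfl⟩ := cl_surjective m
  have : x ∈ S := h ▸ Subgroup.mem_top x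
  exact this

theorem finite_ofCommutator {X : Finset G}
    (hX : ∀ K : Subgroup G, (X : Set G) ⊆ K → IsExpSubgroup A K → K = ⊤)
    (K : Subgroup G) [K.Normal] (hK : IsExpSubgroup A K) [Module.Finite A (ofNormal K hK).M] :
    Module.Finite A (ofCommutator (A := A) K).M :=
  Module.Finite.of_surjective (sumComm X K hK) (sumComm_surjective hX K hK)

/-- The part of a section `s` contained in a normal `A`-subgroup `L`. -/
def inf (s : ExpSec A G) (L : Subgroup G) [L.Normal] (hL : IsExpSubgroup A L) : ExpSec A G where
  top := s.top ⊓ L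
  bot := s.bot ⊓ L
  le := inf_le_inf_right _ s.le
  central := fun x hx g => ⟨s.central x hx.1 g, Subgroup.commutator_le_left L ⊤
    (Subgroup.commutator_mem_commutator hx.2 (Subgroup.mem_top g))⟩
  exp_top := s.exp_top.inf hL
  exp_bot := s.exp_bot.inf hL

/-- The quotient of a section `s` by the image of its part contained in `L`. -/
def mod (s : ExpSec A G) (L : Subgroup G) (hL : IsExpSubgroup A L) : ExpSec A G where
  top := s.top
  bot := s.bot ⊔ (s.top ⊓ L)
  le := sup_le s.le inf_le_left
  central := fun x hx g => Subgroup.mem_sup_left (s.central x hx g)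
  exp_top := s.exp_top
  exp_bot := fun g hg α => by
    obtain ⟨b, hb, l, hl, rfl⟩ := Subgroup.mem_sup_of_normal_left.1 hg
    have h1 : ((b * l : G) : G ⧸ s.bot) = l := by
      rw [QuotientGroup.mk_mul, (QuotientGroup.eq_one_iff b).2 hb, one_mul]
    have h2 := QuotientGroup.eq.1 (mk_expo_congr s.exp_bot h1 α).symm
    have h3 : expo (b * l) α = expo l α * ((expo l α)⁻¹ * expo (b * l) α) := by group
    rw [h3]
    exact mul_mem (Subgroup.mem_sup_right ⟨s.exp_top l hl.1 α, hL l hl.2 α⟩)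
      (Subgroup.mem_sup_left h2)

variable [IsNoetherianRing A]

/-- One step down a central series with finitely generated factors: if sections inside `[K, G]`
are Noetherian and `K / [K, G]` is finitely generated, then sections inside `K` are Noetherian. -/
theorem isNoetherian_step (K : Subgroup G) [K.Normal] (hK : IsExpSubgroup A K)
    [Module.Finite A (ofNormal K hK).M]
    (h : ∀ s : ExpSec A G, s.top ≤ ⁅K, (⊤ : Subgroup G)⁆ → IsNoetherian A s.M)
    (s : ExpSec A G) (hs : s.top ≤ K) : IsNoetherian A s.M := by
  set L := ⁅K, (⊤ : Subgroup G)⁆ with hLdef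
  have hL : IsExpSubgroup A L := isExpSubgroup_commutator_top K
  have : IsNoetherian A (ofNormal K hK).M := isNoetherian_of_isNoetherianRing_of_finite _ _
  have h1 : IsNoetherian A (s.inf L hL).M := h _ inf_le_right
  -- the quotient of `s` by its part in `L`, before dividing by the denominator of `s`
  let s₂ : ExpSec A G :=
    { top := s.top
      bot := s.top ⊓ L
      le := inf_le_left
      central := fun x hx g => ⟨s.le (s.central x hx g),
        Subgroup.commutator_mem_commutator (hs hx) (Subgroup.mem_top g)⟩
      exp_top := s.exp_top
      exp_bot := s.exp_top.inf hL }
  have h2 : IsNoetherian A s₂.M := by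
    refine isNoetherian_of_injective (incl (s := s₂) (t := ofNormal K hK) hs inf_le_right) ?_
    rw [injective_iff_map_eq_zero]
    intro m hm
    obtain ⟨x, rfl⟩ := cl_surjective m
    exact s₂.cl_eq_zero.2 ⟨x.2, (ofNormal K hK).cl_eq_zero.1 hm⟩
  have h3 : IsNoetherian A (s.mod L hL).M := by
    refine isNoetherian_of_surjective (f := incl (s := s₂) (t := s.mod L hL) le_rfl le_sup_right)
      (LinearMap.range_eq_top.2 fun m => ?_)
    obtain ⟨x, rfl⟩ := cl_surjective m
    exact ⟨s₂.cl x, rfl⟩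
  refine isNoetherian_of_range_eq_ker
    (incl (s := s.inf L hL) (t := s) inf_le_left inf_le_left)
    (incl (s := s) (t := s.mod L hL) le_rfl le_sup_left) (le_antisymm ?_ ?_)
  · rintro _ ⟨m, rfl⟩
    obtain ⟨x, rfl⟩ := cl_surjective m
    exact (s.mod L hL).cl_eq_zero.2 (Subgroup.mem_sup_right x.2)
  · intro m hm
    obtain ⟨⟨x, hx⟩, rfl⟩ := cl_surjective m
    have hx' : x ∈ s.bot ⊔ (s.top ⊓ L) := (s.mod L hL).cl_eq_zero.1 hm
    obtain ⟨b, hb, l, hl, rfl⟩ := Subgroup.mem_sup_of_normal_left.1 hx'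
    refine ⟨(s.inf L hL).cl ⟨l, hl⟩, ?_⟩
    change s.cl ⟨l, hl.1⟩ = _
    refine s.cl_eq_iff.2 ?_
    have : l * (b * l)⁻¹ = b⁻¹ := by group
    rw [this]
    exact inv_mem hb

/-- In a finitely generated exponential group over a Noetherian ring, every section by `A`-subgroups
is a Noetherian module. -/
theorem isNoetherian_of_expFG (hfg : ExpFG A G) (s : ExpSec A G) : IsNoetherian A s.M := by
  obtain ⟨X, hX⟩ := hfg
  suffices H : ∀ n, ∀ (K : Subgroup G) (_ : K.Normal) (hK : IsExpSubgroup A K),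
      Module.Finite A (ofNormal K hK).M → K ≤ Subgroup.upperCentralSeries G n →
      ∀ s : ExpSec A G, s.top ≤ K → IsNoetherian A s.M by
    obtain ⟨n, hn⟩ := Group.IsNilpotent.nilpotent G
    exact H n ⊤ inferInstance (IsExpSubgroup.top A) (finite_ofNormal_top hX) hn.ge s le_top
  intro n
  induction n with
  | zero =>
    intro K _ hK _ h s hs
    have := s.subsingleton_of_top_eq_bot ((hs.trans h).trans (by simp))
    infer_instance
  | succ n ih =>
    intro K _ hK _ h
    refine isNoetherian_step K hK (ih _ inferInstance (isExpSubgroup_commutator_top K)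
      (finite_ofCommutator hX K hK) ?_)
    exact Subgroup.commutator_le.2 fun k hk g _ =>
        (Subgroup.mem_upperCentralSeries_succ_iff).1 (h hk) g

end ExpSec

end Noetherian

/-! ### Verbal width of `[K, G]` -/

section Width

/-- The products of `n` commutators `[r, g]` with `r ∈ K`. -/
def commWidth {G : Type*} [Group G] (K : Subgroup G) : ℕ → Set G
  | 0 => {1}
  | n + 1 => {w | ∃ r ∈ K, ∃ g, ∃ z ∈ commWidth K n, w = ⁅r, g⁆ * z}

section

variable {G : Type*} [Group G] {K : Subgroup G}

theorem mul_mem_commWidth {n m : ℕ} {x y : G} (hx : x ∈ commWidth K n) (hy : y ∈ commWidth K m) :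
    x * y ∈ commWidth K (n + m) := by
  induction n generalizing x with
  | zero =>
    rw [commWidth, Set.mem_singleton_iff] at hx
    rwa [hx, one_mul, zero_add]
  | succ n ih =>
    obtain ⟨r, hr, g, z, hz, rfl⟩ := hx
    rw [Nat.succ_add, mul_assoc]
    exact ⟨r, hr, g, _, ih hz, rfl⟩

theorem commutator_mem_commWidth {r : G} (hr : r ∈ K) (g : G) : ⁅r, g⁆ ∈ commWidth K 1 :=
  ⟨r, hr, g, 1, rfl, (mul_one _).symm⟩

theorem commWidth_mono {L : Subgroup G} (h : L ≤ K) (n : ℕ) : commWidth L n ⊆ commWidth K n := by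
  induction n with
  | zero => exact subset_rfl
  | succ n ih =>
    rintro _ ⟨r, hr, g, z, hz, rfl⟩
    exact ⟨r, h hr, g, z, ih hz, rfl⟩

theorem commWidth_le (n : ℕ) : commWidth K n ⊆ (⁅K, (⊤ : Subgroup G)⁆ : Subgroup G) := by
  induction n with
  | zero =>
    rintro _ rfl
    exact one_mem _
  | succ n ih =>
    rintro _ ⟨r, hr, g, z, hz, rfl⟩
    exact mul_mem (Subgroup.commutator_mem_commutator hr (Subgroup.mem_top g)) (ih hz)

theorem commWidth_subset_succ (n : ℕ) : commWidth K n ⊆ commWidth K (n + 1) := fun z hz =>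
  ⟨1, one_mem _, 1, z, hz, by simp⟩

theorem inv_mem_commWidth [K.Normal] {n : ℕ} {x : G} (hx : x ∈ commWidth K n) :
    x⁻¹ ∈ commWidth K n := by
  induction n generalizing x with
  | zero =>
    obtain rfl := hx
    simp [commWidth]
  | succ n ih =>
    obtain ⟨r, hr, g, z, hz, rfl⟩ := hx
    rw [mul_inv_rev]
    refine mul_mem_commWidth (ih hz) ?_
    have : ⁅r, g⁆⁻¹ = ⁅r⁻¹, r * g * r⁻¹⁆ := by
      simp only [commutatorElement_def]
      group
    rw [this]
    exact commutator_mem_commWidth (inv_mem hr) _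

/-- Once products of `n + 1` commutators are products of `n`, the latter exhaust `[K, G]`. -/
theorem coe_commutator_eq_commWidth [K.Normal] {n : ℕ} (h : commWidth K (n + 1) ⊆ commWidth K n) :
    ((⁅K, (⊤ : Subgroup G)⁆ : Subgroup G) : Set G) = commWidth K n := by
  have h' : ∀ m, commWidth K (n + m) ⊆ commWidth K n := by
    intro m
    induction m with
    | zero => exact subset_rfl
    | succ m ih =>
      refine Set.Subset.trans ?_ h
      rintro _ ⟨r, hr, g, z, hz, rfl⟩
      exact ⟨r, hr, g, z, ih hz, rfl⟩
  have hle : ∀ m, commWidth K m ⊆ commWidth K n := fun m => by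
    refine Set.Subset.trans ?_ (h' m)
    have : ∀ k, commWidth K m ⊆ commWidth K (k + m) := fun k => by
      induction k with
      | zero => rw [zero_add]
      | succ k ih =>
        rw [Nat.succ_add]
        exact ih.trans (commWidth_subset_succ _)
    exact this n
  refine Set.Subset.antisymm ?_ (commWidth_le n)
  let S : Subgroup G :=
    { carrier := commWidth K n
      mul_mem' := fun ha hb => hle _ (mul_mem_commWidth ha hb)
      one_mem' := hle 0 rfl
      inv_mem' := inv_mem_commWidth }
  have : ⁅K, (⊤ : Subgroup G)⁆ ≤ S :=
    Subgroup.commutator_le.2 fun r hr g _ => hle 1 (commutator_mem_commWidth hr g)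
  exact this

end

variable {A : Type*} [CommRing A] [BinomialRing A]
  {G : Type*} [Group G] [Group.IsNilpotent G] [ExpGroup A G]

open ExpGroup ExpSec

/-- A sum of `n` classes of commutators is the class of an element of `commWidth K n`. -/
theorem exists_commWidth_cl_eq_sum {ι : Type*} (K : Subgroup G) [K.Normal] (k g : ι → G)
    (hk : ∀ i, k i ∈ K) (F : Finset ι) :
    ∃ p, ∃ hp : p ∈ (ofCommutator (A := A) K).top, p ∈ commWidth K F.card ∧
      (ofCommutator K).cl ⟨p, hp⟩ =
        ∑ i ∈ F, (ofCommutator K).cl ⟨⁅k i, g i⁆, commutator_mem_ofCommutator K (hk i) _⟩ := by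
  classical
  induction F using Finset.induction_on with
  | empty => exact ⟨1, one_mem _, rfl, rfl⟩
  | insert i F hi ih =>
    obtain ⟨p, hp, hpw, e⟩ := ih
    rw [Finset.card_insert_of_notMem hi]
    refine ⟨⁅k i, g i⁆ * p, mul_mem (commutator_mem_ofCommutator K (hk i) _) hp,
      ⟨_, hk i, _, _, hpw, rfl⟩, ?_⟩
    rw [Finset.sum_insert hi, ← e]
    rfl

/-- Width modulo `[K, G, G]` and width of `[K, G, G]` add up to a width of `[K, G]`. -/
theorem width_of_width_mod (K : Subgroup G) [K.Normal] {n m : ℕ}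
    (hn : ∀ z (hz : z ∈ (ofCommutator (A := A) K).top), ∃ p,
      ∃ hp : p ∈ (ofCommutator (A := A) K).top, p ∈ commWidth K n ∧
      (ofCommutator K).cl ⟨p, hp⟩ = (ofCommutator K).cl ⟨z, hz⟩)
    (hm : ((⁅⁅K, (⊤ : Subgroup G)⁆, (⊤ : Subgroup G)⁆ : Subgroup G) : Set G) ⊆
      commWidth ⁅K, (⊤ : Subgroup G)⁆ m) :
    ((⁅K, (⊤ : Subgroup G)⁆ : Subgroup G) : Set G) ⊆ commWidth K (n + m) := by
  intro z hz
  obtain ⟨p, hp, hpw, e⟩ := hn z hz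
  rw [cl_eq_iff_mk] at e
  have h1 : p⁻¹ * z ∈ commWidth K m :=
    commWidth_mono (Subgroup.commutator_le_left _ _) m (hm (QuotientGroup.eq.1 e))
  have := mul_mem_commWidth hpw h1
  rwa [mul_inv_cancel_left] at this

/-- In a finitely generated exponential group, `[K, G]` has finite width for every normal
`A`-subgroup `K`: modulo `[K, G, G]` its elements are products `∏ [k_x, x]` over the generators. -/
theorem exists_width_of_isExpSubgroup (hfg : ExpFG A G) (K : Subgroup G) [K.Normal]
    (hK : IsExpSubgroup A K) :
    ∃ n, ((⁅K, (⊤ : Subgroup G)⁆ : Subgroup G) : Set G) ⊆ commWidth K n := by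
  obtain ⟨X, hX⟩ := hfg
  suffices H : ∀ n, ∀ K : Subgroup G, K.Normal → IsExpSubgroup A K →
      K ≤ Subgroup.upperCentralSeries G n →
      ∃ n, ((⁅K, (⊤ : Subgroup G)⁆ : Subgroup G) : Set G) ⊆ commWidth K n by
    obtain ⟨n, hn⟩ := Group.IsNilpotent.nilpotent G
    exact H n K inferInstance hK (le_top.trans hn.ge)
  clear! K
  intro n
  induction n with
  | zero =>
    intro K _ _ h
    rw [Subgroup.upperCentralSeries_zero, le_bot_iff] at h
    rw [h, Subgroup.commutator_bot_left]
    exact ⟨0, fun x hx => hx⟩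
  | succ n ih =>
    intro K _ hK h
    obtain ⟨m, hm⟩ := ih ⁅K, (⊤ : Subgroup G)⁆ inferInstance
      (isExpSubgroup_commutator_top (A := A) K)
      (Subgroup.commutator_le.2 fun k hk g _ =>
        (Subgroup.mem_upperCentralSeries_succ_iff).1 (h hk) g)
    refine ⟨_, width_of_width_mod (A := A) K (n := (Finset.univ : Finset X).card)
      (fun z hz => ?_) hm⟩
    obtain ⟨κ, e⟩ := sumComm_surjective hX K hK ((ofCommutator K).cl ⟨z, hz⟩)
    choose k hk using fun x => cl_surjective (κ x)
    obtain ⟨p, hp, hpw, e'⟩ := exists_commWidth_cl_eq_sum (A := A) K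
      (fun x : X => (k x : G)) (fun x => (x : G)) (fun x => (k x).2) Finset.univ
    refine ⟨p, hp, hpw, e'.trans (Eq.trans ?_ e)⟩
    rw [sumComm, LinearMap.sum_apply]
    refine Finset.sum_congr rfl fun x _ => ?_
    rw [LinearMap.comp_apply, LinearMap.proj_apply, ← hk]
    rfl

/-- Over a Noetherian ring of exponents, `[K, G]` has finite width for every normal subgroup `K`:
the module `[K, G] / [K, G, G]` is generated by finitely many commutators `[k, g]`, and
`α • [k, g] = [k, g ^ α]`. -/
theorem exists_width_of_isNoetherianRing [IsNoetherianRing A] (hfg : ExpFG A G)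
    (K : Subgroup G) [K.Normal] :
    ∃ n, ((⁅K, (⊤ : Subgroup G)⁆ : Subgroup G) : Set G) ⊆ commWidth K n := by
  classical
  obtain ⟨m, hm⟩ := exists_width_of_isExpSubgroup hfg ⁅K, (⊤ : Subgroup G)⁆
    (isExpSubgroup_commutator_top (A := A) K)
  set s := ofCommutator (A := A) K with hs
  have hN : IsNoetherian A s.M := isNoetherian_of_expFG hfg s
  let q : K × G → s.M := fun x => s.cl ⟨⁅(x.1 : G), x.2⁆, commutator_mem_ofCommutator K x.1.2 _⟩
  have htop : Submodule.span A (Set.range q) = ⊤ :=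
    eq_top_of_commutator_mem K _ fun k hk g => Submodule.subset_span ⟨(⟨k, hk⟩, g), rfl⟩
  obtain ⟨t, ht, hspan⟩ := Submodule.fg_span_iff_fg_span_finset_subset _ |>.1
    (hN.noetherian (Submodule.span A (Set.range q)))
  obtain ⟨F, rfl⟩ : ∃ F : Finset (K × G), t = F.image q := by
    obtain ⟨F, -, hF⟩ := Finset.subset_set_image_iff.1
      (show (t : Set s.M) ⊆ q '' Set.univ by rwa [Set.image_univ])
    exact ⟨F, hF.symm⟩
  refine ⟨_, width_of_width_mod (A := A) K (n := F.card) (fun z hz => ?_) hm⟩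
  have hmem : s.cl ⟨z, hz⟩ ∈ Submodule.span A (q '' (F : Set (K × G))) := by
    rw [← Finset.coe_image, ← hspan, htop]
    exact Submodule.mem_top
  obtain ⟨α, hα⟩ := (Submodule.mem_span_image_finset_iff_exists_fun' A).1 hmem
  obtain ⟨p, hp, hpw, e⟩ := exists_commWidth_cl_eq_sum (A := A) K
    (fun x : K × G => (x.1 : G)) (fun x => expo x.2 (α x)) (fun x => x.1.2) F
  refine ⟨p, hp, hpw, e.trans (Eq.trans ?_ hα)⟩
  refine Finset.sum_congr rfl fun x _ => ?_
  have hx := commutator_mem_ofCommutator (A := A) K x.1.2 x.2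
  exact s.cl_eq_iff_mk.2 (mk_commutator_expo_right s.exp_bot (s.mk_commute hx x.2) _)

end Width

/-! ### Finite complete systems -/

section Complete

variable {A : Type*} [CommRing A] [BinomialRing A]
  {G : Type*} [Group G] [Group.IsNilpotent G] [ExpGroup A G]

open ExpGroup ExpSec

theorem CentralSeries.isExpSubgroup_Rl {c : ℕ} (R : CentralSeries G c) (i : ℕ) :
    IsExpSubgroup A (R.Rl i) := by
  match i with
  | 0 => exact IsExpSubgroup.top A
  | 1 => exact IsExpSubgroup.top A
  | i + 2 => exact isExpSubgroup_commutator_top _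

/-- The elements of `e` detect all classes of `R^u_i / R^u_{i+1}` under the bilinear maps `f_i`. -/
def CentralSeries.IsComplete {G : Type*} [Group G] {c : ℕ} (R : CentralSeries G c) {m : ℕ}
    (e : Fin m → G) : Prop :=
  ∀ i : CentralSeries.Idx c, ∀ y ∈ R.Ru i, (∀ j, ⁅e j, y⁆ ∈ R.Rl (i + 2)) → y ∈ R.Ru (i + 1)

/-- In a finitely generated exponential group, the generators form a complete system. -/
theorem CentralSeries.exists_isComplete (hfg : ExpFG A G) {c : ℕ} (R : CentralSeries G c) :
    ∃ (m : ℕ) (e : Fin m → G), R.IsComplete e := by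
  obtain ⟨X, hX⟩ := hfg
  refine ⟨X.card, fun j => X.equivFin.symm j, fun i y hy h g => ?_⟩
  let s : ExpSec A G :=
    { R.L (i + 1) with
      exp_top := R.isExpSubgroup_Rl _
      exp_bot := R.isExpSubgroup_Rl _ }
  have hk : ∀ g, ⁅y, g⁆ ∈ s.top := R.Ru_comm i y hy
  have h1 := cl_commutator_mem_of_generators hX y hk ⊥ (fun x hx => by
    rw [Submodule.mem_bot, cl_eq_zero]
    have := inv_mem (h (X.equivFin ⟨x, hx⟩))
    beta_reduce at this
    rw [Equiv.symm_apply_apply, commutatorElement_inv] at this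
    exact this) g
  rw [Submodule.mem_bot, cl_eq_zero] at h1
  exact h1

end Complete

/-! ### Formulas for central series and transfer to elementarily equivalent groups -/

section Transfer

open Language

namespace GroupTerm

variable {α : Type*}

/-- The product of two terms of the language of groups. -/
def mul (s t : groupLang.Term α) : groupLang.Term α :=
  Functions.apply₂ (GroupFunc.mul : groupLang.Functions 2) s t

/-- The inverse of a term of the language of groups. -/
def inv (s : groupLang.Term α) : groupLang.Term α :=
  Functions.apply₁ (GroupFunc.inv : groupLang.Functions 1) s

/-- The term for the neutral element. -/
def one : groupLang.Term α := Constants.term (GroupFunc.one : groupLang.Constants)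

/-- The commutator of two terms of the language of groups. -/
def comm (s t : groupLang.Term α) : groupLang.Term α := mul (mul (mul s t) (inv s)) (inv t)

variable {H : Type*} [Group H] (v : α → H)

@[simp]
theorem realize_mul (s t : groupLang.Term α) :
    (mul s t).realize v = s.realize v * t.realize v :=
  Term.realize_functions_apply₂

@[simp]
theorem realize_inv (s : groupLang.Term α) : (inv s).realize v = (s.realize v)⁻¹ :=
  Term.realize_functions_apply₁

@[simp]
theorem realize_one : (one : groupLang.Term α).realize v = 1 :=
  Term.realize_constants

@[simp]
theorem realize_comm (s t : groupLang.Term α) :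
    (comm s t).realize v = ⁅s.realize v, t.realize v⁆ := by
  simp [comm, commutatorElement_def]

end GroupTerm

/-- The formula `φ` in one variable, at a term. -/
def atTerm {α : Type*} (φ : groupLang.Formula (Fin 1)) (t : groupLang.Term α) :
    groupLang.Formula α :=
  BoundedFormula.subst φ fun _ => t

@[simp]
theorem realize_atTerm {α : Type*} (φ : groupLang.Formula (Fin 1)) (t : groupLang.Term α)
    {H : Type*} [Group H] (v : α → H) :
    (atTerm φ t).Realize v ↔ φ.Realize fun _ => t.realize v :=
  BoundedFormula.realize_subst

/-- A formula that holds identically in `G` holds identically in every model of its theory. -/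
theorem realize_of_model {G H : Type*} [Group G] [Group H]
    (h : H ⊨ groupLang.completeTheory G) {β : Type*} [Finite β] (φ : groupLang.Formula β)
    (hφ : ∀ v : β → G, φ.Realize v) (v : β → H) : φ.Realize v := by
  let ψ : groupLang.Sentence := (φ.relabel (Sum.inr : β → Empty ⊕ β)).iAlls β
  have h1 : G ⊨ ψ := by
    simp only [ψ, Sentence.Realize, Formula.realize_iAlls, Formula.realize_relabel]
    exact fun w => hφ w
  have h2 : H ⊨ ψ := h.realize_of_mem ψ h1
  simp only [ψ, Sentence.Realize, Formula.realize_iAlls, Formula.realize_relabel] at h2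
  exact h2 v

/-- The formulas `σ_i` define in `H` the terms of a central series of length `c`. Each field says
that a formula holds identically in `H`, so that the property depends only on the theory of `H`. -/
structure IsSeries (σ : ℕ → groupLang.Formula (Fin 1)) (c : ℕ) (H : Type*) [Group H] : Prop where
  one_mem : ∀ i, (σ i).Realize fun _ => (1 : H)
  mul_mem : ∀ i (x y : H), (σ i).Realize (fun _ => x) → (σ i).Realize (fun _ => y) →
    (σ i).Realize fun _ => x * y
  inv_mem : ∀ i (x : H), (σ i).Realize (fun _ => x) → (σ i).Realize fun _ => x⁻¹
  anti : ∀ i (x : H), (σ (i + 1)).Realize (fun _ => x) → (σ i).Realize fun _ => x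
  first : ∀ x : H, (σ 1).Realize fun _ => x
  last : ∀ x : H, (σ (c + 1)).Realize (fun _ => x) → x = 1
  central : ∀ i (x g : H), (σ i).Realize (fun _ => x) → (σ (i + 1)).Realize fun _ => ⁅x, g⁆

variable {σ : ℕ → groupLang.Formula (Fin 1)} {c : ℕ}

theorem IsSeries.of_defines {G : Type*} [Group G] (R : CentralSeries G c)
    (hσ : ∀ i, Defines (σ i) (R.term i)) : IsSeries σ c G where
  one_mem i := (hσ i 1).2 (R.term i).one_mem
  mul_mem i x y hx hy := (hσ i _).2 ((R.term i).mul_mem ((hσ i x).1 hx) ((hσ i y).1 hy))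
  inv_mem i x hx := (hσ i _).2 ((R.term i).inv_mem ((hσ i x).1 hx))
  anti i x hx := (hσ i x).2 (R.anti i.le_succ ((hσ _ x).1 hx))
  first x := (hσ 1 x).2 (R.first ▸ Subgroup.mem_top x)
  last x hx := by
    have := (hσ _ x).1 hx
    rwa [R.last, Subgroup.mem_bot] at this
  central i x g hx := (hσ _ _).2 (R.central i
    (Subgroup.commutator_mem_commutator ((hσ i x).1 hx) (Subgroup.mem_top g)))

open GroupTerm in
theorem IsSeries.of_model {G H : Type*} [Group G] [Group H] (hG : IsSeries σ c G)
    (h : H ⊨ groupLang.completeTheory G) : IsSeries σ c H where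
  one_mem i := by
    have := realize_of_model h (β := Fin 0) (atTerm (σ i) one)
      (fun v => by simpa using hG.one_mem i) default
    simpa using this
  mul_mem i x y := by
    have := realize_of_model h (β := Fin 2) ((atTerm (σ i) (Term.var 0)).imp
      ((atTerm (σ i) (Term.var 1)).imp (atTerm (σ i) (mul (Term.var 0) (Term.var 1)))))
      (fun v => by simpa using hG.mul_mem i (v 0) (v 1)) ![x, y]
    simpa using this
  inv_mem i x := by
    have := realize_of_model h (β := Fin 1) ((atTerm (σ i) (Term.var 0)).imp
      (atTerm (σ i) (inv (Term.var 0)))) (fun v => by simpa using hG.inv_mem i (v 0)) ![x]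
    simpa using this
  anti i x := by
    have := realize_of_model h (β := Fin 1) ((atTerm (σ (i + 1)) (Term.var 0)).imp
      (atTerm (σ i) (Term.var 0))) (fun v => by simpa using hG.anti i (v 0)) ![x]
    simpa using this
  first x := by
    have := realize_of_model h (β := Fin 1) (atTerm (σ 1) (Term.var 0))
      (fun v => by simpa using hG.first (v 0)) ![x]
    simpa using this
  last x := by
    have := realize_of_model h (β := Fin 1) ((atTerm (σ (c + 1)) (Term.var 0)).imp
      (Term.equal (Term.var 0) one)) (fun v => by simpa using hG.last (v 0)) ![x]
    simpa using this
  central i x g := by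
    have := realize_of_model h (β := Fin 2) ((atTerm (σ i) (Term.var 0)).imp
      (atTerm (σ (i + 1)) (comm (Term.var 0) (Term.var 1))))
      (fun v => by simpa using hG.central i (v 0) (v 1)) ![x, g]
    simpa using this

/-- The central series defined by formulas. -/
def IsSeries.series {H : Type*} [Group H] (h : IsSeries σ c H) : CentralSeries H c where
  term i :=
    { carrier := {x | (σ i).Realize fun _ => x}
      one_mem' := h.one_mem i
      mul_mem' := h.mul_mem i _ _
      inv_mem' := h.inv_mem i _ }
  anti := antitone_nat_of_succ_le fun i => h.anti i
  first := eq_top_iff.2 fun x _ => h.first x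
  last := eq_bot_iff.2 fun x hx => Subgroup.mem_bot.2 (h.last x hx)
  central i := Subgroup.commutator_le.2 fun x hx g _ => h.central i x g hx

theorem IsSeries.defines_series {H : Type*} [Group H] (h : IsSeries σ c H) (i : ℕ) :
    Defines (σ i) (h.series.term i) := fun _ => Iff.rfl

/-- A formula for `commWidth K n`, where `K` is defined by `φ`. -/
noncomputable def widthFormula (φ : groupLang.Formula (Fin 1)) : ℕ → groupLang.Formula (Fin 1)
  | 0 => Term.equal (Term.var 0) GroupTerm.one
  | n + 1 => Formula.iExs (Fin 3)
      (atTerm φ (Term.var (Sum.inr 0)) ⊓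
        (atTerm (widthFormula φ n) (Term.var (Sum.inr 2)) ⊓
          Term.equal (Term.var (Sum.inl 0)) (GroupTerm.mul
            (GroupTerm.comm (Term.var (Sum.inr 0)) (Term.var (Sum.inr 1)))
            (Term.var (Sum.inr 2)))))

theorem realize_widthFormula {φ : groupLang.Formula (Fin 1)} {H : Type*} [Group H]
    {K : Subgroup H} (hφ : Defines φ K) (n : ℕ) (x : H) :
    ((widthFormula φ n).Realize fun _ => x) ↔ x ∈ commWidth K n := by
  induction n generalizing x with
  | zero => simp [widthFormula, commWidth]
  | succ n ih =>
    simp only [widthFormula, Formula.realize_iExs, Formula.realize_inf, realize_atTerm,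
      Term.realize_var, Sum.elim_inr, hφ _, ih, Formula.realize_equal, Sum.elim_inl,
      GroupTerm.realize_mul, GroupTerm.realize_comm]
    constructor
    · rintro ⟨w, h1, h2, h3⟩
      exact ⟨w 0, h1, w 1, w 2, h2, h3⟩
    · rintro ⟨r, hr, g, z, hz, e⟩
      exact ⟨![r, g, z], hr, hz, e⟩

/-- The verbal widths of the subgroups `[R_i, H]` are bounded by `N i`. -/
def CentralSeries.HasWidth {H : Type*} [Group H] (R : CentralSeries H c) (N : ℕ → ℕ) : Prop :=
  ∀ i, ((⁅R.term i, (⊤ : Subgroup H)⁆ : Subgroup H) : Set H) = commWidth (R.term i) (N i)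

/-- A formula for `[R_i, H]`. -/
noncomputable def commFormula (σ : ℕ → groupLang.Formula (Fin 1)) (N : ℕ → ℕ) (i : ℕ) :
    groupLang.Formula (Fin 1) := widthFormula (σ i) (N i)

/-- A formula for `R^l_i`. -/
noncomputable def lowerFormula (σ : ℕ → groupLang.Formula (Fin 1)) (N : ℕ → ℕ) :
    ℕ → groupLang.Formula (Fin 1)
  | 0 => ⊤
  | 1 => ⊤
  | i + 2 => commFormula σ N (i + 1)

/-- A formula for `R^u_i`. -/
noncomputable def upperFormula (σ : ℕ → groupLang.Formula (Fin 1)) (N : ℕ → ℕ) (i : ℕ) :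
    groupLang.Formula (Fin 1) :=
  Formula.iAlls (Fin 1) (atTerm (commFormula σ N i)
    (GroupTerm.comm (Term.var (Sum.inl 0)) (Term.var (Sum.inr 0))))

section

variable {H : Type*} [Group H] {R : CentralSeries H c} {N : ℕ → ℕ}
  (hσ : ∀ i, Defines (σ i) (R.term i)) (hN : R.HasWidth N)

include hσ hN

theorem defines_commFormula (i : ℕ) :
    Defines (commFormula σ N i) ⁅R.term i, (⊤ : Subgroup H)⁆ := fun x => by
  rw [commFormula, realize_widthFormula (hσ i), ← hN i]
  rfl

theorem defines_lowerFormula (i : ℕ) : Defines (lowerFormula σ N i) (R.Rl i) := by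
  match i with
  | 0 => exact fun x => ⟨fun _ => Subgroup.mem_top x, fun _ => Formula.realize_top.2 trivial⟩
  | 1 => exact fun x => ⟨fun _ => Subgroup.mem_top x, fun _ => Formula.realize_top.2 trivial⟩
  | i + 2 => exact defines_commFormula hσ hN (i + 1)

theorem defines_upperFormula (i : ℕ) : Defines (upperFormula σ N i) (R.Ru i) := fun x => by
  rw [upperFormula, Formula.realize_iAlls]
  simp only [realize_atTerm, GroupTerm.realize_comm, Term.realize_var, Sum.elim_inl, Sum.elim_inr,
    defines_commFormula hσ hN i _]
  exact ⟨fun h g => h fun _ => g, fun h g => h (g 0)⟩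

end

instance finite_idx (c : ℕ) : Finite (CentralSeries.Idx c) :=
  Finite.of_injective (fun i => (⟨i.1, i.2.2⟩ : Fin c)) fun i j h => Subtype.ext (by simpa using h)

/-- A sentence expressing that there is a complete system of `m` elements. -/
noncomputable def completeSentence (σ : ℕ → groupLang.Formula (Fin 1)) (N : ℕ → ℕ) (c m : ℕ) :
    groupLang.Formula (Fin 0) :=
  Formula.iExs (Fin m) (Formula.iInf fun i : CentralSeries.Idx c => Formula.iAlls (Fin 1)
    ((atTerm (upperFormula σ N i) (Term.var (Sum.inr 0))).imp
      ((Formula.iInf fun j : Fin m => atTerm (lowerFormula σ N (i + 2))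
        (GroupTerm.comm (Term.var (Sum.inl (Sum.inr j))) (Term.var (Sum.inr 0)))).imp
          (atTerm (upperFormula σ N (i + 1)) (Term.var (Sum.inr 0))))))

theorem realize_completeSentence {H : Type*} [Group H] {R : CentralSeries H c} {N : ℕ → ℕ}
    (hσ : ∀ i, Defines (σ i) (R.term i)) (hN : R.HasWidth N) (m : ℕ) (v : Fin 0 → H) :
    (completeSentence σ N c m).Realize v ↔ ∃ e : Fin m → H, R.IsComplete e := by
  simp only [completeSentence, Formula.realize_iExs, Formula.realize_iInf, Formula.realize_iAlls,
    Formula.realize_imp, realize_atTerm, GroupTerm.realize_comm, Term.realize_var, Sum.elim_inl,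
    Sum.elim_inr, defines_upperFormula hσ hN _ _, defines_lowerFormula hσ hN _ _]
  exact exists_congr fun e => ⟨fun h i y => h i fun _ => y, fun h i y => h i (y 0)⟩

end Transfer

/-! ### Coding operators by their values on a complete system -/

section Coding

/-- The relation `Γ` between representatives induces an endomorphism of the abelian group
`top / bot`. Single-valuedness follows from additivity and the condition on `bot`. -/
structure IsEndo {H : Type*} [Group H] (s : CSec H) (Γ : H → H → Prop) : Prop where
  total : ∀ x ∈ s.top, ∃ y ∈ s.top, Γ x y
  mul : ∀ x ∈ s.top, ∀ x' ∈ s.top, ∀ y ∈ s.top, ∀ y' ∈ s.top, Γ x y → Γ x' y' →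
    Γ (x * x') (y * y')
  bot : ∀ x ∈ s.bot, ∀ y ∈ s.top, Γ x y → y ∈ s.bot

theorem IsEndo.of_end {H : Type*} [Group H] {s : CSec H} {Γ : H → H → Prop}
    (φ : AddMonoid.End s.Q) (h : ∀ x y : s.top, Γ x y ↔ φ (s.cls x) = s.cls y) : IsEndo s Γ where
  total x hx := by
    obtain ⟨y, hy⟩ := CSec.cls_surjective (φ (s.cls ⟨x, hx⟩))
    exact ⟨y, y.2, (h ⟨x, hx⟩ y).2 hy.symm⟩
  mul x hx x' hx' y hy y' hy' h1 h2 := by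
    have h1' := (h ⟨x, hx⟩ ⟨y, hy⟩).1 h1
    have h2' := (h ⟨x', hx'⟩ ⟨y', hy'⟩).1 h2
    refine (h (⟨x, hx⟩ * ⟨x', hx'⟩) (⟨y, hy⟩ * ⟨y', hy'⟩)).2 ?_
    rw [CSec.cls_mul, CSec.cls_mul, map_add, h1', h2']
  bot x hx y hy h1 := by
    have h1' := (h ⟨x, s.le hx⟩ ⟨y, hy⟩).1 h1
    rw [s.cls_eq_zero.2 hx, map_zero, eq_comm, s.cls_eq_zero] at h1'
    exact h1'

theorem IsEndo.exists_end {H : Type*} [Group H] {s : CSec H} {Γ : H → H → Prop}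
    (h : IsEndo s Γ) :
    ∃ φ : AddMonoid.End s.Q, ∀ x y : s.top, Γ x y → φ (s.cls x) = s.cls y := by
  choose g hg hΓ using fun x : s.top => h.total x x.2
  have huniq : ∀ x y y' : s.top, Γ x y → Γ x y' → s.cls y = s.cls y' := by
    intro x y y' h1 h2
    obtain ⟨z, hz, h3⟩ := h.total (x : H)⁻¹ (inv_mem x.2)
    have key : ∀ w : s.top, Γ x w → s.cls w = - s.cls ⟨z, hz⟩ := fun w hw => by
      have h4 := h.mul _ x.2 _ (inv_mem x.2) _ w.2 _ hz hw h3
      rw [mul_inv_cancel] at h4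
      have h5 := h.bot 1 (one_mem _) _ (mul_mem w.2 hz) h4
      have h6 : s.cls (w * ⟨z, hz⟩) = 0 := s.cls_eq_zero.2 h5
      rw [CSec.cls_mul] at h6
      exact eq_neg_of_add_eq_zero_left h6
    rw [key y h1, key y' h2]
  refine ⟨s.lift (fun x => s.cls ⟨g x, hg x⟩) (fun x y => ?_) (fun x hx => ?_), fun x y hxy => ?_⟩
  · rw [← CSec.cls_mul]
    exact huniq (x * y) _ _ (hΓ _) (h.mul _ x.2 _ y.2 _ (hg x) _ (hg y) (hΓ x) (hΓ y))
  · exact s.cls_eq_zero.2 (h.bot x hx _ (hg x) (hΓ x))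
  · exact huniq x _ _ (hΓ x) hxy

namespace CentralSeries

variable {H : Type*} [Group H] {c : ℕ} (R : CentralSeries H c)

/-- The class in `G / V_R` of a group element. -/
def clV (x : H) : R.topV.Q := R.topV.cls ⟨x, Subgroup.mem_top x⟩

theorem clV_surjective : Function.Surjective R.clV := fun q => by
  obtain ⟨⟨x, hx⟩, rfl⟩ := CSec.cls_surjective q
  exact ⟨x, rfl⟩

theorem clV_mul (x y : H) : R.clV (x * y) = R.clV x + R.clV y := rfl

theorem f_clV (i : Idx c) (x : H) (y : (R.U i).top) :
    R.f i (R.clV x) ((R.U i).cls y) =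
      (R.L (i + 1)).cls ⟨⁅x, (y : H)⁆, R.Ru_comm' i y y.2 _⟩ := rfl

theorem f_clV_eq_iff (i : Idx c) (x x' : H) (y y' : (R.U i).top) :
    R.f i (R.clV x) ((R.U i).cls y) = R.f i (R.clV x') ((R.U i).cls y') ↔
      ⁅x, (y : H)⁆ * ⁅x', (y' : H)⁆⁻¹ ∈ R.Rl (i + 2) :=
  (R.L (i + 1)).cls_eq_iff

/-- The bilinear maps `f_i` are jointly non-degenerate in the first variable. -/
theorem topV_nondeg (x : R.topV.Q) (h : ∀ (i : Idx c) y, R.f i x y = 0) : x = 0 := by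
  obtain ⟨x, rfl⟩ := CSec.cls_surjective x
  refine R.topV.cls_eq_zero.2 (Subgroup.mem_iInf.2 fun i y hy => ?_)
  exact (R.L (i + 1)).cls_eq_zero.1 (h i ((R.U i).cls ⟨y, hy⟩))

theorem f_actV (i : Idx c) (φ : R.P) (x : R.topV.Q) (y : (R.U i).Q) :
    R.f i (R.actV φ x) y = R.f i x (R.actU i φ y) := by
  have h := congrFun (R.F_actV φ x (Pi.single i y)) i
  rw [F_apply, F_apply, Pi.single_eq_same] at h
  exact h

theorem f_actL (i : Idx c) (φ : R.P) (x : R.topV.Q) (y : (R.U i).Q) :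
    R.actL i φ (R.f i x y) = R.f i (R.actV φ x) y := by
  have h := congrFun (R.F_actLsum φ x (Pi.single i y)) i
  rw [F_single, F_single, Pi.single_eq_same] at h
  exact h

theorem f_ext (x x' : R.topV.Q) (h : ∀ (i : Idx c) y, R.f i x y = R.f i x' y) : x = x' := by
  rw [← sub_eq_zero]
  refine R.topV_nondeg _ fun i y => ?_
  rw [map_sub, AddMonoidHom.sub_apply, h, sub_self]

/-- An element of `P_R` is determined by its action on `G / V_R`. -/
theorem P_ext {φ ψ : R.P} (h : ∀ x, R.actV φ x = R.actV ψ x) : φ = ψ := by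
  have hU : ∀ y, R.actUsum φ y = R.actUsum ψ y := fun y => by
    funext i
    rw [← sub_eq_zero]
    refine R.f_nondeg i _ fun x => ?_
    rw [map_sub, sub_eq_zero, ← F_apply, ← F_apply, ← F_actV, ← F_actV, h]
  have hL' : ∀ i z, R.actLsum φ (Pi.single i z) = R.actLsum ψ (Pi.single i z) := fun i z => by
    induction R.f_full i z using AddSubgroup.closure_induction with
    | mem w hw =>
      obtain ⟨x, y, rfl⟩ := hw
      rw [← F_single, F_actLsum, F_actLsum, h]
    | zero => rw [Pi.single_zero, map_zero, map_zero]
    | add w z _ _ hw hz => rw [Pi.single_add, map_add, map_add, hw, hz]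
    | neg w _ hw => rw [Pi.single_neg, map_neg, map_neg, hw]
  have hL : R.actLsum φ = R.actLsum ψ :=
    AddMonoidHom.functions_ext' _ _ _ fun i => AddMonoidHom.ext fun z => hL' i z
  refine Subtype.ext (Prod.ext ?_ (Prod.ext ?_ hL))
  · exact AddMonoidHom.ext h
  · exact AddMonoidHom.ext hU

/-- Endomorphisms of `G / V_R` and of the single summands that are compatible with the maps `f_i`
assemble to an element of `P_R`. -/
theorem exists_P (φ₁ : AddMonoid.End R.topV.Q) (φ₂ : ∀ i : Idx c, AddMonoid.End (R.U i).Q)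
    (φ₀ : ∀ i : Idx c, AddMonoid.End (R.L (i + 1)).Q)
    (h1 : ∀ i x y, R.f i (φ₁ x) y = R.f i x (φ₂ i y))
    (h2 : ∀ i x y, R.f i x (φ₂ i y) = φ₀ i (R.f i x y)) :
    ∃ φ : R.P, R.actV φ = φ₁ := by
  let ψ₂ : AddMonoid.End (∀ i : Idx c, (R.U i).Q) :=
    AddMonoidHom.mk' (fun y i => φ₂ i (y i)) fun y z => by
      funext i
      exact map_add (φ₂ i) _ _
  let ψ₀ : AddMonoid.End (∀ i : Idx c, (R.L (i + 1)).Q) :=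
    AddMonoidHom.mk' (fun y i => φ₀ i (y i)) fun y z => by
      funext i
      exact map_add (φ₀ i) _ _
  exact ⟨⟨(φ₁, ψ₂, ψ₀), fun x y => ⟨funext fun i => h1 i x (y i), funext fun i => h2 i x (y i)⟩⟩,
    rfl⟩

theorem Rl_succ_eq (i : Idx c) : R.Rl (i + 1) = ⁅R.term i, (⊤ : Subgroup H)⁆ := by
  obtain ⟨_ | k, hk⟩ := i
  · exact absurd hk.1 (by omega)
  · rfl

variable {m : ℕ} (e a : Fin m → H)

/-- The element `φ` of `P_R` is coded by the tuples `e` and `a`: the system `e` is complete and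
`φ` maps the class of `e_j` to the class of `a_j`. -/
def Codes (φ : R.P) : Prop := R.IsComplete e ∧ ∀ j, R.actV φ (R.clV (e j)) = R.clV (a j)

/-- The action on `R^u_i / R^u_{i+1}` of the operator coded by `e`, `a`, on representatives:
`z` represents `φ y` if and only if `[φ e_j, y] = [e_j, z]` for all `j`. -/
def graphU (i : ℕ) (y z : H) : Prop :=
  y ∈ R.Ru i ∧ z ∈ R.Ru i ∧ ∀ j, ⁅a j, y⁆ * ⁅e j, z⁆⁻¹ ∈ R.Rl (i + 2)

/-- The action on `G / V_R` of the operator coded by `e`, `a`, on representatives: `x'` represents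
`φ x` if and only if `[x', y] = [x, φ y]` for all `y`. -/
def graphV (x x' : H) : Prop :=
  ∀ (i : Idx c) (y z : H), R.graphU e a i y z → ⁅x', y⁆ * ⁅x, z⁆⁻¹ ∈ R.Rl (i + 2)

/-- The pairs `(∏ [x_k, y_k], ∏ [x_k, φ y_k])` of products of `n` commutators, where `φ` is the
operator coded by `e`, `a`. -/
def graphProd (i : ℕ) : ℕ → H → H → Prop
  | 0, w, w' => w = 1 ∧ w' = 1
  | n + 1, w, w' => ∃ x y z p p' : H, R.graphU e a i y z ∧ graphProd i n p p' ∧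
      w = ⁅x, y⁆ * p ∧ w' = ⁅x, z⁆ * p'

/-- The action on `R^l_{i+1} / R^l_{i+2}` of the operator coded by `e`, `a`, on representatives;
`n` is a bound for the width of `R^l_{i+1}`. -/
def graphL (n i : ℕ) (w w' : H) : Prop :=
  ∃ p p', R.graphProd e a i n p p' ∧ w * p⁻¹ ∈ R.Rl (i + 2) ∧ w' * p'⁻¹ ∈ R.Rl (i + 2)

/-- The first-order condition on the tuples `e`, `a` to code an element of `P_R`: the relations
above are endomorphisms, `φ [x, y] = [x, φ y]`, and `φ e_j = a_j`. The remaining identity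
`[φ x, y] = [x, φ y]` is built into the definition of `graphV`. -/
structure IsCode (N : ℕ → ℕ) : Prop where
  complete : R.IsComplete e
  endoU : ∀ i : Idx c, IsEndo (R.U i) (R.graphU e a i)
  endoV : IsEndo R.topV (R.graphV e a)
  endoL : ∀ i : Idx c, IsEndo (R.L (i + 1)) (R.graphL e a (N i) i)
  comm : ∀ (i : Idx c) (x y z : H), R.graphU e a i y z → R.graphL e a (N i) i ⁅x, y⁆ ⁅x, z⁆
  code : ∀ j, R.graphV e a (e j) (a j)

variable {R e a}

theorem Codes.graphU_iff {φ : R.P} (h : R.Codes e a φ) (i : Idx c) (y z : (R.U i).top) :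
    R.graphU e a i y z ↔ R.actU i φ ((R.U i).cls y) = (R.U i).cls z := by
  have h1 : ∀ j, ⁅a j, (y : H)⁆ * ⁅e j, (z : H)⁆⁻¹ ∈ R.Rl (i + 2) ↔
      R.f i (R.clV (e j)) (R.actU i φ ((R.U i).cls y) - (R.U i).cls z) = 0 := fun j => by
    rw [← f_clV_eq_iff, ← h.2, f_actV, map_sub, sub_eq_zero]
  have h2 : R.graphU e a i y z ↔ ∀ j, ⁅a j, (y : H)⁆ * ⁅e j, (z : H)⁆⁻¹ ∈ R.Rl (i + 2) :=
    ⟨fun h => h.2.2, fun h => ⟨y.2, z.2, h⟩⟩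
  rw [h2, forall_congr' h1, ← sub_eq_zero (a := R.actU i φ _)]
  refine ⟨fun h3 => ?_, fun h3 j => by rw [h3, map_zero]⟩
  obtain ⟨w, hw⟩ := CSec.cls_surjective (R.actU i φ ((R.U i).cls y) - (R.U i).cls z)
  rw [← hw] at h3 ⊢
  refine (R.U i).cls_eq_zero.2 (h.1 i w w.2 fun j => ?_)
  exact (R.L (i + 1)).cls_eq_zero.1 (h3 j)

theorem Codes.graphV_iff {φ : R.P} (h : R.Codes e a φ) (x x' : H) :
    R.graphV e a x x' ↔ R.actV φ (R.clV x) = R.clV x' := by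
  constructor
  · intro h1
    refine R.f_ext _ _ fun i y => ?_
    obtain ⟨y, rfl⟩ := CSec.cls_surjective y
    obtain ⟨z, hz⟩ := CSec.cls_surjective (R.actU i φ ((R.U i).cls y))
    rw [f_actV, ← hz, eq_comm, f_clV_eq_iff]
    exact h1 i y z ((h.graphU_iff i y z).2 hz.symm)
  · intro h1 i y z hyz
    have h2 := (h.graphU_iff i ⟨y, hyz.1⟩ ⟨z, hyz.2.1⟩).1 hyz
    refine (R.f_clV_eq_iff i x' x ⟨y, hyz.1⟩ ⟨z, hyz.2.1⟩).1 ?_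
    rw [← h1, f_actV, h2]

theorem Codes.graphProd_mem {φ : R.P} (h : R.Codes e a φ) (i : Idx c) {n : ℕ} {p p' : H}
    (hp : R.graphProd e a i n p p') : ∃ (h1 : p ∈ R.Rl (i + 1)) (h2 : p' ∈ R.Rl (i + 1)),
      R.actL i φ ((R.L (i + 1)).cls ⟨p, h1⟩) = (R.L (i + 1)).cls ⟨p', h2⟩ := by
  induction n generalizing p p' with
  | zero =>
    obtain ⟨rfl, rfl⟩ := hp
    exact ⟨one_mem _, one_mem _, map_zero _⟩
  | succ n ih =>
    obtain ⟨x, y, z, p, p', hyz, hp, rfl, rfl⟩ := hp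
    obtain ⟨h1, h2, h3⟩ := ih hp
    refine ⟨mul_mem (R.Ru_comm' i y hyz.1 x) h1, mul_mem (R.Ru_comm' i z hyz.2.1 x) h2, ?_⟩
    have h4 : R.actL i φ (R.f i (R.clV x) ((R.U i).cls ⟨y, hyz.1⟩)) =
        R.f i (R.clV x) ((R.U i).cls ⟨z, hyz.2.1⟩) := by
      rw [f_actL, f_actV, (h.graphU_iff i ⟨y, hyz.1⟩ ⟨z, hyz.2.1⟩).1 hyz]
    change R.actL i φ (R.f i (R.clV x) ((R.U i).cls ⟨y, hyz.1⟩) +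
      (R.L (i + 1)).cls ⟨p, h1⟩) = R.f i (R.clV x) ((R.U i).cls ⟨z, hyz.2.1⟩) +
      (R.L (i + 1)).cls ⟨p', h2⟩
    rw [map_add, h3, h4]

/-- Every product of `n` commutators lies in the domain of `graphProd` modulo `R^l_{i+2}`. -/
theorem Codes.exists_graphProd {φ : R.P} (h : R.Codes e a φ) (i : Idx c) {n : ℕ} {p : H}
    (hp : p ∈ commWidth (R.term i) n) : ∃ q p', R.graphProd e a i n q p' ∧
      p * q⁻¹ ∈ R.Rl (i + 2) := by
  induction n generalizing p with
  | zero =>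
    obtain rfl := hp
    exact ⟨1, 1, ⟨rfl, rfl⟩, by simp⟩
  | succ n ih =>
    obtain ⟨r, hr, g, p, hp, rfl⟩ := hp
    obtain ⟨q, p', hq, hpq⟩ := ih hp
    have hr' : r ∈ R.Ru i := R.term_le_Ru i hr
    obtain ⟨z, hz⟩ := CSec.cls_surjective (R.actU i φ ((R.U i).cls ⟨r, hr'⟩))
    -- modulo `R^l_{i+2}`, the commutator `[r, g] = [g, r]⁻¹` is `[g⁻¹, r]`
    refine ⟨⁅g⁻¹, r⁆ * q, ⁅g⁻¹, (z : H)⁆ * p',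
      ⟨g⁻¹, r, z, q, p', (h.graphU_iff i ⟨r, hr'⟩ z).2 hz.symm, hq, rfl, rfl⟩, ?_⟩
    have h1 : ⁅r, g⁆ = (g * ⁅g⁻¹, r⁆ * g⁻¹) := by
      simp only [commutatorElement_def]
      group
    have hmem := R.Ru_comm' i r hr' g⁻¹
    have h2 : ((⁅r, g⁆ * p : H) : H ⧸ R.Rl (i + 2)) = (⁅g⁻¹, r⁆ * q : H) := by
      have h3 : ((p : H) : H ⧸ R.Rl (i + 2)) = q := by
        rw [QuotientGroup.eq_iff_div_mem, div_eq_mul_inv]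
        exact hpq
      have h4 : Commute ((⁅g⁻¹, r⁆ : H) : H ⧸ R.Rl (i + 2)) (g : H) :=
        mk_commute_of_mem (R.Rl_central (i + 1) _ hmem g)
      rw [QuotientGroup.mk_mul, QuotientGroup.mk_mul, h3, h1, QuotientGroup.mk_mul,
        QuotientGroup.mk_mul, ← h4.eq, QuotientGroup.mk_inv, mul_inv_cancel_right]
    rw [QuotientGroup.eq_iff_div_mem, div_eq_mul_inv] at h2
    exact h2

theorem Codes.graphL_iff {N : ℕ → ℕ} (hN : R.HasWidth N) {φ : R.P} (h : R.Codes e a φ)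
    (i : Idx c) (w w' : (R.L (i + 1)).top) :
    R.graphL e a (N i) i w w' ↔
      R.actL i φ ((R.L (i + 1)).cls w) = (R.L (i + 1)).cls w' := by
  constructor
  · rintro ⟨p, p', hp, h1, h2⟩
    obtain ⟨h3, h4, h5⟩ := h.graphProd_mem i hp
    have h6 : (R.L (i + 1)).cls w = (R.L (i + 1)).cls ⟨p, h3⟩ := (R.L (i + 1)).cls_eq_of h1
    have h7 : (R.L (i + 1)).cls w' = (R.L (i + 1)).cls ⟨p', h4⟩ := (R.L (i + 1)).cls_eq_of h2
    rw [h6, h7, h5]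
  · intro h1
    have hw : (w : H) ∈ commWidth (R.term i) (N i) := by
      rw [← hN i, ← Rl_succ_eq]
      exact w.2
    obtain ⟨q, p', hq, hwq⟩ := h.exists_graphProd i hw
    obtain ⟨h3, h4, h5⟩ := h.graphProd_mem i hq
    refine ⟨q, p', hq, hwq, ?_⟩
    have h6 : (R.L (i + 1)).cls w = (R.L (i + 1)).cls ⟨q, h3⟩ := (R.L (i + 1)).cls_eq_of hwq
    rw [h6, h5] at h1
    exact (R.L (i + 1)).cls_eq_iff.1 h1.symm

theorem Codes.unique {φ ψ : R.P} (h : R.Codes e a φ) (h' : R.Codes e a ψ) : φ = ψ := by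
  refine R.P_ext fun x => ?_
  obtain ⟨x, rfl⟩ := R.clV_surjective x
  obtain ⟨x', hx'⟩ := R.clV_surjective (R.actV φ (R.clV x))
  rw [← hx', (h'.graphV_iff x x').1 ((h.graphV_iff x x').2 hx'.symm)]

theorem Codes.isCode {N : ℕ → ℕ} (hN : R.HasWidth N) {φ : R.P} (h : R.Codes e a φ) :
    R.IsCode e a N where
  complete := h.1
  endoU i := IsEndo.of_end (R.actU i φ) fun y z => h.graphU_iff i y z
  endoV := IsEndo.of_end (R.actV φ) fun x x' => h.graphV_iff x x'
  endoL i := IsEndo.of_end (R.actL i φ) fun w w' => h.graphL_iff hN i w w'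
  comm i x y z hyz := by
    refine (h.graphL_iff hN i ⟨_, R.Ru_comm' i y hyz.1 x⟩ ⟨_, R.Ru_comm' i z hyz.2.1 x⟩).2 ?_
    rw [← R.f_clV i x ⟨y, hyz.1⟩, ← R.f_clV i x ⟨z, hyz.2.1⟩, f_actL, f_actV,
      (h.graphU_iff i ⟨y, hyz.1⟩ ⟨z, hyz.2.1⟩).1 hyz]
  code j := (h.graphV_iff _ _).2 (h.2 j)

theorem IsCode.exists_codes {N : ℕ → ℕ} (h : R.IsCode e a N) : ∃ φ, R.Codes e a φ := by
  obtain ⟨φ₁, h₁⟩ := h.endoV.exists_end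
  choose φ₂ h₂ using fun i => (h.endoU i).exists_end
  choose φ₀ h₀ using fun i => (h.endoL i).exists_end
  have hV : ∀ x x', R.graphV e a x x' → φ₁ (R.clV x) = R.clV x' := fun x x' hx =>
    h₁ ⟨x, Subgroup.mem_top x⟩ ⟨x', Subgroup.mem_top x'⟩ hx
  obtain ⟨φ, rfl⟩ := R.exists_P φ₁ φ₂ φ₀ (fun i x y => by
    obtain ⟨x, rfl⟩ := R.clV_surjective x
    obtain ⟨y, rfl⟩ := CSec.cls_surjective y
    obtain ⟨x', -, hx'⟩ := h.endoV.total x (Subgroup.mem_top x)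
    obtain ⟨z, hz, hyz⟩ := (h.endoU i).total y y.2
    rw [hV x x' hx', h₂ i y ⟨z, hz⟩ hyz, f_clV_eq_iff]
    exact hx' i y z hyz) (fun i x y => by
    obtain ⟨x, rfl⟩ := R.clV_surjective x
    obtain ⟨y, rfl⟩ := CSec.cls_surjective y
    obtain ⟨z, hz, hyz⟩ := (h.endoU i).total y y.2
    rw [h₂ i y ⟨z, hz⟩ hyz, f_clV, f_clV]
    exact (h₀ i ⟨_, R.Ru_comm' i y y.2 x⟩ ⟨_, R.Ru_comm' i z hz x⟩ (h.comm i x y z hyz)).symm)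
  exact ⟨φ, h.complete, fun j => hV _ _ (h.code j)⟩

theorem exists_codes_of_isComplete (he : R.IsComplete e) (φ : R.P) :
    ∃ a : Fin m → H, R.Codes e a φ := by
  choose a ha using fun j => R.clV_surjective (R.actV φ (R.clV (e j)))
  exact ⟨a, he, fun j => (ha j).symm⟩

end CentralSeries

end Coding

/-! ### Uniformly definable relations in a class of groups -/

section Uniform

open Language

universe x y

variable {ι : Type x} {M : ι → Type y} [∀ k, Group (M k)]

/-- A function of the variables `α` given in all groups `M k` by one term. -/
def UnifTerm {α : Type} (t : ∀ k, (α → M k) → M k) : Prop :=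
  ∃ τ : groupLang.Term α, ∀ k v, τ.realize v = t k v

/-- A relation in the variables `α` defined in all groups `M k` by one formula. -/
def UnifRel {α : Type} (P : ∀ k, (α → M k) → Prop) : Prop :=
  ∃ θ : groupLang.Formula α, ∀ k v, θ.Realize v ↔ P k v

/-- A subgroup defined in all groups `M k` by one formula. -/
def UnifSubgroup (K : ∀ k, Subgroup (M k)) : Prop :=
  ∃ θ : groupLang.Formula (Fin 1), ∀ k, Defines θ (K k)

variable {α : Type}

namespace UnifTerm

theorem var (a : α) : UnifTerm (M := M) fun _ v => v a := ⟨Term.var a, fun _ _ => rfl⟩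

theorem weaken {t : ∀ k, (α → M k) → M k} (h : UnifTerm t) :
    UnifTerm (α := Option α) fun k v => t k fun a => v (some a) := by
  obtain ⟨τ, hτ⟩ := h
  exact ⟨τ.relabel some, fun k v => by rw [Term.realize_relabel, hτ]; rfl⟩

theorem one : UnifTerm (α := α) (M := M) fun _ _ => 1 :=
  ⟨GroupTerm.one, fun _ v => GroupTerm.realize_one v⟩

variable {s t : ∀ k, (α → M k) → M k}

theorem mul (hs : UnifTerm s) (ht : UnifTerm t) : UnifTerm fun k v => s k v * t k v := by
  obtain ⟨σ, hσ⟩ := hs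
  obtain ⟨τ, hτ⟩ := ht
  exact ⟨GroupTerm.mul σ τ, fun k v => by rw [GroupTerm.realize_mul, hσ, hτ]⟩

theorem inv (hs : UnifTerm s) : UnifTerm fun k v => (s k v)⁻¹ := by
  obtain ⟨σ, hσ⟩ := hs
  exact ⟨GroupTerm.inv σ, fun k v => by rw [GroupTerm.realize_inv, hσ]⟩

theorem comm (hs : UnifTerm s) (ht : UnifTerm t) : UnifTerm fun k v => ⁅s k v, t k v⁆ := by
  obtain ⟨σ, hσ⟩ := hs
  obtain ⟨τ, hτ⟩ := ht
  exact ⟨GroupTerm.comm σ τ, fun k v => by rw [GroupTerm.realize_comm, hσ, hτ]⟩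

theorem mul_inv (hs : UnifTerm s) (ht : UnifTerm t) : UnifTerm fun k v => s k v * (t k v)⁻¹ :=
  hs.mul ht.inv

end UnifTerm

namespace UnifRel

variable {P Q : ∀ k, (α → M k) → Prop}

theorem congr (h : UnifRel P) (e : ∀ k v, P k v ↔ Q k v) : UnifRel Q := by
  obtain ⟨θ, hθ⟩ := h
  exact ⟨θ, fun k v => (hθ k v).trans (e k v)⟩

theorem and (hP : UnifRel P) (hQ : UnifRel Q) : UnifRel fun k v => P k v ∧ Q k v := by
  obtain ⟨θ, hθ⟩ := hP
  obtain ⟨η, hη⟩ := hQ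
  exact ⟨θ ⊓ η, fun k v => by rw [Formula.realize_inf, hθ, hη]⟩

theorem imp (hP : UnifRel P) (hQ : UnifRel Q) : UnifRel fun k v => P k v → Q k v := by
  obtain ⟨θ, hθ⟩ := hP
  obtain ⟨η, hη⟩ := hQ
  exact ⟨θ.imp η, fun k v => by rw [Formula.realize_imp, hθ, hη]⟩

theorem iff (hP : UnifRel P) (hQ : UnifRel Q) : UnifRel fun k v => P k v ↔ Q k v := by
  obtain ⟨θ, hθ⟩ := hP
  obtain ⟨η, hη⟩ := hQ
  exact ⟨θ.iff η, fun k v => by rw [Formula.realize_iff, hθ, hη]⟩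

theorem forall_finite {β : Sort*} [Finite β] {P : β → ∀ k, (α → M k) → Prop}
    (h : ∀ b, UnifRel (P b)) : UnifRel fun k v => ∀ b, P b k v := by
  choose θ hθ using fun b : PLift β => h b.down
  refine ⟨Formula.iInf θ, fun k v => ?_⟩
  rw [Formula.realize_iInf]
  exact ⟨fun h b => (hθ ⟨b⟩ k v).1 (h ⟨b⟩), fun h b => (hθ b k v).2 (h b.down)⟩

/-- A bound variable is the additional free variable `none` of a relation in `Option α`. -/
theorem all {P : ∀ k, (α → M k) → M k → Prop}
    (h : UnifRel (α := Option α) fun k v => P k (fun a => v (some a)) (v none)) :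
    UnifRel fun k v => ∀ x, P k v x := by
  obtain ⟨θ, hθ⟩ := h
  let g : Option α → α ⊕ Fin 1 := fun o => o.elim (Sum.inr 0) Sum.inl
  refine ⟨Formula.iAlls (Fin 1) (θ.relabel g), fun k v => ?_⟩
  rw [Formula.realize_iAlls]
  simp only [Formula.realize_relabel, hθ]
  exact ⟨fun h x => h fun _ => x, fun h w => h (w 0)⟩

/-- A bound variable is the additional free variable `none` of a relation in `Option α`. -/
theorem ex {P : ∀ k, (α → M k) → M k → Prop}
    (h : UnifRel (α := Option α) fun k v => P k (fun a => v (some a)) (v none)) :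
    UnifRel fun k v => ∃ x, P k v x := by
  obtain ⟨θ, hθ⟩ := h
  let g : Option α → α ⊕ Fin 1 := fun o => o.elim (Sum.inr 0) Sum.inl
  refine ⟨Formula.iExs (Fin 1) (θ.relabel g), fun k v => ?_⟩
  rw [Formula.realize_iExs]
  simp only [Formula.realize_relabel, hθ]
  exact ⟨fun ⟨w, h⟩ => ⟨w 0, h⟩, fun ⟨x, h⟩ => ⟨fun _ => x, h⟩⟩

theorem eq {s t : ∀ k, (α → M k) → M k} (hs : UnifTerm s) (ht : UnifTerm t) :
    UnifRel fun k v => s k v = t k v := by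
  obtain ⟨σ, hσ⟩ := hs
  obtain ⟨τ, hτ⟩ := ht
  exact ⟨Term.equal σ τ, fun k v => by rw [Formula.realize_equal, hσ, hτ]⟩

theorem mem {K : ∀ k, Subgroup (M k)} {t : ∀ k, (α → M k) → M k} (hK : UnifSubgroup K)
    (ht : UnifTerm t) : UnifRel fun k v => t k v ∈ K k := by
  obtain ⟨θ, hθ⟩ := hK
  obtain ⟨τ, hτ⟩ := ht
  exact ⟨atTerm θ τ, fun k v => by rw [realize_atTerm, hτ]; exact hθ k _⟩

/-- Quantification over the elements of a definable subgroup. -/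
theorem all_mem {K : ∀ k, Subgroup (M k)} {P : ∀ k, (α → M k) → M k → Prop} (hK : UnifSubgroup K)
    (h : UnifRel (α := Option α) fun k v => P k (fun a => v (some a)) (v none)) :
    UnifRel fun k v => ∀ x ∈ K k, P k v x :=
  all (imp (mem hK (.var none)) h)

/-- Quantification over the elements of a definable subgroup. -/
theorem ex_mem {K : ∀ k, Subgroup (M k)} {P : ∀ k, (α → M k) → M k → Prop} (hK : UnifSubgroup K)
    (h : UnifRel (α := Option α) fun k v => P k (fun a => v (some a)) (v none)) :
    UnifRel fun k v => ∃ x ∈ K k, P k v x :=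
  ex (and (mem hK (.var none)) h)

end UnifRel

namespace UnifSubgroup

theorem of_rel {K : ∀ k, Subgroup (M k)}
    (h : UnifRel (α := Fin 1) fun k v => v 0 ∈ K k) : UnifSubgroup K := by
  obtain ⟨θ, hθ⟩ := h
  exact ⟨θ, fun k x => hθ k fun _ => x⟩

variable {K L : ∀ k, Subgroup (M k)}

theorem top : UnifSubgroup fun k => (⊤ : Subgroup (M k)) :=
  ⟨⊤, fun _ x => ⟨fun _ => Subgroup.mem_top x, fun _ => Formula.realize_top.2 trivial⟩⟩

theorem inf (hK : UnifSubgroup K) (hL : UnifSubgroup L) : UnifSubgroup fun k => K k ⊓ L k :=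
  of_rel (.and (.mem hK (.var 0)) (.mem hL (.var 0)))

theorem sup [∀ k, (L k).Normal] (hK : UnifSubgroup K) (hL : UnifSubgroup L) :
    UnifSubgroup fun k => K k ⊔ L k := by
  refine of_rel (UnifRel.congr (P := fun k v => ∃ x ∈ K k, ∃ y ∈ L k, x * y = v 0)
    (.ex_mem hK (.ex_mem hL (.eq (.mul (.var (some none)) (.var none)) (.var (some (some 0))))))
    fun k v => Subgroup.mem_sup_of_normal_right.symm)

theorem center : UnifSubgroup fun k => Subgroup.center (M k) := by
  refine of_rel (UnifRel.congr (P := fun k v => ∀ g : M k, g * v 0 = v 0 * g)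
    (.all (.eq (.mul (.var none) (.var (some 0))) (.mul (.var (some 0)) (.var none))))
    fun k v => Subgroup.mem_center_iff.symm)

end UnifSubgroup

theorem CentralSeries.Rl_two {H : Type*} [Group H] {c : ℕ} (R : CentralSeries H c) :
    R.Rl 2 = commutator H := by
  change ⁅R.term 1, (⊤ : Subgroup H)⁆ = _
  rw [R.first, commutator_def]

end Uniform

/-! ### Uniform definability of the coding relations -/

section UniformCoding

universe x y

variable {ι : Type x} {M : ι → Type y} [∀ k, Group (M k)] {c : ℕ}
  (S : ∀ k, CentralSeries (M k) c)

/-- The terms of the associated lower and upper series are uniformly definable. -/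
structure UnifSeries : Prop where
  lower : ∀ i, UnifSubgroup fun k => (S k).Rl i
  upper : ∀ i, UnifSubgroup fun k => (S k).Ru i

variable {S} (h : UnifSeries S)

include h

namespace UnifSeries

theorem commutator : UnifSubgroup fun k => commutator (M k) := by
  obtain ⟨θ, hθ⟩ := h.lower 2
  refine ⟨θ, fun k x => ?_⟩
  rw [hθ k x]
  beta_reduce
  rw [(S k).Rl_two]

theorem V : UnifSubgroup fun k => (S k).V := by
  refine .of_rel (UnifRel.congr (P := fun k v => ∀ i : CentralSeries.Idx c,
    ∀ y ∈ (S k).Ru i, ⁅v 0, y⁆ ∈ (S k).Rl (i + 2)) ?_ fun k v => ?_)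
  · exact .forall_finite fun i => .all_mem (h.upper i)
      (.mem (h.lower (i + 2)) (.comm (.var (some 0)) (.var none)))
  · exact (Subgroup.mem_iInf (S := fun i : CentralSeries.Idx c => (S k).Vi i) (x := v 0)).symm

theorem topT (i : ℕ) : UnifSubgroup fun k => ((S k).T i).top := (h.lower i).inf .center

theorem topD (i : ℕ) : UnifSubgroup fun k => ((S k).D i).top := h.V.inf (h.upper i)

theorem topX (i : ℕ) : UnifSubgroup fun k => ((S k).X i).top := (h.topD i).sup h.commutator

theorem botX (i : ℕ) : UnifSubgroup fun k => ((S k).X i).bot := h.topX (i + 1)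

variable {α : Type} {m : ℕ} {e a : ∀ k, (α → M k) → Fin m → M k} {x y : ∀ k, (α → M k) → M k}

theorem isComplete (he : ∀ j, UnifTerm fun k v => e k v j) :
    UnifRel fun k v => (S k).IsComplete (e k v) :=
  .forall_finite fun i => .all_mem (h.upper i) (.imp
    (.forall_finite fun j => .mem (h.lower (i + 2)) (.comm (he j).weaken (.var none)))
    (.mem (h.upper (i + 1)) (.var none)))

theorem graphU (i : ℕ) (he : ∀ j, UnifTerm fun k v => e k v j)
    (ha : ∀ j, UnifTerm fun k v => a k v j) (hx : UnifTerm x) (hy : UnifTerm y) :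
    UnifRel fun k v => (S k).graphU (e k v) (a k v) i (x k v) (y k v) :=
  .and (.mem (h.upper i) hx) (.and (.mem (h.upper i) hy) (.forall_finite fun j =>
    .mem (h.lower (i + 2)) (.mul_inv (.comm (ha j) hx) (.comm (he j) hy))))

theorem graphV (he : ∀ j, UnifTerm fun k v => e k v j)
    (ha : ∀ j, UnifTerm fun k v => a k v j) (hx : UnifTerm x) (hy : UnifTerm y) :
    UnifRel fun k v => (S k).graphV (e k v) (a k v) (x k v) (y k v) :=
  .forall_finite fun i => .all (.all (.imp
    (h.graphU i (fun j => (he j).weaken.weaken) (fun j => (ha j).weaken.weaken)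
      (.var (some none)) (.var none))
    (.mem (h.lower (i + 2)) (.mul_inv (.comm hy.weaken.weaken (.var (some none)))
      (.comm hx.weaken.weaken (.var none))))))

theorem graphProd (i n : ℕ) (he : ∀ j, UnifTerm fun k v => e k v j)
    (ha : ∀ j, UnifTerm fun k v => a k v j) (hx : UnifTerm x) (hy : UnifTerm y) :
    UnifRel fun k v => (S k).graphProd (e k v) (a k v) i n (x k v) (y k v) := by
  induction n generalizing α with
  | zero => exact .and (.eq hx .one) (.eq hy .one)
  | succ n ih =>
    refine .ex (.ex (.ex (.ex (.ex (.and ?_ (.and ?_ (.and ?_ ?_)))))))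
    · exact h.graphU i (fun j => (he j).weaken.weaken.weaken.weaken.weaken)
        (fun j => (ha j).weaken.weaken.weaken.weaken.weaken)
        (.var (some (some (some none)))) (.var (some (some none)))
    · exact ih (fun j => (he j).weaken.weaken.weaken.weaken.weaken)
        (fun j => (ha j).weaken.weaken.weaken.weaken.weaken)
        (.var (some none)) (.var none)
    · exact .eq hx.weaken.weaken.weaken.weaken.weaken
        (.mul (.comm (.var (some (some (some (some none))))) (.var (some (some (some none)))))
          (.var (some none)))
    · exact .eq hy.weaken.weaken.weaken.weaken.weaken
        (.mul (.comm (.var (some (some (some (some none))))) (.var (some (some none))))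
          (.var none))

theorem graphL (n i : ℕ) (he : ∀ j, UnifTerm fun k v => e k v j)
    (ha : ∀ j, UnifTerm fun k v => a k v j) (hx : UnifTerm x) (hy : UnifTerm y) :
    UnifRel fun k v => (S k).graphL (e k v) (a k v) n i (x k v) (y k v) :=
  .ex (.ex (.and
    (h.graphProd i n (fun j => (he j).weaken.weaken) (fun j => (ha j).weaken.weaken)
      (.var (some none)) (.var none))
    (.and (.mem (h.lower (i + 2)) (.mul_inv hx.weaken.weaken (.var (some none))))
      (.mem (h.lower (i + 2)) (.mul_inv hy.weaken.weaken (.var none))))))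

end UnifSeries

omit h in
/-- The hypothesis on `Γ` is stated for all renamings `g` of the parameters, since the relation is
used under quantifiers. -/
theorem UnifRel.isEndo {α : Type} {s : ∀ k, CSec (M k)} {Γ : ∀ k, (α → M k) → M k → M k → Prop}
    (htop : UnifSubgroup fun k => (s k).top) (hbot : UnifSubgroup fun k => (s k).bot)
    (hΓ : ∀ (β : Type) (g : α → β) (x y : ∀ k, (β → M k) → M k), UnifTerm x → UnifTerm y →
      UnifRel fun k v => Γ k (fun a => v (g a)) (x k v) (y k v)) :
    UnifRel fun k v => IsEndo (s k) (Γ k v) := by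
  refine UnifRel.congr (P := fun k v =>
    (∀ x ∈ (s k).top, ∃ y ∈ (s k).top, Γ k v x y) ∧
    (∀ x ∈ (s k).top, ∀ x' ∈ (s k).top, ∀ y ∈ (s k).top, ∀ y' ∈ (s k).top, Γ k v x y →
      Γ k v x' y' → Γ k v (x * x') (y * y')) ∧
    (∀ x ∈ (s k).bot, ∀ y ∈ (s k).top, Γ k v x y → y ∈ (s k).bot)) ?_
    fun k v => ⟨fun ⟨h1, h2, h3⟩ => ⟨h1, h2, h3⟩, fun ⟨h1, h2, h3⟩ => ⟨h1, h2, h3⟩⟩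
  refine .and ?_ (.and ?_ ?_)
  · exact .all_mem htop (.ex_mem htop
      (hΓ _ (fun a => some (some a)) _ _ (.var (some none)) (.var none)))
  · refine .all_mem htop (.all_mem htop (.all_mem htop (.all_mem htop (.imp ?_ (.imp ?_ ?_)))))
    · exact hΓ _ (fun a => some (some (some (some a)))) _ _
        (.var (some (some (some none)))) (.var (some none))
    · exact hΓ _ (fun a => some (some (some (some a)))) _ _
        (.var (some (some none))) (.var none)
    · exact hΓ _ (fun a => some (some (some (some a)))) _ _
        (.mul (.var (some (some (some none)))) (.var (some (some none))))
        (.mul (.var (some none)) (.var none))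
  · exact .all_mem hbot (.all_mem htop (.imp
      (hΓ _ (fun a => some (some a)) _ _ (.var (some none)) (.var none))
      (.mem hbot (.var none))))

theorem UnifSeries.isCode (N : ℕ → ℕ) {α : Type} {m : ℕ} (e a : Fin m → α) :
    UnifRel fun k (v : α → M k) =>
      (S k).IsCode (fun j => v (e j)) (fun j => v (a j)) N := by
  refine UnifRel.congr (P := fun k v =>
    (S k).IsComplete (fun j => v (e j)) ∧
    (∀ i : CentralSeries.Idx c, IsEndo ((S k).U i)
      ((S k).graphU (fun j => v (e j)) (fun j => v (a j)) i)) ∧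
    IsEndo (S k).topV ((S k).graphV (fun j => v (e j)) (fun j => v (a j))) ∧
    (∀ i : CentralSeries.Idx c, IsEndo ((S k).L (i + 1))
      ((S k).graphL (fun j => v (e j)) (fun j => v (a j)) (N i) i)) ∧
    (∀ (i : CentralSeries.Idx c) (x y z : M k),
      (S k).graphU (fun j => v (e j)) (fun j => v (a j)) i y z →
      (S k).graphL (fun j => v (e j)) (fun j => v (a j)) (N i) i ⁅x, y⁆ ⁅x, z⁆) ∧
    ∀ j, (S k).graphV (fun j => v (e j)) (fun j => v (a j)) (v (e j)) (v (a j))) ?_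
    fun k v => ⟨fun ⟨h1, h2, h3, h4, h5, h6⟩ => ⟨h1, h2, h3, h4, h5, h6⟩,
      fun ⟨h1, h2, h3, h4, h5, h6⟩ => ⟨h1, h2, h3, h4, h5, h6⟩⟩
  refine .and (h.isComplete fun j => .var (e j)) (.and ?_ (.and ?_ (.and ?_ (.and ?_ ?_))))
  · exact .forall_finite fun i => .isEndo (h.upper i) (h.upper (i + 1)) fun β g x y hx hy =>
      h.graphU i (fun j => .var (g (e j))) (fun j => .var (g (a j))) hx hy
  · exact .isEndo .top h.V fun β g x y hx hy =>
      h.graphV (fun j => .var (g (e j))) (fun j => .var (g (a j))) hx hy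
  · exact .forall_finite fun i => .isEndo (h.lower _) (h.lower (i + 2)) fun β g x y hx hy =>
      h.graphL (N i) i (fun j => .var (g (e j))) (fun j => .var (g (a j))) hx hy
  · exact .forall_finite fun i => .all (.all (.all (.imp
      (h.graphU i (fun j => .var _) (fun j => .var _) (.var (some none)) (.var none))
      (h.graphL (N i) i (fun j => .var _) (fun j => .var _)
        (.comm (.var (some (some none))) (.var (some none)))
        (.comm (.var (some (some none))) (.var none))))))
  · exact .forall_finite fun j =>
      h.graphV (fun j => .var (e j)) (fun j => .var (a j)) (.var _) (.var _)

end UniformCoding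

/-! ### Interpretation of definable subrings of `P_R` -/

section Membership

variable {H : Type*} [Group H] {c : ℕ} {R : CentralSeries H c} {m : ℕ} {e a : Fin m → H}
  {N : ℕ → ℕ}

namespace CentralSeries

/-- The operators in `PL_R` are those whose graphs on the lower quotients are contained in their
graphs on the upper quotients. -/
theorem Codes.mem_PL_iff (hN : R.HasWidth N) {φ : R.P} (h : R.Codes e a φ) :
    φ ∈ R.PL ↔ ∀ i : Idx c, (i : ℕ) + 1 < c → ∀ x ∈ R.Rl (i + 1), ∀ y ∈ R.Rl (i + 1),
      R.graphL e a (N i) i x y → R.graphU e a (i + 1) x y := by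
  simp only [PL, Subring.mem_iInf]
  constructor
  · intro h1 i hi x hx y hy hxy
    have h2 := (h.graphL_iff hN i ⟨x, hx⟩ ⟨y, hy⟩).1 hxy
    have h3 := h1 i ⟨i.2.1, hi⟩ ((R.L (i + 1)).cls ⟨x, hx⟩)
    refine (h.graphU_iff ⟨i + 1, Nat.succ_le_succ (Nat.zero_le _), hi⟩
      ⟨x, R.Rl_le_Ru _ hx⟩ ⟨y, R.Rl_le_Ru _ hy⟩).2 ?_
    refine h3.symm.trans ?_
    change R.e (i + 1) (R.actL i φ ((R.L (i + 1)).cls ⟨x, hx⟩)) = _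
    rw [h2]
    rfl
  · intro h1 i hi q
    obtain ⟨x, rfl⟩ := CSec.cls_surjective q
    obtain ⟨y, hy⟩ := CSec.cls_surjective
      (R.actL ⟨i, hi.1, (Nat.lt_succ_self i).trans hi.2⟩ φ ((R.L (i + 1)).cls x))
    have h2 := h1 ⟨i, hi.1, (Nat.lt_succ_self i).trans hi.2⟩ hi.2 x x.2 y y.2
      ((h.graphL_iff hN ⟨i, hi.1, (Nat.lt_succ_self i).trans hi.2⟩ x y).2 hy.symm)
    have h3 := (h.graphU_iff ⟨i + 1, Nat.succ_le_succ (Nat.zero_le _), hi.2⟩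
      ⟨x, R.Rl_le_Ru _ x.2⟩ ⟨y, R.Rl_le_Ru _ y.2⟩).1 h2
    rw [← hy]
    exact h3.symm

theorem Codes.mem_AE_iff (hN : R.HasWidth N) {φ : R.P} (h : R.Codes e a φ) :
    φ ∈ R.AE ↔ φ ∈ R.PL ∧ ∀ i : Idx c, ∀ x ∈ (R.T (i + 1)).top, ∃ y ∈ (R.T (i + 1)).top,
      R.graphL e a (N i) i x y := by
  rw [AE, Subring.mem_inf, Subring.mem_iInf]
  refine and_congr Iff.rfl (forall_congr' fun i => ⟨fun h1 x hx => ?_, ?_⟩)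
  · obtain ⟨q, hq⟩ := h1 _ ⟨(R.T (i + 1)).cls ⟨x, hx⟩, rfl⟩
    obtain ⟨y, rfl⟩ := CSec.cls_surjective q
    exact ⟨y, y.2, (h.graphL_iff hN i ⟨x, hx.1⟩ ⟨y, y.2.1⟩).2 hq.symm⟩
  · rintro h1 _ ⟨q, rfl⟩
    obtain ⟨x, rfl⟩ := CSec.cls_surjective q
    obtain ⟨y, hy, hxy⟩ := h1 x x.2
    exact ⟨(R.T (i + 1)).cls ⟨y, hy⟩,
      ((h.graphL_iff hN i ⟨x, x.2.1⟩ ⟨y, hy.1⟩).1 hxy).symm⟩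

theorem Codes.mem_ADwide_iff {φ : R.P} (h : R.Codes e a φ) :
    φ ∈ R.ADwide ↔ φ ∈ R.PL ∧ ∀ i : Idx c, ∀ x ∈ (R.D i).top, ∃ y ∈ (R.D i).top,
      R.graphU e a i x y := by
  rw [ADwide, Subring.mem_inf, Subring.mem_iInf]
  refine and_congr Iff.rfl (forall_congr' fun i => ⟨fun h1 x hx => ?_, ?_⟩)
  · obtain ⟨q, hq⟩ := h1 _ ⟨(R.D i).cls ⟨x, hx⟩, rfl⟩
    obtain ⟨y, rfl⟩ := CSec.cls_surjective q
    exact ⟨y, y.2, (h.graphU_iff i ⟨x, hx.2⟩ ⟨y, y.2.2⟩).2 hq.symm⟩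
  · rintro h1 _ ⟨q, rfl⟩
    obtain ⟨x, rfl⟩ := CSec.cls_surjective q
    obtain ⟨y, hy, hxy⟩ := h1 x x.2
    exact ⟨(R.D i).cls ⟨y, hy⟩, ((h.graphU_iff i ⟨x, x.2.2⟩ ⟨y, hy.2⟩).1 hxy).symm⟩

theorem mem_ker_proj_iff (i : ℕ) (x : (R.D i).top) :
    (R.D i).cls x ∈ (R.proj i).ker ↔ (x : H) ∈ (R.X i).bot :=
  (R.X i).cls_eq_zero

theorem Codes.mem_AD_iff {φ : R.P} (h : R.Codes e a φ) :
    φ ∈ R.AD ↔ φ ∈ R.ADwide ∧ ∀ i : Idx c, ∀ x ∈ (R.D i).top, x ∈ (R.X i).bot →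
      ∃ y ∈ (R.D i).top, y ∈ (R.X i).bot ∧ R.graphU e a i x y := by
  rw [AD, Subring.mem_inf, Subring.mem_iInf]
  refine and_congr Iff.rfl (forall_congr' fun i => ⟨fun h1 x hx hx' => ?_, ?_⟩)
  · obtain ⟨q, hq', hq⟩ := h1 _ ⟨(R.D i).cls ⟨x, hx⟩, (mem_ker_proj_iff i ⟨x, hx⟩).2 hx', rfl⟩
    obtain ⟨y, rfl⟩ := CSec.cls_surjective q
    exact ⟨y, y.2, (mem_ker_proj_iff i y).1 hq',
      (h.graphU_iff i ⟨x, hx.2⟩ ⟨y, y.2.2⟩).2 hq.symm⟩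
  · rintro h1 _ ⟨q, hq, rfl⟩
    obtain ⟨x, rfl⟩ := CSec.cls_surjective q
    obtain ⟨y, hy, hy', hxy⟩ := h1 x x.2 ((mem_ker_proj_iff i x).1 hq)
    exact ⟨(R.D i).cls ⟨y, hy⟩, (mem_ker_proj_iff i ⟨y, hy⟩).2 hy',
      ((h.graphU_iff i ⟨x, x.2.2⟩ ⟨y, hy.2⟩).1 hxy).symm⟩

end CentralSeries

end Membership

section Interpretation

universe x y

variable {ι : Type x} {M : ι → Type y} [∀ k, Group (M k)] {c : ℕ}
  {S : ∀ k, CentralSeries (M k) c} {N : ℕ → ℕ}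

/-- Membership in the subrings `B k` of `P_R` is uniformly definable in terms of codes: for codes
formed from variables, it is given by one formula in these variables. -/
def UnifSubring (B : ∀ k, Subring (S k).P) : Prop :=
  ∀ (m : ℕ) (α : Type) (e a : Fin m → α), ∃ χ : ∀ k, (α → M k) → Prop, UnifRel χ ∧
    ∀ k v φ, (S k).Codes (fun j => v (e j)) (fun j => v (a j)) φ → (χ k v ↔ φ ∈ B k)

variable (h : UnifSeries S) (hN : ∀ k, (S k).HasWidth N)

include h hN

theorem UnifSeries.unifSubring_PL : UnifSubring fun k => (S k).PL := fun _ _ e a =>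
  ⟨fun k v => ∀ i : CentralSeries.Idx c, (i : ℕ) + 1 < c → ∀ x ∈ (S k).Rl (i + 1),
      ∀ y ∈ (S k).Rl (i + 1), (S k).graphL (fun j => v (e j)) (fun j => v (a j)) (N i) i x y →
        (S k).graphU (fun j => v (e j)) (fun j => v (a j)) (i + 1) x y,
    .forall_finite fun i => .forall_finite fun _ => .all_mem (h.lower (i + 1))
      (.all_mem (h.lower (i + 1)) (.imp
        (h.graphL (N i) i (fun j => .var (some (some (e j)))) (fun j => .var (some (some (a j))))
          (.var (some none)) (.var none))
        (h.graphU (i + 1) (fun _ => .var _) (fun _ => .var _) (.var _) (.var _)))),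
    fun k _ _ hc => (hc.mem_PL_iff (hN k)).symm⟩

theorem UnifSeries.unifSubring_AE : UnifSubring fun k => (S k).AE := fun m α e a => by
  obtain ⟨χ, hχ, hχ'⟩ := h.unifSubring_PL hN m α e a
  exact ⟨fun k v => χ k v ∧ ∀ i : CentralSeries.Idx c, ∀ x ∈ ((S k).T (i + 1)).top,
      ∃ y ∈ ((S k).T (i + 1)).top, (S k).graphL (fun j => v (e j)) (fun j => v (a j)) (N i) i x y,
    .and hχ (.forall_finite fun i => .all_mem (h.topT (i + 1)) (.ex_mem (h.topT (i + 1))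
      (h.graphL (N i) i (fun j => .var (some (some (e j)))) (fun j => .var (some (some (a j))))
          (.var (some none)) (.var none)))),
    fun k v φ hc => ((hc.mem_AE_iff (hN k)).trans (and_congr (hχ' k v φ hc).symm Iff.rfl)).symm⟩

theorem UnifSeries.unifSubring_ADwide : UnifSubring fun k => (S k).ADwide := fun m α e a => by
  obtain ⟨χ, hχ, hχ'⟩ := h.unifSubring_PL hN m α e a
  exact ⟨fun k v => χ k v ∧ ∀ i : CentralSeries.Idx c, ∀ x ∈ ((S k).D i).top,
      ∃ y ∈ ((S k).D i).top, (S k).graphU (fun j => v (e j)) (fun j => v (a j)) i x y,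
    .and hχ (.forall_finite fun i => .all_mem (h.topD i) (.ex_mem (h.topD i)
      (h.graphU i (fun j => .var (some (some (e j)))) (fun j => .var (some (some (a j))))
          (.var (some none)) (.var none)))),
    fun k v φ hc => (hc.mem_ADwide_iff.trans (and_congr (hχ' k v φ hc).symm Iff.rfl)).symm⟩

theorem UnifSeries.unifSubring_AD : UnifSubring fun k => (S k).AD := fun m α e a => by
  obtain ⟨χ, hχ, hχ'⟩ := h.unifSubring_ADwide hN m α e a
  exact ⟨fun k v => χ k v ∧ ∀ i : CentralSeries.Idx c, ∀ x ∈ ((S k).D i).top,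
      x ∈ ((S k).X i).bot → ∃ y ∈ ((S k).D i).top, y ∈ ((S k).X i).bot ∧
        (S k).graphU (fun j => v (e j)) (fun j => v (a j)) i x y,
    .and hχ (.forall_finite fun i => .all_mem (h.topD i)
      (.imp (.mem (h.botX i) (.var none)) (.ex_mem (h.topD i) (.and (.mem (h.botX i) (.var none))
        (h.graphU i (fun j => .var (some (some (e j)))) (fun j => .var (some (some (a j))))
          (.var (some none)) (.var none)))))),
    fun k v φ hc => (hc.mem_AD_iff.trans (and_congr (hχ' k v φ hc).symm Iff.rfl)).symm⟩

omit h hN in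
theorem UnifSubring.inf {B C : ∀ k, Subring (S k).P} (hB : UnifSubring B) (hC : UnifSubring C) :
    UnifSubring fun k => B k ⊓ C k := fun m α e a => by
  obtain ⟨χ, hχ, hχ'⟩ := hB m α e a
  obtain ⟨χ₁, hχ₁, hχ₁'⟩ := hC m α e a
  exact ⟨_, .and hχ hχ₁, fun k v φ hc =>
    (and_congr (hχ' k v φ hc) (hχ₁' k v φ hc)).trans Subring.mem_inf.symm⟩

theorem UnifSeries.unifSubring_scalars : UnifSubring fun k => (S k).scalars :=
  (h.unifSubring_AE hN).inf (h.unifSubring_AD hN)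

theorem UnifSeries.unifSubring_scalarsWide : UnifSubring fun k => (S k).scalarsWide :=
  (h.unifSubring_AE hN).inf (h.unifSubring_ADwide hN)

/-- The tuple `t` of length `m + m` codes the operator `φ`: its first half is a complete system
and its second half represents the values of `φ` on it. -/
def TupleCodes {H : Type*} [Group H] (R : CentralSeries H c) {m : ℕ} (t : Fin (m + m) → H)
    (φ : R.P) : Prop :=
  R.Codes (fun j => t (Fin.castAdd m j)) (fun j => t (Fin.natAdd m j)) φ

/-- A uniformly definable family of subrings of `P_R` is uniformly interpretable as soon as there
are complete systems of bounded size. -/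
theorem UnifSubring.exists_ringCode {B : ∀ k, Subring (S k).P} (hB : UnifSubring B) {m : ℕ}
    (hm : ∀ k, ∃ e : Fin m → M k, (S k).IsComplete e) :
    ∃ (C : RingCode (m + m)) (π : ∀ k, C.Dom (M k) → B k), (∀ k, C.Interprets (π k)) ∧
      ∀ k t, TupleCodes (S k) t.1 (π k t : (S k).P) := by
  obtain ⟨χ, hχ, hχ'⟩ := hB m (Fin (m + m)) (Fin.castAdd m) (Fin.natAdd m)
  obtain ⟨dom, hdom⟩ := (h.isCode N (Fin.castAdd m) (Fin.natAdd m)).and hχ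
  obtain ⟨eq, heq⟩ : UnifRel (α := Fin (m + m) ⊕ Fin (m + m)) fun k v => ∀ x y,
      (S k).graphV (fun j => v (.inl (Fin.castAdd m j))) (fun j => v (.inl (Fin.natAdd m j))) x y ↔
      (S k).graphV (fun j => v (.inr (Fin.castAdd m j))) (fun j => v (.inr (Fin.natAdd m j)))
        x y :=
    .all (.all (.iff
      (h.graphV (fun _ => .var _) (fun _ => .var _) (.var (some none)) (.var none))
      (h.graphV (fun _ => .var _) (fun _ => .var _) (.var (some none)) (.var none))))
  obtain ⟨zero, hzero⟩ : UnifRel (α := Fin (m + m)) fun k v => ∀ x,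
      (S k).graphV (fun j => v (Fin.castAdd m j)) (fun j => v (Fin.natAdd m j)) x 1 :=
    .all (h.graphV (fun _ => .var _) (fun _ => .var _) (.var none) .one)
  obtain ⟨one, hone⟩ : UnifRel (α := Fin (m + m)) fun k v => ∀ x,
      (S k).graphV (fun j => v (Fin.castAdd m j)) (fun j => v (Fin.natAdd m j)) x x :=
    .all (h.graphV (fun _ => .var _) (fun _ => .var _) (.var none) (.var none))
  obtain ⟨add, hadd⟩ : UnifRel (α := Fin (m + m) ⊕ Fin (m + m) ⊕ Fin (m + m)) fun k v =>
      ∀ x y z,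
      (S k).graphV (fun j => v (.inl (Fin.castAdd m j))) (fun j => v (.inl (Fin.natAdd m j)))
        x y →
      (S k).graphV (fun j => v (.inr (.inl (Fin.castAdd m j))))
        (fun j => v (.inr (.inl (Fin.natAdd m j)))) x z →
      (S k).graphV (fun j => v (.inr (.inr (Fin.castAdd m j))))
        (fun j => v (.inr (.inr (Fin.natAdd m j)))) x (y * z) :=
    .all (.all (.all (.imp
      (h.graphV (fun _ => .var _) (fun _ => .var _) (.var (some (some none))) (.var (some none)))
      (.imp (h.graphV (fun _ => .var _) (fun _ => .var _) (.var (some (some none))) (.var none))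
        (h.graphV (fun _ => .var _) (fun _ => .var _) (.var (some (some none)))
          (.mul (.var (some none)) (.var none)))))))
  -- the product of operators is composition, so the second factor acts first
  obtain ⟨mul, hmul⟩ : UnifRel (α := Fin (m + m) ⊕ Fin (m + m) ⊕ Fin (m + m)) fun k v =>
      ∀ x y z,
      (S k).graphV (fun j => v (.inr (.inl (Fin.castAdd m j))))
        (fun j => v (.inr (.inl (Fin.natAdd m j)))) x y →
      (S k).graphV (fun j => v (.inl (Fin.castAdd m j))) (fun j => v (.inl (Fin.natAdd m j)))
        y z →
      (S k).graphV (fun j => v (.inr (.inr (Fin.castAdd m j))))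
        (fun j => v (.inr (.inr (Fin.natAdd m j)))) x z :=
    .all (.all (.all (.imp
      (h.graphV (fun _ => .var _) (fun _ => .var _) (.var (some (some none))) (.var (some none)))
      (.imp (h.graphV (fun _ => .var _) (fun _ => .var _) (.var (some none)) (.var none))
        (h.graphV (fun _ => .var _) (fun _ => .var _) (.var (some (some none)))
          (.var none))))))
  let C : RingCode (m + m) := ⟨dom, eq, zero, one, add, mul⟩
  have hex : ∀ k (t : C.Dom (M k)), ∃ φ : B k, TupleCodes (S k) t.1 (φ : (S k).P) := by
    intro k t
    obtain ⟨h1, h2⟩ := (hdom k t.1).1 t.2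
    obtain ⟨φ, hφ⟩ := h1.exists_codes
    exact ⟨⟨φ, (hχ' k t.1 φ hφ).1 h2⟩, hφ⟩
  choose π hπ using hex
  -- all ring operations are read off from the faithful action on `G / V_R`
  have hV : ∀ k (t : C.Dom (M k)) (x y : M k),
      (S k).graphV (fun j => t.1 (Fin.castAdd m j)) (fun j => t.1 (Fin.natAdd m j)) x y ↔
        (S k).actV (π k t) ((S k).clV x) = (S k).clV y := fun k t x y =>
    CentralSeries.Codes.graphV_iff (hπ k t) x y
  have hext : ∀ k (φ ψ : B k), (∀ x, (S k).actV φ ((S k).clV x) = (S k).actV ψ ((S k).clV x)) →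
      φ = ψ := fun k φ ψ h1 => Subtype.ext ((S k).P_ext fun x => by
    obtain ⟨x, rfl⟩ := (S k).clV_surjective x
    exact h1 x)
  have hone' : ∀ k, (S k).clV 1 = 0 := fun k => rfl
  refine ⟨C, π, fun k => ⟨?_, ?_, ?_, ?_, ?_, ?_⟩, hπ⟩
  · intro φ
    obtain ⟨e, he⟩ := hm k
    obtain ⟨a, ha⟩ := CentralSeries.exists_codes_of_isComplete he (φ : (S k).P)
    have ht : TupleCodes (S k) (Fin.append e a) (φ : (S k).P) := by
      rw [TupleCodes]
      simpa only [Fin.append_left, Fin.append_right] using ha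
    refine ⟨⟨Fin.append e a, (hdom k _).2 ⟨ht.isCode (hN k), (hχ' k _ _ ht).2 φ.2⟩⟩, ?_⟩
    exact Subtype.ext ((hπ k _).unique ht)
  · intro s t
    refine (heq k _).trans ⟨fun h1 => ?_, fun h1 x y => ?_⟩
    · refine hext k _ _ fun x => ?_
      obtain ⟨y, hy⟩ := (S k).clV_surjective ((S k).actV (π k s) ((S k).clV x))
      rw [← hy]
      exact ((hV k t x y).1 ((h1 x y).1 ((hV k s x y).2 hy.symm))).symm
    · refine (hV k s x y).trans (Iff.trans ?_ (hV k t x y).symm)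
      rw [h1]
  · intro s
    refine (hzero k _).trans ((forall_congr' fun x => hV k s x 1).trans
      ⟨fun h1 => hext k _ _ fun x => ?_, fun h1 x => ?_⟩)
    · rw [h1, Subring.coe_zero, map_zero]
      rfl
    · rw [h1, Subring.coe_zero, map_zero]
      rfl
  · intro s
    refine (hone k _).trans ((forall_congr' fun x => hV k s x x).trans
      ⟨fun h1 => hext k _ _ fun x => ?_, fun h1 x => ?_⟩)
    · rw [h1, Subring.coe_one, map_one]
      rfl
    · rw [h1, Subring.coe_one, map_one]
      rfl
  · intro s t r
    refine (hadd k _).trans ⟨fun h1 => hext k _ _ fun x => ?_, fun h1 x y z h2 h3 => ?_⟩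
    · obtain ⟨y, hy⟩ := (S k).clV_surjective ((S k).actV (π k s) ((S k).clV x))
      obtain ⟨z, hz⟩ := (S k).clV_surjective ((S k).actV (π k t) ((S k).clV x))
      have h2 := (hV k r x (y * z)).1
        (h1 x y z ((hV k s x y).2 hy.symm) ((hV k t x z).2 hz.symm))
      rw [h2, CentralSeries.clV_mul, hy, hz, Subring.coe_add, map_add]
      rfl
    · refine (hV k r x (y * z)).2 ?_
      rw [← h1, CentralSeries.clV_mul, ← (hV k s x y).1 h2, ← (hV k t x z).1 h3, Subring.coe_add,
        map_add]
      rfl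
  · intro s t r
    refine (hmul k _).trans ⟨fun h1 => hext k _ _ fun x => ?_, fun h1 x y z h2 h3 => ?_⟩
    · obtain ⟨y, hy⟩ := (S k).clV_surjective ((S k).actV (π k t) ((S k).clV x))
      obtain ⟨z, hz⟩ := (S k).clV_surjective ((S k).actV (π k s) ((S k).clV y))
      have h2 := (hV k r x z).1 (h1 x y z ((hV k t x y).2 hy.symm) ((hV k s y z).2 hz.symm))
      rw [h2, hz, hy, Subring.coe_mul, map_mul]
      rfl
    · refine (hV k r x z).2 ?_
      rw [← h1, ← (hV k s y z).1 h3, ← (hV k t x y).1 h2, Subring.coe_mul, map_mul]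
      rfl

end Interpretation

/-! ### Definability of the actions -/

section Actions

universe x y

variable {ι : Type x} {M : ι → Type y} [∀ k, Group (M k)] {c : ℕ}
  {S : ∀ k, CentralSeries (M k) c} {N : ℕ → ℕ} {m : ℕ} {C : RingCode (m + m)}
  {B : ∀ k, Subring (S k).P} {π : ∀ k, C.Dom (M k) → B k}

theorem UnifRel.exists_definesAction {s : ∀ k, CSec (M k)}
    {act : ∀ k, B k →+* AddMonoid.End (s k).Q} {Γ : ∀ k, (Fin (m + m) ⊕ Fin 2 → M k) → Prop}
    (hΓ : UnifRel Γ) (h : ∀ k (t : C.Dom (M k)) (y z : (s k).top),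
      Γ k (Sum.elim t.1 ![(y : M k), (z : M k)]) ↔
        act k (π k t) ((s k).cls y) = (s k).cls z) :
    ∃ θ, ∀ k, DefinesAction C θ (π k) (s k) (act k) := by
  obtain ⟨θ, hθ⟩ := hΓ
  exact ⟨θ, fun k t y z => (hθ k _).trans (h k t y z)⟩

variable (h : UnifSeries S) (hπ : ∀ k t, TupleCodes (S k) t.1 (π k t : (S k).P))

include h hπ

namespace UnifSeries

theorem exists_definesAction_V {act : ∀ k, B k →+* AddMonoid.End (S k).topV.Q}
    (hact : ∀ k b, act k b = (S k).actV b) :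
    ∃ θ, ∀ k, DefinesAction C θ (π k) (S k).topV (act k) := by
  refine (h.graphV (α := Fin (m + m) ⊕ Fin 2) (fun j => .var (.inl (Fin.castAdd m j)))
    (fun j => .var (.inl (Fin.natAdd m j)))
    (.var (.inr 0)) (.var (.inr 1))).exists_definesAction fun k t y z => ?_
  rw [hact]
  exact CentralSeries.Codes.graphV_iff (hπ k t) y z

theorem exists_definesAction_U (i : CentralSeries.Idx c)
    {act : ∀ k, B k →+* AddMonoid.End ((S k).U i).Q} (hact : ∀ k b, act k b = (S k).actU i b) :
    ∃ θ, ∀ k, DefinesAction C θ (π k) ((S k).U i) (act k) := by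
  refine (h.graphU (α := Fin (m + m) ⊕ Fin 2) i (fun j => .var (.inl (Fin.castAdd m j)))
    (fun j => .var (.inl (Fin.natAdd m j)))
    (.var (.inr 0)) (.var (.inr 1))).exists_definesAction fun k t y z => ?_
  rw [hact]
  exact CentralSeries.Codes.graphU_iff (hπ k t) i y z

theorem exists_definesAction_D (i : CentralSeries.Idx c)
    {act : ∀ k, B k →+* AddMonoid.End ((S k).D i).Q}
    (hact : ∀ k b x, (S k).delta i (act k b x) = (S k).actU i b ((S k).delta i x)) :
    ∃ θ, ∀ k, DefinesAction C θ (π k) ((S k).D i) (act k) := by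
  refine (h.graphU (α := Fin (m + m) ⊕ Fin 2) i (fun j => .var (.inl (Fin.castAdd m j)))
    (fun j => .var (.inl (Fin.natAdd m j)))
    (.var (.inr 0)) (.var (.inr 1))).exists_definesAction fun k t y z => ?_
  rw [← ((S k).delta_injective i).eq_iff, hact]
  exact CentralSeries.Codes.graphU_iff (hπ k t) i ⟨y, y.2.2⟩ ⟨z, z.2.2⟩

/-- On `X_i` the operator is applied to representatives of classes of `D_i`. -/
theorem exists_definesAction_X (i : CentralSeries.Idx c)
    {actD : ∀ k, B k →+* AddMonoid.End ((S k).D i).Q}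
    (hactD : ∀ k b x, (S k).delta i (actD k b x) = (S k).actU i b ((S k).delta i x))
    {act : ∀ k, B k →+* AddMonoid.End ((S k).X i).Q}
    (hact : ∀ k b x, act k b ((S k).proj i x) = (S k).proj i (actD k b x)) :
    ∃ θ, ∀ k, DefinesAction C θ (π k) ((S k).X i) (act k) := by
  have hrel : UnifRel (α := Fin (m + m) ⊕ Fin 2) fun k v =>
      ∃ d ∈ ((S k).D i).top, ∃ d' ∈ ((S k).D i).top,
        v (.inr 0) * d⁻¹ ∈ ((S k).X i).bot ∧ v (.inr 1) * d'⁻¹ ∈ ((S k).X i).bot ∧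
        (S k).graphU (fun j => v (.inl (Fin.castAdd m j)))
          (fun j => v (.inl (Fin.natAdd m j))) i d d' :=
    .ex_mem (h.topD i) (.ex_mem (h.topD i) (.and
      (.mem (h.botX i) (.mul_inv (.var _) (.var (some none))))
      (.and (.mem (h.botX i) (.mul_inv (.var _) (.var none)))
        (h.graphU i (fun _ => .var _) (fun _ => .var _) (.var (some none)) (.var none)))))
  refine hrel.exists_definesAction fun k t y z => ?_
  have key : ∀ d d' : ((S k).D i).top,
      (S k).graphU (fun j => t.1 (Fin.castAdd m j)) (fun j => t.1 (Fin.natAdd m j)) i d d' ↔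
        actD k (π k t) (((S k).D i).cls d) = ((S k).D i).cls d' := fun d d' => by
    rw [← ((S k).delta_injective i).eq_iff, hactD]
    exact CentralSeries.Codes.graphU_iff (hπ k t) i ⟨d, d.2.2⟩ ⟨d', d'.2.2⟩
  constructor
  · rintro ⟨d, hd, d', hd', h1, h2, h3⟩
    have h1' : ((S k).X i).cls y = (S k).proj i (((S k).D i).cls ⟨d, hd⟩) :=
      ((S k).X i).cls_eq_of h1
    have h2' : ((S k).X i).cls z = (S k).proj i (((S k).D i).cls ⟨d', hd'⟩) :=
      ((S k).X i).cls_eq_of h2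
    rw [h1', h2', hact, (key ⟨d, hd⟩ ⟨d', hd'⟩).1 h3]
  · intro h1
    obtain ⟨q, hq⟩ := (S k).proj_surjective i (((S k).X i).cls y)
    obtain ⟨d, rfl⟩ := CSec.cls_surjective q
    obtain ⟨d', hd'⟩ := CSec.cls_surjective (actD k (π k t) (((S k).D i).cls d))
    rw [← hq, hact, ← hd'] at h1
    exact ⟨d, d.2, d', d'.2, ((S k).X i).cls_eq_iff.1 hq.symm,
      ((S k).X i).cls_eq_iff.1 h1.symm, (key d d').2 hd'.symm⟩

variable (hN : ∀ k, (S k).HasWidth N)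

include hN

theorem exists_definesAction_L (i : CentralSeries.Idx c)
    {act : ∀ k, B k →+* AddMonoid.End ((S k).L (i + 1)).Q}
    (hact : ∀ k b, act k b = (S k).actL i b) :
    ∃ θ, ∀ k, DefinesAction C θ (π k) ((S k).L (i + 1)) (act k) := by
  refine (h.graphL (α := Fin (m + m) ⊕ Fin 2) (N i) i (fun j => .var (.inl (Fin.castAdd m j)))
    (fun j => .var (.inl (Fin.natAdd m j)))
    (.var (.inr 0)) (.var (.inr 1))).exists_definesAction fun k t y z => ?_
  rw [hact]
  exact CentralSeries.Codes.graphL_iff (hN k) (hπ k t) i y z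

theorem exists_definesAction_T (i : CentralSeries.Idx c)
    {act : ∀ k, B k →+* AddMonoid.End ((S k).T (i + 1)).Q}
    (hact : ∀ k b x, (S k).eps (i + 1) (act k b x) = (S k).actL i b ((S k).eps (i + 1) x)) :
    ∃ θ, ∀ k, DefinesAction C θ (π k) ((S k).T (i + 1)) (act k) := by
  refine (h.graphL (α := Fin (m + m) ⊕ Fin 2) (N i) i (fun j => .var (.inl (Fin.castAdd m j)))
    (fun j => .var (.inl (Fin.natAdd m j)))
    (.var (.inr 0)) (.var (.inr 1))).exists_definesAction fun k t y z => ?_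
  rw [← ((S k).eps_injective (i + 1)).eq_iff, hact]
  exact CentralSeries.Codes.graphL_iff (hN k) (hπ k t) i ⟨y, y.2.1⟩ ⟨z, z.2.1⟩

end UnifSeries

end Actions

namespace CentralSeries

variable {H : Type*} [Group H] {c : ℕ} (R : CentralSeries H c) (i : Idx c)

theorem wideV_apply (b : R.scalarsWide) : R.wideV b = R.actV b :=
  RingHom.comp_apply _ _ _

theorem eps_wideT (b : R.scalarsWide) (x : (R.T (i + 1)).Q) :
    R.eps (i + 1) (R.wideT i b x) = R.actL i b (R.eps (i + 1) x) :=
  (restrictAct_spec _ _ _ _ b x).trans (by rw [wideL_apply])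

theorem delta_wideD_apply (b : R.scalarsWide) (x : (R.D i).Q) :
    R.delta i (R.wideD i b x) = R.actU i b (R.delta i x) := by
  rw [delta_wideD, wideU_apply]

variable (b : R.scalars)

theorem wideV_toWide : R.wideV.comp R.toWide b = R.actV b := by
  rw [RingHom.comp_apply, wideV_apply, coe_toWide]

theorem wideU_toWide : (R.wideU i).comp R.toWide b = R.actU i b := by
  rw [RingHom.comp_apply, wideU_apply, coe_toWide]

theorem wideL_toWide : (R.wideL i).comp R.toWide b = R.actL i b := by
  rw [RingHom.comp_apply, wideL_apply, coe_toWide]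

theorem eps_wideT_toWide (x : (R.T (i + 1)).Q) :
    R.eps (i + 1) ((R.wideT i).comp R.toWide b x) = R.actL i b (R.eps (i + 1) x) := by
  rw [RingHom.comp_apply, eps_wideT, coe_toWide]

theorem delta_wideD_toWide (x : (R.D i).Q) :
    R.delta i ((R.wideD i).comp R.toWide b x) = R.actU i b (R.delta i x) := by
  rw [RingHom.comp_apply, delta_wideD_apply, coe_toWide]

theorem actX_proj (x : (R.D i).Q) :
    R.actX i b (R.proj i x) = R.proj i ((R.wideD i).comp R.toWide b x) :=
  descendAct_spec _ _ _ _ b x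

end CentralSeries

/-! ### Models of the theory of the group -/

section Models

open Language

/-- The groups in a fixed universe that are models of a theory; they form the index type over which
relations are to be uniformly definable. -/
structure GroupModel (T : groupLang.Theory) where
  /-- the underlying type -/
  carrier : Type v
  [group : Group carrier]
  models : carrier ⊨ T

instance (T : groupLang.Theory) (k : GroupModel.{v} T) : Group k.carrier := k.group

theorem UnifSubgroup.unifDefinable {T : groupLang.Theory}
    {K : ∀ (H : Type v) [Group H], H ⊨ T → Subgroup H}
    (h : UnifSubgroup fun k : GroupModel.{v} T => K k.carrier k.models) : UnifDefinable T K := by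
  obtain ⟨θ, hθ⟩ := h
  exact ⟨θ, fun H _ hH => hθ ⟨H, hH⟩⟩

/-- Formulas for the terms of a central series of length `c`, extended to all indices by the
forced values of the terms of index `0` and greater than `c`. -/
noncomputable def extendFormulas (ρ : ℕ → groupLang.Formula (Fin 1)) (c i : ℕ) :
    groupLang.Formula (Fin 1) :=
  if i = 0 then ⊤ else if i ≤ c then ρ i else Term.equal (Term.var 0) GroupTerm.one

theorem defines_extendFormulas {G : Type*} [Group G] {c : ℕ} (R : CentralSeries G c)
    {ρ : ℕ → groupLang.Formula (Fin 1)}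
    (hρ : ∀ i ∈ Finset.Icc 1 (c + 1), Defines (ρ i) (R.term i)) (i : ℕ) :
    Defines (extendFormulas ρ c i) (R.term i) := fun x => by
  unfold extendFormulas
  split_ifs with h1 h2
  · subst h1
    have : x ∈ R.term 0 := R.anti zero_le_one (R.first ▸ Subgroup.mem_top x)
    exact ⟨fun _ => this, fun _ => Formula.realize_top.2 trivial⟩
  · exact hρ i (Finset.mem_Icc.2 ⟨by omega, by omega⟩) x
  · have : R.term i = ⊥ := le_bot_iff.1 (R.last ▸ R.anti (by omega))
    rw [this, Subgroup.mem_bot, Formula.realize_equal, Term.realize_var, GroupTerm.realize_one]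

variable {G : Type u} [Group G] {H : Type v} [Group H] {c : ℕ}

theorem defines_of_model {R : CentralSeries G c} {ρ : ℕ → groupLang.Formula (Fin 1)}
    (hρ : ∀ i ∈ Finset.Icc 1 (c + 1), Defines (ρ i) (R.term i))
    (h : H ⊨ groupLang.completeTheory G) {R' : CentralSeries H c}
    (hR' : ∀ i, Defines (extendFormulas ρ c i) (R'.term i)) :
    ∀ i ∈ Finset.Icc 1 (c + 1), Defines (ρ i) (R'.term i) := fun i hi x => by
  rw [← hR' i x]
  have h1 := realize_of_model h (β := Fin 1) ((ρ i).iff (extendFormulas ρ c i)) (fun v => by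
    obtain ⟨y, rfl⟩ : ∃ y, v = fun _ => y := ⟨v 0, funext fun j => by rw [Subsingleton.elim j 0]⟩
    rw [Formula.realize_iff, hρ i hi y, defines_extendFormulas R hρ i y]) fun _ => x
  exact Formula.realize_iff.1 h1

/-- Bounds for the widths pass to elementarily equivalent groups: it is a first-order property that
every product of `n + 1` commutators is a product of `n` commutators. -/
theorem hasWidth_of_model {σ : ℕ → groupLang.Formula (Fin 1)} {N : ℕ → ℕ}
    {R : CentralSeries G c} (hR : ∀ i, Defines (σ i) (R.term i)) (hN : R.HasWidth N)
    (h : H ⊨ groupLang.completeTheory G) {R' : CentralSeries H c}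
    (hR' : ∀ i, Defines (σ i) (R'.term i)) : R'.HasWidth N := fun i => by
  refine coe_commutator_eq_commWidth fun x hx => ?_
  have h1 := realize_of_model h (β := Fin 1) ((widthFormula (σ i) (N i + 1)).imp
    (widthFormula (σ i) (N i))) (fun v => by
      obtain ⟨y, rfl⟩ : ∃ y, v = fun _ => y :=
        ⟨v 0, funext fun j => by rw [Subsingleton.elim j 0]⟩
      rw [Formula.realize_imp, realize_widthFormula (hR i), realize_widthFormula (hR i), ← hN i]
      exact fun hy => commWidth_le _ hy) fun _ => x
  rw [Formula.realize_imp, realize_widthFormula (hR' i), realize_widthFormula (hR' i)] at h1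
  exact h1 hx

theorem exists_isComplete_of_model {σ : ℕ → groupLang.Formula (Fin 1)} {N : ℕ → ℕ}
    {R : CentralSeries G c} (hR : ∀ i, Defines (σ i) (R.term i)) (hN : R.HasWidth N) {m : ℕ}
    (hm : ∃ e : Fin m → G, R.IsComplete e)
    (h : H ⊨ groupLang.completeTheory G) {R' : CentralSeries H c}
    (hR' : ∀ i, Defines (σ i) (R'.term i)) : ∃ e : Fin m → H, R'.IsComplete e :=
  (realize_completeSentence hR' (hasWidth_of_model hR hN h hR') m default).1
    (realize_of_model h _ (fun v => (realize_completeSentence hR hN m v).2 hm) default)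

/-- The widths of the subgroups `[R_i, G]` are finite, under either of the two alternative
hypotheses on the ring of exponents and the series. -/
theorem CentralSeries.exists_hasWidth {A : Type w} [CommRing A] [BinomialRing A]
    [Group.IsNilpotent G] [ExpGroup A G] (hfg : ExpFG A G) (R : CentralSeries G c)
    (hA : IsNoetherianRing A ∨ ∀ i, IsExpSubgroup A (R.term i)) : ∃ N, R.HasWidth N := by
  have h : ∀ i, ∃ n, ((⁅R.term i, (⊤ : Subgroup G)⁆ : Subgroup G) : Set G) ⊆
      commWidth (R.term i) n := fun i => by
    rcases hA with hA | hA
    · exact exists_width_of_isNoetherianRing (A := A) hfg _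
    · exact exists_width_of_isExpSubgroup hfg _ (hA i)
  choose N hN using h
  exact ⟨N, fun i => (hN i).antisymm (commWidth_le _)⟩

/-- Interpretation of the rings `A_R` and of their actions in all models of a theory in which the
widths and the sizes of complete systems are bounded. -/
theorem exists_interpretation_scalars {T : groupLang.Theory} {c : ℕ}
    {S : ∀ (H : Type v) [Group H], H ⊨ T → CentralSeries H c}
    (hU : UnifSeries fun k : GroupModel.{v} T => S k.carrier k.models) {N : ℕ → ℕ}
    (hN : ∀ k : GroupModel.{v} T, (S k.carrier k.models).HasWidth N) {m : ℕ}
    (hm : ∀ k : GroupModel.{v} T, ∃ e : Fin m → k.carrier, (S k.carrier k.models).IsComplete e) :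
    ∃ (n : ℕ) (C : RingCode n)
    (π : ∀ (H : Type v) [Group H] (h : H ⊨ T),
      C.Dom H → (S H h).scalars),
    (∀ (H : Type v) [Group H] (h : H ⊨ T),
      C.Interprets (π H h)) ∧
    (∀ i : CentralSeries.Idx c, ∃ θ,
      ∀ (H : Type v) [Group H] (h : H ⊨ T),
        DefinesAction C θ (π H h) ((S H h).U i)
          (((S H h).wideU i).comp (S H h).toWide)) ∧
    (∀ i : CentralSeries.Idx c, ∃ θ,
      ∀ (H : Type v) [Group H] (h : H ⊨ T),
        DefinesAction C θ (π H h) ((S H h).T (i + 1))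
          (((S H h).wideT i).comp (S H h).toWide)) ∧
    (∃ θ, ∀ (H : Type v) [Group H] (h : H ⊨ T),
        DefinesAction C θ (π H h) (S H h).topV
          ((S H h).wideV.comp (S H h).toWide)) ∧
    (∀ i : CentralSeries.Idx c, ∃ θ,
      ∀ (H : Type v) [Group H] (h : H ⊨ T),
        DefinesAction C θ (π H h) ((S H h).X i) ((S H h).actX i)) ∧
    (∀ i : CentralSeries.Idx c, ∃ θ,
      ∀ (H : Type v) [Group H] (h : H ⊨ T),
        DefinesAction C θ (π H h) ((S H h).L (i + 1))
          (((S H h).wideL i).comp (S H h).toWide)) := by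
  obtain ⟨C, π, hint, hπ⟩ := (hU.unifSubring_scalars hN).exists_ringCode hU hN hm
  refine ⟨m + m, C, fun H _ h => π ⟨H, h⟩, fun H _ h => hint ⟨H, h⟩, fun i => ?_, fun i => ?_,
    ?_, fun i => ?_, fun i => ?_⟩
  · obtain ⟨θ, hθ⟩ := hU.exists_definesAction_U hπ i
      fun k => (S k.carrier k.models).wideU_toWide i
    exact ⟨θ, fun H _ h => hθ ⟨H, h⟩⟩
  · obtain ⟨θ, hθ⟩ := hU.exists_definesAction_T hπ hN i
      fun k => (S k.carrier k.models).eps_wideT_toWide i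
    exact ⟨θ, fun H _ h => hθ ⟨H, h⟩⟩
  · obtain ⟨θ, hθ⟩ := hU.exists_definesAction_V hπ
      fun k => (S k.carrier k.models).wideV_toWide
    exact ⟨θ, fun H _ h => hθ ⟨H, h⟩⟩
  · obtain ⟨θ, hθ⟩ := hU.exists_definesAction_X hπ i
      (fun k => (S k.carrier k.models).delta_wideD_toWide i)
      fun k => (S k.carrier k.models).actX_proj i
    exact ⟨θ, fun H _ h => hθ ⟨H, h⟩⟩
  · obtain ⟨θ, hθ⟩ := hU.exists_definesAction_L hπ hN i
      fun k => (S k.carrier k.models).wideL_toWide i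
    exact ⟨θ, fun H _ h => hθ ⟨H, h⟩⟩

/-- Interpretation of the rings `Â_R` and of their actions in all models of a theory in which the
widths and the sizes of complete systems are bounded. -/
theorem exists_interpretation_scalarsWide {T : groupLang.Theory} {c : ℕ}
    {S : ∀ (H : Type v) [Group H], H ⊨ T → CentralSeries H c}
    (hU : UnifSeries fun k : GroupModel.{v} T => S k.carrier k.models) {N : ℕ → ℕ}
    (hN : ∀ k : GroupModel.{v} T, (S k.carrier k.models).HasWidth N) {m : ℕ}
    (hm : ∀ k : GroupModel.{v} T, ∃ e : Fin m → k.carrier, (S k.carrier k.models).IsComplete e) :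
    ∃ (n : ℕ) (C : RingCode n)
    (π : ∀ (H : Type v) [Group H] (h : H ⊨ T),
      C.Dom H → (S H h).scalarsWide),
    (∀ (H : Type v) [Group H] (h : H ⊨ T),
      C.Interprets (π H h)) ∧
    (∀ i : CentralSeries.Idx c, ∃ θ,
      ∀ (H : Type v) [Group H] (h : H ⊨ T),
        DefinesAction C θ (π H h) ((S H h).U i) ((S H h).wideU i)) ∧
    (∀ i : CentralSeries.Idx c, ∃ θ,
      ∀ (H : Type v) [Group H] (h : H ⊨ T),
        DefinesAction C θ (π H h) ((S H h).T (i + 1)) ((S H h).wideT i)) ∧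
    (∃ θ, ∀ (H : Type v) [Group H] (h : H ⊨ T),
        DefinesAction C θ (π H h) (S H h).topV (S H h).wideV) ∧
    (∀ i : CentralSeries.Idx c, ∃ θ,
      ∀ (H : Type v) [Group H] (h : H ⊨ T),
        DefinesAction C θ (π H h) ((S H h).D i) ((S H h).wideD i)) ∧
    (∀ i : CentralSeries.Idx c, ∃ θ,
      ∀ (H : Type v) [Group H] (h : H ⊨ T),
        DefinesAction C θ (π H h) ((S H h).L (i + 1)) ((S H h).wideL i)) := by
  obtain ⟨C, π, hint, hπ⟩ := (hU.unifSubring_scalarsWide hN).exists_ringCode hU hN hm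
  refine ⟨m + m, C, fun H _ h => π ⟨H, h⟩, fun H _ h => hint ⟨H, h⟩, fun i => ?_, fun i => ?_,
    ?_, fun i => ?_, fun i => ?_⟩
  · obtain ⟨θ, hθ⟩ := hU.exists_definesAction_U hπ i
      fun k => (S k.carrier k.models).wideU_apply i
    exact ⟨θ, fun H _ h => hθ ⟨H, h⟩⟩
  · obtain ⟨θ, hθ⟩ := hU.exists_definesAction_T hπ hN i
      fun k => (S k.carrier k.models).eps_wideT i
    exact ⟨θ, fun H _ h => hθ ⟨H, h⟩⟩
  · obtain ⟨θ, hθ⟩ := hU.exists_definesAction_V hπ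
      fun k => (S k.carrier k.models).wideV_apply
    exact ⟨θ, fun H _ h => hθ ⟨H, h⟩⟩
  · obtain ⟨θ, hθ⟩ := hU.exists_definesAction_D hπ i
      fun k => (S k.carrier k.models).delta_wideD_apply i
    exact ⟨θ, fun H _ h => hθ ⟨H, h⟩⟩
  · obtain ⟨θ, hθ⟩ := hU.exists_definesAction_L hπ hN i
      fun k => (S k.carrier k.models).wideL_apply i
    exact ⟨θ, fun H _ h => hθ ⟨H, h⟩⟩

end Models

end NilScalars

theorem mainTheorem10
    {A : Type w} [CommRing A] [IsDomain A] [BinomialRing A]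
    {G : Type u} [Group G] [Group.IsNilpotent G] [NilScalars.ExpGroup A G]
    (hfg : NilScalars.ExpFG A G)
    (c : ℕ) (R : NilScalars.CentralSeries G c)
    (hA : IsNoetherianRing A ∨ ∀ i, NilScalars.IsExpSubgroup A (R.term i))
    (ρ : ℕ → NilScalars.groupLang.Formula (Fin 1))
    (hρ : ∀ i ∈ Finset.Icc 1 (c + 1), NilScalars.Defines (ρ i) (R.term i)) :
    ∃ S : ∀ (H : Type v) [Group H],
        H ⊨ NilScalars.groupLang.completeTheory G → NilScalars.CentralSeries H c,
      -- the series in `H ≡ G` given by the formulas `ρ`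
      (∀ (H : Type v) [Group H] (h : H ⊨ NilScalars.groupLang.completeTheory G),
        ∀ i ∈ Finset.Icc 1 (c + 1), NilScalars.Defines (ρ i) ((S H h).term i)) ∧
      -- (1) the terms of the refined upper series
      (∀ i ∈ Finset.Icc 1 c,
        NilScalars.UnifDefinable.{v} (NilScalars.groupLang.completeTheory G)
          fun H _ h => (S H h).Ru i) ∧
      (∀ i ∈ Finset.Icc 2 (c + 1),
        NilScalars.UnifDefinable.{v} (NilScalars.groupLang.completeTheory G)
          fun H _ h => (S H h).Rl i ⊓ Subgroup.center H) ∧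
      -- (2) the terms of the refined lower series
      (NilScalars.UnifDefinable.{v} (NilScalars.groupLang.completeTheory G)
        fun H _ h => (S H h).V) ∧
      (∀ i ∈ Finset.Icc 1 c,
        NilScalars.UnifDefinable.{v} (NilScalars.groupLang.completeTheory G)
          fun H _ h => ((S H h).V ⊓ (S H h).Ru i) ⊔ commutator H) ∧
      (∀ i ∈ Finset.Icc 2 (c + 1),
        NilScalars.UnifDefinable.{v} (NilScalars.groupLang.completeTheory G)
          fun H _ h => (S H h).Rl i) ∧
      -- (3) the ring `A_R`, and its action on all quotients of the two refined series
      -- other than the special gap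
      (∃ (n : ℕ) (C : NilScalars.RingCode n)
        (π : ∀ (H : Type v) [Group H] (h : H ⊨ NilScalars.groupLang.completeTheory G),
          C.Dom H → (S H h).scalars),
        (∀ (H : Type v) [Group H] (h : H ⊨ NilScalars.groupLang.completeTheory G),
          C.Interprets (π H h)) ∧
        -- (a) the upper series: `R^u_i / R^u_{i+1}` and `T_{i+1}`
        (∀ i : NilScalars.CentralSeries.Idx c, ∃ θ,
          ∀ (H : Type v) [Group H] (h : H ⊨ NilScalars.groupLang.completeTheory G),
            NilScalars.DefinesAction C θ (π H h) ((S H h).U i)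
              (((S H h).wideU i).comp (S H h).toWide)) ∧
        (∀ i : NilScalars.CentralSeries.Idx c, ∃ θ,
          ∀ (H : Type v) [Group H] (h : H ⊨ NilScalars.groupLang.completeTheory G),
            NilScalars.DefinesAction C θ (π H h) ((S H h).T (i + 1))
              (((S H h).wideT i).comp (S H h).toWide)) ∧
        -- (b) the lower series: `G / V_R`, `X_i` and `R^l_{i+1} / R^l_{i+2}`
        (∃ θ, ∀ (H : Type v) [Group H] (h : H ⊨ NilScalars.groupLang.completeTheory G),
            NilScalars.DefinesAction C θ (π H h) (S H h).topV
              ((S H h).wideV.comp (S H h).toWide)) ∧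
        (∀ i : NilScalars.CentralSeries.Idx c, ∃ θ,
          ∀ (H : Type v) [Group H] (h : H ⊨ NilScalars.groupLang.completeTheory G),
            NilScalars.DefinesAction C θ (π H h) ((S H h).X i) ((S H h).actX i)) ∧
        (∀ i : NilScalars.CentralSeries.Idx c, ∃ θ,
          ∀ (H : Type v) [Group H] (h : H ⊨ NilScalars.groupLang.completeTheory G),
            NilScalars.DefinesAction C θ (π H h) ((S H h).L (i + 1))
              (((S H h).wideL i).comp (S H h).toWide))) ∧
      -- the same for the larger ring `Â_R`, with `D_i` in place of `X_i`
      (∃ (n : ℕ) (C : NilScalars.RingCode n)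
        (π : ∀ (H : Type v) [Group H] (h : H ⊨ NilScalars.groupLang.completeTheory G),
          C.Dom H → (S H h).scalarsWide),
        (∀ (H : Type v) [Group H] (h : H ⊨ NilScalars.groupLang.completeTheory G),
          C.Interprets (π H h)) ∧
        (∀ i : NilScalars.CentralSeries.Idx c, ∃ θ,
          ∀ (H : Type v) [Group H] (h : H ⊨ NilScalars.groupLang.completeTheory G),
            NilScalars.DefinesAction C θ (π H h) ((S H h).U i) ((S H h).wideU i)) ∧
        (∀ i : NilScalars.CentralSeries.Idx c, ∃ θ,
          ∀ (H : Type v) [Group H] (h : H ⊨ NilScalars.groupLang.completeTheory G),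
            NilScalars.DefinesAction C θ (π H h) ((S H h).T (i + 1)) ((S H h).wideT i)) ∧
        (∃ θ, ∀ (H : Type v) [Group H] (h : H ⊨ NilScalars.groupLang.completeTheory G),
            NilScalars.DefinesAction C θ (π H h) (S H h).topV (S H h).wideV) ∧
        (∀ i : NilScalars.CentralSeries.Idx c, ∃ θ,
          ∀ (H : Type v) [Group H] (h : H ⊨ NilScalars.groupLang.completeTheory G),
            NilScalars.DefinesAction C θ (π H h) ((S H h).D i) ((S H h).wideD i)) ∧
        (∀ i : NilScalars.CentralSeries.Idx c, ∃ θ,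
          ∀ (H : Type v) [Group H] (h : H ⊨ NilScalars.groupLang.completeTheory G),
            NilScalars.DefinesAction C θ (π H h) ((S H h).L (i + 1)) ((S H h).wideL i))) := by
  have hσ := NilScalars.defines_extendFormulas R hρ
  obtain ⟨N, hN⟩ := R.exists_hasWidth hfg hA
  obtain ⟨m, hm⟩ := NilScalars.CentralSeries.exists_isComplete (A := A) hfg R
  have hG := NilScalars.IsSeries.of_defines R hσ
  let S : ∀ (H : Type v) [Group H],
      H ⊨ NilScalars.groupLang.completeTheory G → NilScalars.CentralSeries H c :=
    fun H _ h => (hG.of_model h).series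
  have hS : ∀ (H : Type v) [Group H] (h : H ⊨ NilScalars.groupLang.completeTheory G) (i : ℕ),
      NilScalars.Defines (NilScalars.extendFormulas ρ c i) ((S H h).term i) :=
    fun H _ h => (hG.of_model h).defines_series
  let S' : ∀ k : NilScalars.GroupModel.{v} (NilScalars.groupLang.completeTheory G),
    NilScalars.CentralSeries k.carrier c := fun k => S k.carrier k.models
  have hN' : ∀ k, (S' k).HasWidth N := fun k =>
    NilScalars.hasWidth_of_model hσ hN k.models (hS k.carrier k.models)
  have hm' : ∀ k, ∃ e : Fin m → k.carrier, (S' k).IsComplete e := fun k =>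
    NilScalars.exists_isComplete_of_model hσ hN hm k.models (hS k.carrier k.models)
  have hU : NilScalars.UnifSeries S' :=
    { lower := fun i => ⟨_, fun k =>
        NilScalars.defines_lowerFormula (hS k.carrier k.models) (hN' k) i⟩
      upper := fun i => ⟨_, fun k =>
        NilScalars.defines_upperFormula (hS k.carrier k.models) (hN' k) i⟩ }
  exact ⟨S, fun H _ h => NilScalars.defines_of_model hρ h (hS H h),
    fun i _ => (hU.upper i).unifDefinable,
    fun i _ => ((hU.lower i).inf .center).unifDefinable,
    hU.V.unifDefinable, fun i _ => (hU.topX i).unifDefinable,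
    fun i _ => (hU.lower i).unifDefinable,
    NilScalars.exists_interpretation_scalars hU hN' hm',
    NilScalars.exists_interpretation_scalarsWide hU hN' hm'⟩
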